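/- **Theorem.** Let $d\ge 0$ be fixed, $\beta\in\mathbb R^d$, and for each $n$ let observations $(y_i,x_i',w_i')$, $1\le i\le n$, with $x_i\in\mathbb R^d$, $w_i\in\mathbb R^{k}$, $k=k_n$, be random variables on a probability space (which, like all the objects below, may depend on $n$) such that $y_i=\beta'x_i+\gamma'w_i+u_i$ with $\gamma\in\mathbb R^{k}$ and $x_i,w_i,u_i$ square integrable. Let $\mathcal X_n=(x_1,\dots,x_n)$, and let $\mathcal W_n$ be a sub-$\sigma$-algebra for which $w_1,\dots,w_n$ are measurable (for example $\sigma(w_1,\dots,w_n)$); conditioning on $(\mathcal X_n,\mathcal W_n)$ means conditioning on $\sigma(\mathcal X_n)\vee\mathcal W_n$. Let $G$ be a (nonrandom) partition of $\{1,\dots,n\}$ into clusters. Put $$V_i=x_i-E[x_i|\mathcal W_n],\quad \alpha'=\Big(\sum_jE[x_jw_j']\Big)\Big(\sum_jE[w_jw_j']\Big)^{-1},\quad v_i=x_i-\alpha'w_i,\quad Q_i=E[v_i|\mathcal W_n],$$ and, with $W$ the $n\times k$ matrix with rows $w_i'$, $$M=I-W(W'W)^{-1}W',\quad \tilde V_i=\sum_jM_{ij}V_j,\quad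 \hat v_i=\sum_jM_{ij}x_j,\quad \hat\Gamma=\frac1n\sum_i\hat v_i\hat v_i',\quad S=\frac1{\sqrt n}\sum_i\hat v_iu_i,$$ $$\Sigma=\frac1n\sum_{g\in G}\sum_{i,j\in g}\hat v_i\hat v_j'\,E[u_iu_j|\mathcal X_n,\mathcal W_n],\qquad \hat\beta=1\{\lambda_{\min}(\hat\Gamma)>0\}\,\hat\Gamma^{-1}\Big(\frac1n\sum_i\hat v_iy_i\Big).$$ (An inverse of a singular matrix is read as $0$, $1/\lambda_{\min}$ of a singular matrix is $\infty$, and $\lambda_{\min}$ of an empty matrix is $\infty$.) Assume: 1. $\max_{g\in G}|g|=O(1)$; the families $\{(u_i,V_i'):i\in g\}$ are independent across $g\in G$ conditionally on $(\mathcal X_n,\mathcal W_n)$; and the families $\{V_i:i\in g\}$ are independent across $g\in G$ conditionally on $\mathcal W_n$. 2. $P[\lambda_{\min}(\sum_iw_iw_i')>0]\to1$, $\limsup_n k/n<1$, and $$\max_{1\le i\le n}\Big\{E[u_i^4|\mathcal X_n,\mathcal W_n]+E[\|V_i\|^4|\mathcal W_n]+\frac1{\lambda_{\min}(E[uu'|\mathcal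 X_n,\mathcal W_n])}+\frac1{\lambda_{\min}(E[\frac1n\sum_i\tilde V_i\tilde V_i'|\mathcal W_n])}\Big\}=O_p(1),$$ where $u=(u_1,\dots,u_n)'$. 3. $E[u_i|\mathcal X_n,\mathcal W_n]=0$ for all $i$, $\chi=\frac1n\sum_iE\|Q_i\|^2=O(1)$, and $\max_i\|\hat v_i\|/\sqrt n=o_p(1)$. Then, wherever $\lambda_{\min}(\sum_iw_iw_i')>0$ and $\lambda_{\min}(\hat\Gamma)>0$, $$\sqrt n(\hat\beta-\beta)=\hat\Gamma^{-1}S ,$$ and, with $\Omega=\hat\Gamma^{-1}\Sigma\hat\Gamma^{-1}$ and $\Omega^{-1/2}$ the inverse of its symmetric positive semidefinite square root, $$\Omega^{-1/2}\sqrt n(\hat\beta-\beta)\ \xrightarrow{d}\ \mathcal N(0,I_d)\qquad(n\to\infty).$$ -/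

import Mathlib

open MeasureTheory Filter
open scoped ENNReal NNReal Topology Matrix MatrixOrder

noncomputable section

/-- `r`-dimensional Euclidean space. -/
abbrev Vec (r : ℕ) := EuclideanSpace ℝ (Fin r)

/-- The smallest eigenvalue `λ_min(A)` of a symmetric positive semidefinite real matrix, as an
extended nonnegative number, so that `1 / λ_min(A) = ∞` when `A` is singular.
The empty matrix has no eigenvalue, and `λ_min = ∞`. -/
def lamMin {r : ℕ} (A : Matrix (Fin r) (Fin r) ℝ) : ℝ≥0∞ :=
  ⨅ t ∈ spectrum ℝ A, ENNReal.ofReal t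

/-- `A^{-1/2}`, the inverse of the symmetric positive semidefinite square root of `A`. -/
def invSqrt {r : ℕ} (A : Matrix (Fin r) (Fin r) ℝ) : Matrix (Fin r) (Fin r) ℝ :=
  (CFC.sqrt A)⁻¹

/-- A matrix acting on a Euclidean vector. -/
def act {r s : ℕ} (A : Matrix (Fin r) (Fin s) ℝ) (v : Vec s) : Vec r :=
  WithLp.toLp 2 (A *ᵥ v.ofLp)

/-- `a b'` -/
def outer {r s : ℕ} (a : Vec r) (b : Vec s) : Matrix (Fin r) (Fin s) ℝ :=
  Matrix.vecMulVec a.ofLp b.ofLp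

/-- The random elements `f i`, for `i` in a finite index set, are independent conditionally on the
sub-σ-algebra `m`. -/
def CondIndepFamily {Ω ι : Type*} [MeasurableSpace Ω] (μ : Measure Ω) (m : MeasurableSpace Ω)
    {E : ι → Type*} [∀ i, MeasurableSpace (E i)] (f : ∀ i, Ω → E i) : Prop :=
  ∀ (s : Finset ι) (A : ∀ i, Set (E i)), (∀ i ∈ s, MeasurableSet (A i)) →
    μ[(⋂ i ∈ s, f i ⁻¹' A i).indicator (fun _ => (1 : ℝ)) | m]
      =ᵐ[μ] ∏ i ∈ s, μ[(f i ⁻¹' A i).indicator (fun _ => (1 : ℝ)) | m]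

/-- `Z n = O_p(1)`; the `n`-th variable lives on the `n`-th probability space. -/
def BoundedInProb {Ω : ℕ → Type*} [∀ n, MeasurableSpace (Ω n)] (μ : ∀ n, Measure (Ω n))
    (Z : ∀ n, Ω n → ℝ≥0∞) : Prop :=
  ∀ ε : ℝ≥0∞, 0 < ε → ∃ K : ℝ≥0, ∀ᶠ n in atTop, μ n {ω | (K : ℝ≥0∞) < Z n ω} ≤ ε

/-- `Z n = o_p(1)`; the `n`-th variable lives on the `n`-th probability space. -/
def NegligibleInProb {Ω : ℕ → Type*} [∀ n, MeasurableSpace (Ω n)] (μ : ∀ n, Measure (Ω n))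
    (Z : ∀ n, Ω n → ℝ) : Prop :=
  ∀ ε : ℝ, 0 < ε → Tendsto (fun n => μ n {ω | ε < |Z n ω|}) atTop (𝓝 0)

/-- A sample of size `n` from the partially linear model `y_i = β' x_i + γ' w_i + u_i`, with
`d` regressors of interest and `k` nuisance covariates: the variables have finite second moments,
`𝒲` is a sub-σ-algebra for which all the `w_i` are measurable (for instance the one that they
generate), and `G` is a partition of the observations into clusters. -/
structure PLSample (d k n : ℕ) {Ω : Type*} [mΩ : MeasurableSpace Ω] (μ : Measure Ω)
    (β : Vec d) where
  x : Fin n → Ω → Vec d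
  w : Fin n → Ω → Vec k
  u : Fin n → Ω → ℝ
  y : Fin n → Ω → ℝ
  γ : Vec k
  𝒲 : MeasurableSpace Ω
  G : Finpartition (Finset.univ : Finset (Fin n))
  𝒲_le : 𝒲 ≤ mΩ
  measurable_x : ∀ i, Measurable[mΩ] (x i)
  measurable_w : ∀ i, Measurable[𝒲] (w i)
  measurable_u : ∀ i, Measurable[mΩ] (u i)
  memLp_x : ∀ i, MemLp (x i) 2 μ
  memLp_w : ∀ i, MemLp (w i) 2 μ
  memLp_u : ∀ i, MemLp (u i) 2 μ
  model : ∀ i ω, y i ω = inner ℝ β (x i ω) + inner ℝ γ (w i ω) + u i ω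

namespace PLSample

variable {d k n : ℕ} {Ω : Type*} [mΩ : MeasurableSpace Ω] {μ : Measure Ω} {β : Vec d}
  (D : PLSample d k n μ β)

/-- The σ-algebra of `(𝒳, 𝒲)`, where `𝒳 = (x_1, …, x_n)`. -/
abbrev 𝒳𝒲 : MeasurableSpace Ω :=
  (⨆ i, MeasurableSpace.comap (D.x i) inferInstance) ⊔ D.𝒲

/-- `V_i = x_i - E[x_i | 𝒲]` -/
def V (i : Fin n) (ω : Ω) : Vec d := D.x i ω - (μ[D.x i | D.𝒲]) ω

/-- `α' = (∑_j E[x_j w_j']) (∑_j E[w_j w_j'])⁻¹`, the population linear projection. -/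
def αT : Matrix (Fin d) (Fin k) ℝ :=
  (∑ j, Matrix.of fun a b => ∫ ω, D.x j ω a * D.w j ω b ∂μ) *
    (∑ j, Matrix.of fun a b => ∫ ω, D.w j ω a * D.w j ω b ∂μ)⁻¹

/-- `v_i = x_i - α' w_i` -/
def v (i : Fin n) (ω : Ω) : Vec d := D.x i ω - act D.αT (D.w i ω)

/-- `Q_i = E[v_i | 𝒲]` -/
def Q (i : Fin n) : Ω → Vec d := μ[D.v i | D.𝒲]

/-- `χ = (1/n) ∑_i E ‖Q_i‖²` -/
def χ : ℝ := (n : ℝ)⁻¹ * ∑ i, ∫ ω, ‖D.Q i ω‖ ^ 2 ∂μ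

/-- The `n × k` matrix with rows `w_i'`. -/
def W (ω : Ω) : Matrix (Fin n) (Fin k) ℝ := Matrix.of fun i a => D.w i ω a

/-- `∑_i w_i w_i'` -/
def gramW (ω : Ω) : Matrix (Fin k) (Fin k) ℝ := ∑ i, outer (D.w i ω) (D.w i ω)

/-- `M = I - W (W'W)⁻¹ W'` -/
def M (ω : Ω) : Matrix (Fin n) (Fin n) ℝ :=
  1 - D.W ω * ((D.W ω)ᵀ * D.W ω)⁻¹ * (D.W ω)ᵀ

/-- `v̂_i = ∑_j M_ij x_j`, the partialled-out regressors. -/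
def vhat (i : Fin n) (ω : Ω) : Vec d := ∑ j, D.M ω i j • D.x j ω

/-- `Ṽ_i = ∑_j M_ij V_j` -/
def Vtilde (i : Fin n) (ω : Ω) : Vec d := ∑ j, D.M ω i j • D.V j ω

/-- The conditional covariance matrix `E[u u' | 𝒳, 𝒲]` of the errors. -/
def errCov (ω : Ω) : Matrix (Fin n) (Fin n) ℝ :=
  Matrix.of fun i j => (μ[fun ω' => D.u i ω' * D.u j ω' | D.𝒳𝒲]) ω

/-- `E[(1/n) ∑_i Ṽ_i Ṽ_i' | 𝒲]` -/
def condGramVtilde (ω : Ω) : Matrix (Fin d) (Fin d) ℝ :=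
  Matrix.of fun a b =>
    (μ[fun ω' => (n : ℝ)⁻¹ * ∑ i, D.Vtilde i ω' a * D.Vtilde i ω' b | D.𝒲]) ω

/-- `max_i {E[u_i⁴ | 𝒳, 𝒲] + E[‖V_i‖⁴ | 𝒲] + 1/λ_min(E[uu' | 𝒳, 𝒲])
+ 1/λ_min(E[(1/n) ∑_i Ṽ_i Ṽ_i' | 𝒲])}`, with values in `[0, ∞]`. -/
def momentBound (ω : Ω) : ℝ≥0∞ :=
  ⨆ i : Fin n, (condLExp D.𝒳𝒲 μ (fun ω' => ‖D.u i ω'‖ₑ ^ 4) ω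
    + condLExp D.𝒲 μ (fun ω' => ‖D.V i ω'‖ₑ ^ 4) ω
    + (lamMin (D.errCov ω))⁻¹ + (lamMin (D.condGramVtilde ω))⁻¹)

/-- `Γ̂ = (1/n) ∑_i v̂_i v̂_i'` -/
def Γhat (ω : Ω) : Matrix (Fin d) (Fin d) ℝ :=
  (n : ℝ)⁻¹ • ∑ i, outer (D.vhat i ω) (D.vhat i ω)

/-- `Σ = (1/n) ∑_{g ∈ G} ∑_{i, j ∈ g} v̂_i v̂_j' E[u_i u_j | 𝒳, 𝒲]` -/
def SigmaHat (ω : Ω) : Matrix (Fin d) (Fin d) ℝ :=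
  (n : ℝ)⁻¹ • ∑ g ∈ D.G.parts, ∑ i ∈ g, ∑ j ∈ g,
    (μ[fun ω' => D.u i ω' * D.u j ω' | D.𝒳𝒲]) ω • outer (D.vhat i ω) (D.vhat j ω)

/-- `S = n^{-1/2} ∑_i v̂_i u_i` -/
def S (ω : Ω) : Vec d := (Real.sqrt n)⁻¹ • ∑ i, D.u i ω • D.vhat i ω

open Classical in
/-- The OLS estimator `β̂ = 1{λ_min(Γ̂) > 0} Γ̂⁻¹ ((1/n) ∑_i v̂_i y_i)`. -/
def βhat (ω : Ω) : Vec d :=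
  if 0 < lamMin (D.Γhat ω) then
    act (D.Γhat ω)⁻¹ ((n : ℝ)⁻¹ • ∑ i, D.y i ω • D.vhat i ω)
  else 0

/-- The sandwich variance `Γ̂⁻¹ Σ Γ̂⁻¹`. -/
def sandwich (ω : Ω) : Matrix (Fin d) (Fin d) ℝ :=
  (D.Γhat ω)⁻¹ * D.SigmaHat ω * (D.Γhat ω)⁻¹

/-- The errors `{(u_i, V_i) : i ∈ g}` of the cluster `g`. -/
def clusterUV (g : D.G.parts) (ω : Ω) : (i : g.1) → ℝ × Vec d :=
  fun i => (D.u i ω, D.V i ω)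

/-- The auxiliary errors `{V_i : i ∈ g}` of the cluster `g`. -/
def clusterV (g : D.G.parts) (ω : Ω) : (i : g.1) → Vec d := fun i => D.V i ω

/-- The size of the largest cluster. -/
def maxClusterSize : ℕ := D.G.parts.sup Finset.card

end PLSample

section Assumptions

variable {d : ℕ} {k : ℕ → ℕ} {Ω : ℕ → Type*} [∀ n, MeasurableSpace (Ω n)]
  {μ : ∀ n, Measure (Ω n)} {β : Vec d}

/-- Sampling: bounded cluster sizes; the errors `(u_i, V_i)` are independent across clusters
conditionally on `(𝒳, 𝒲)`, and the auxiliary errors `V_i`, which are functions of `(𝒳, 𝒲)`, are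
independent across clusters conditionally on `𝒲`. -/
structure SamplingAssumption (D : ∀ n, PLSample d (k n) n (μ n) β) : Prop where
  bounded_clusters :
    (fun n => ((D n).maxClusterSize : ℝ)) =O[atTop] (fun _ => (1 : ℝ))
  indep_uV : ∀ n, CondIndepFamily (μ n) (D n).𝒳𝒲 (D n).clusterUV
  indep_V : ∀ n, CondIndepFamily (μ n) (D n).𝒲 (D n).clusterV

/-- Design: nonsingular nuisance covariates, `limsup k/n < 1`, and the moment conditions. -/
structure DesignAssumption (D : ∀ n, PLSample d (k n) n (μ n) β) : Prop where
  nonsingular : Tendsto (fun n => μ n {ω | 0 < lamMin ((D n).gramW ω)}) atTop (𝓝 1)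
  dimension : limsup (fun n : ℕ => (k n : ℝ≥0∞) / (n : ℝ≥0∞)) atTop < 1
  moments : BoundedInProb μ (fun n => (D n).momentBound)

/-- Exogeneity, bounded error of the linear projection, and negligible leverage. -/
structure ExogeneityAssumption (D : ∀ n, PLSample d (k n) n (μ n) β) : Prop where
  exogenous : ∀ n i, (μ n)[(D n).u i | (D n).𝒳𝒲] =ᵐ[μ n] 0
  projection : (fun n => (D n).χ) =O[atTop] (fun _ => (1 : ℝ))
  leverage : NegligibleInProb μ (fun n ω => (⨆ i, ‖(D n).vhat i ω‖) / Real.sqrt n)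

end Assumptions

end

/-!
Three facts carry the theorem.

*Partialling out.* `M` is a symmetric idempotent that annihilates `W` where `W'W` is nonsingular, so
the nuisance covariates drop out of `∑ v̂_i y_i` and `√n (β̂ - β) = Γ̂⁻¹ S` exactly
(`PLSample.sqrt_smul_βhat_sub`).

*`Γ̂` is bounded away from singularity.* Write `x_i = V_i + Q_i + α' w_i`. The last term is
annihilated, and `∑ (M Q)_i (M Q)_i'` is positive semidefinite, so `Γ̂` exceeds
`(1/n) ∑ Ṽ_i Ṽ_i'` up to a cross term in `V` and `Q` (`PLSample.ae_dotProduct_Γhat_ge`). Given `𝒲`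
the first is a quadratic and the second a linear form in centred variables that are independent
across bounded clusters. Because the rows of `M` have norm at most one and `M` is a contraction,
both have conditional variance of order `1/n` (`PLSample.ae_lintegral_deviation_le`), while the
conditional mean of the quadratic form has its smallest eigenvalue bounded below by assumption.
Markov's inequality given `𝒲` then bounds `1/λ_min(Γ̂)` in probability
(`PLSample.exists_eventually_measure_Γhat_lt_le`).

*A conditional Lyapunov theorem.* Given `(𝒳, 𝒲)` the inner product of `Ω^{-1/2} Γ̂⁻¹ S` with `t`
is a linear form `∑ c_i u_i` with fixed coefficients, hence a sum over clusters of independent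
centred variables. Its conditional variance is exactly `‖t‖²` (`PLSample.clusterVar_weight`), and
`∑ c_i ^ 4 ≤ (max_i c_i ^ 2) ∑ c_i ^ 2` tends to zero in probability by the leverage condition
(`PLSample.sum_weight_pow_four_le`). Thus the conditional characteristic function is close to
`exp (-‖t‖² / 2)` outside an event of small probability
(`PLSample.ae_norm_integral_cexp_sub_le`); integrating it and applying Lévy's continuity theorem
gives the convergence in distribution.

Conditioning is handled throughout with a regular conditional law of the *array of errors*
(`condLaw`), which takes values in a finite-dimensional space; no regularity of the sample spaces is
needed. Conditional independence becomes ordinary independence under almost every such law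
(`CondIndepFamily.ae_iIndepFun`), so the bounds above are proved for independent variables.
-/

open ProbabilityTheory

/-! ### Conditional laws -/

lemma lintegral_condDistrib_prod {α β E : Type*} [MeasurableSpace E] [StandardBorelSpace E]
    [Nonempty E] {mα : MeasurableSpace α} {mβ : MeasurableSpace β} {μ : Measure α}
    [IsFiniteMeasure μ] {X : α → β} {Y : α → E} (hX : Measurable X) (hY : Measurable Y)
    {f : β × E → ℝ≥0∞} (hf : Measurable f) :
    ∫⁻ a, ∫⁻ e, f (X a, e) ∂condDistrib Y X μ (X a) ∂μ = ∫⁻ a, f (X a, Y a) ∂μ := by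
  rw [← lintegral_map hf (hX.prodMk hY), ← compProd_map_condDistrib hY.aemeasurable,
    Measure.lintegral_compProd hf, lintegral_map hf.lintegral_kernel_prod_right' hX]

section CondLaw

variable {Ω E : Type*} [MeasurableSpace E] [StandardBorelSpace E] [Nonempty E]

/-- A regular version of the conditional law of `Y` given the sub-σ-algebra `m`. Only the target
space of `Y` has to be standard Borel; the sample space is arbitrary. -/
noncomputable def condLaw (m : MeasurableSpace Ω) {mΩ : MeasurableSpace Ω} (Y : Ω → E)
    (μ : Measure Ω) [IsFiniteMeasure μ] (ω : Ω) : Measure E :=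
  @condDistrib Ω Ω E _ _ _ mΩ m Y id μ _ ω

variable {m mΩ : MeasurableSpace Ω} {μ : Measure Ω} [IsFiniteMeasure μ] {Y : Ω → E}

instance (ω : Ω) : IsProbabilityMeasure (condLaw m Y μ ω) := by
  unfold condLaw; infer_instance

/-- Disintegration of the joint law of the identity and `Y` along `m`. -/
lemma lintegral_condLaw (hm : m ≤ mΩ) (hY : Measurable Y) {f : Ω → E → ℝ≥0∞}
    (hf : Measurable[m.prod inferInstance] (Function.uncurry f)) :
    ∫⁻ ω, ∫⁻ e, f ω e ∂condLaw m Y μ ω ∂μ = ∫⁻ ω, f ω (Y ω) ∂μ := by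
  exact @lintegral_condDistrib_prod Ω Ω E _ _ _ mΩ m μ _ id Y (measurable_id'' hm) hY _ hf

lemma measurable_lintegral_condLaw {f : Ω → E → ℝ≥0∞}
    (hf : Measurable[m.prod inferInstance] (Function.uncurry f)) :
    Measurable[m] fun ω => ∫⁻ e, f ω e ∂condLaw m Y μ ω :=
  @Measurable.lintegral_kernel_prod_right' Ω E m _
    (@condDistrib Ω Ω E _ _ _ mΩ m Y id μ _) _ _ hf

lemma condLExp_ae_eq_lintegral_condLaw (hm : m ≤ mΩ) (hY : Measurable Y) {f : Ω → E → ℝ≥0∞}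
    (hf : Measurable[m.prod inferInstance] (Function.uncurry f)) :
    condLExp m μ (fun ω => f ω (Y ω)) =ᵐ[μ] fun ω => ∫⁻ e, f ω e ∂condLaw m Y μ ω := by
  refine (ae_eq_condLExp hm μ _ (measurable_lintegral_condLaw hf) fun s hs => ?_).symm
  rw [← lintegral_indicator (hm s hs), ← lintegral_indicator (hm s hs)]
  have hf' : Measurable[m.prod inferInstance]
      (Function.uncurry fun ω e => s.indicator (fun ω => f ω e) ω) := by
    have : (Function.uncurry fun ω e => s.indicator (fun ω => f ω e) ω)
        = (Prod.fst ⁻¹' s).indicator (Function.uncurry f) := by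
      ext ⟨ω, e⟩; by_cases h : ω ∈ s <;> simp [h, Set.indicator]
    rw [this]
    exact hf.indicator (@measurable_fst Ω E m _ s hs)
  have := lintegral_condLaw (μ := μ) hm hY hf'
  convert this using 2
  · ext ω; by_cases h : ω ∈ s <;> simp [h]
  · ext ω; by_cases h : ω ∈ s <;> simp [h]

lemma condExp_ae_eq_integral_condLaw {F : Type*} [NormedAddCommGroup F] [NormedSpace ℝ F]
    [CompleteSpace F] (hm : m ≤ mΩ) (hY : Measurable Y) {f : Ω → E → F}
    (hf : StronglyMeasurable[m.prod inferInstance] (Function.uncurry f))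
    (hi : Integrable (fun ω => f ω (Y ω)) μ) :
    μ[fun ω => f ω (Y ω) | m] =ᵐ[μ] fun ω => ∫ e, f ω e ∂condLaw m Y μ ω := by
  have h := @condExp_prod_ae_eq_integral_condDistrib Ω Ω E F _ _ _ _ mΩ μ _ id Y m
    (Function.uncurry f) _ _ (measurable_id'' hm) hY.aemeasurable hf hi
  rwa [MeasurableSpace.comap_id] at h

lemma integral_condLaw {F : Type*} [NormedAddCommGroup F] [NormedSpace ℝ F]
    [CompleteSpace F] (hm : m ≤ mΩ) (hY : Measurable Y) {f : Ω → E → F}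
    (hf : StronglyMeasurable[m.prod inferInstance] (Function.uncurry f))
    (hi : Integrable (fun ω => f ω (Y ω)) μ) :
    ∫ ω, ∫ e, f ω e ∂condLaw m Y μ ω ∂μ = ∫ ω, f ω (Y ω) ∂μ := by
  rw [← integral_condExp hm (f := fun ω => f ω (Y ω))]
  exact integral_congr_ae (condExp_ae_eq_integral_condLaw hm hY hf hi).symm

/-- Markov's inequality given `m`: if the conditional mean of `f` is at most `b` outside of a
small event, then `f` is at most `c` with probability close to one. -/
lemma measure_ge_le_add_div (hm : m ≤ mΩ) (hY : Measurable Y) {f : Ω → E → ℝ≥0∞}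
    (hf : Measurable[m.prod inferInstance] (Function.uncurry f)) {b c : ℝ≥0∞} (hc : c ≠ 0)
    (hc' : c ≠ ∞) (hμ : μ Set.univ ≤ 1) :
    μ {ω | c ≤ f ω (Y ω)} ≤ μ {ω | b < ∫⁻ e, f ω e ∂condLaw m Y μ ω} + b / c := by
  set g : Ω → ℝ≥0∞ := fun ω => ∫⁻ e, f ω e ∂condLaw m Y μ ω with hg
  have hgm : Measurable[m] g := measurable_lintegral_condLaw hf
  set A : Set Ω := {ω | g ω ≤ b} with hA
  have hAm : MeasurableSet[m] A := measurableSet_le hgm measurable_const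
  set f' : Ω → E → ℝ≥0∞ := fun ω e => A.indicator (fun ω => f ω e) ω with hf'
  have hfm' : Measurable[m.prod inferInstance] (Function.uncurry f') := by
    have : (Function.uncurry f') = (Prod.fst ⁻¹' A).indicator (Function.uncurry f) := by
      ext ⟨ω, e⟩; by_cases h : ω ∈ A <;> simp [h, hf', Set.indicator]
    rw [this]
    exact hf.indicator (@measurable_fst Ω E m _ A hAm)
  have h1 : ∫⁻ ω, f' ω (Y ω) ∂μ ≤ b := by
    rw [← lintegral_condLaw hm hY hfm']
    calc ∫⁻ ω, ∫⁻ e, f' ω e ∂condLaw m Y μ ω ∂μ ≤ ∫⁻ ω, b ∂μ := by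
          refine lintegral_mono fun ω => ?_
          by_cases h : ω ∈ A
          · simp only [hf', Set.indicator_of_mem h]
            exact h
          · simp [hf', h]
      _ ≤ b := by
          rw [lintegral_const]
          exact (mul_le_mul_right hμ b).trans (by simp)
  have hmeas : Measurable fun ω => f' ω (Y ω) :=
    hfm'.comp ((measurable_id'' hm).prodMk hY)
  calc μ {ω | c ≤ f ω (Y ω)} ≤ μ ({ω | b < g ω} ∪ {ω | c ≤ f' ω (Y ω)}) := by
        refine measure_mono fun ω hω => ?_
        by_cases h : ω ∈ A
        · right; simpa [hf', h] using hω
        · left; simpa [hA] using h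
    _ ≤ μ {ω | b < g ω} + μ {ω | c ≤ f' ω (Y ω)} := measure_union_le _ _
    _ ≤ _ := by
        gcongr
        exact (meas_ge_le_lintegral_div hmeas.aemeasurable hc hc').trans (by gcongr)

end CondLaw

section CondIndep

variable {Ω ι : Type*} {m mΩ : MeasurableSpace Ω} {μ : Measure Ω}

lemma CondIndepFamily.comp {E F : ι → Type*} [∀ i, MeasurableSpace (E i)]
    [∀ i, MeasurableSpace (F i)] {f : ∀ i, Ω → E i} (h : CondIndepFamily μ m f)
    {φ : ∀ i, E i → F i} (hφ : ∀ i, Measurable (φ i)) :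
    CondIndepFamily μ m (fun i ω => φ i (f i ω)) := by
  intro s A hA
  exact h s (fun i => φ i ⁻¹' A i) (fun i hi => hφ i (hA i hi))

variable {E : Type*} [MeasurableSpace E] [StandardBorelSpace E] [Nonempty E]
  [IsProbabilityMeasure μ] {Y : Ω → E}

lemma condExp_indicator_ae_eq_condLaw (hm : m ≤ mΩ) (hY : Measurable Y) {s : Set E}
    (hs : MeasurableSet s) :
    μ[(Y ⁻¹' s).indicator (fun _ => (1 : ℝ)) | m] =ᵐ[μ] fun ω => (condLaw m Y μ ω).real s := by
  have h := condExp_ae_eq_integral_condLaw (μ := μ) (F := ℝ) hm hY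
    (f := fun _ => s.indicator (fun _ => (1 : ℝ)))
    ((stronglyMeasurable_const.indicator hs).comp_measurable (@measurable_snd Ω E m _))
    ((integrable_const (1 : ℝ)).indicator (hY hs))
  filter_upwards [h] with ω hω
  rw [integral_indicator_const _ hs, smul_eq_mul, mul_one] at hω
  exact hω

/-- Conditional independence given `m` is independence under almost every conditional law. -/
lemma CondIndepFamily.ae_iIndepFun [Countable ι] {F : ι → Type*} [∀ i, MeasurableSpace (F i)]
    [∀ i, MeasurableSpace.CountablyGenerated (F i)] (hm : m ≤ mΩ) (hY : Measurable Y)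
    {φ : ∀ i, E → F i} (hφ : ∀ i, Measurable (φ i))
    (h : CondIndepFamily μ m (fun i ω => φ i (Y ω))) :
    ∀ᵐ ω ∂μ, iIndepFun φ (condLaw m Y μ ω) := by
  -- It suffices to test independence on a countable algebra that generates each factor.
  let C : ∀ i, Set (Set (F i)) := fun i =>
    generateSetAlgebra (MeasurableSpace.countableGeneratingSet (F i))
  have hCc : ∀ i, (C i).Countable := fun i =>
    countable_generateSetAlgebra (MeasurableSpace.countable_countableGeneratingSet)
  have hCgen : ∀ i, (‹∀ i, MeasurableSpace (F i)› i) = MeasurableSpace.generateFrom (C i) := by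
    intro i
    rw [generateFrom_generateSetAlgebra_eq, MeasurableSpace.generateFrom_countableGeneratingSet]
  have hCm : ∀ i, ∀ s ∈ C i, MeasurableSet s := by
    intro i s hs
    rw [hCgen i]; exact MeasurableSpace.measurableSet_generateFrom hs
  have : ∀ i, Countable (C i) := fun i => (hCc i).to_subtype
  have key : ∀ p : (Σ s : Finset ι, ∀ i : s, C i), ∀ᵐ ω ∂μ,
      condLaw m Y μ ω (⋂ i : p.1, φ i ⁻¹' (p.2 i).1)
        = ∏ i : p.1, condLaw m Y μ ω (φ i ⁻¹' (p.2 i).1) := by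
    rintro ⟨s, B⟩
    classical
    let A : ∀ i, Set (F i) := fun i => if hi : i ∈ s then (B ⟨i, hi⟩).1 else Set.univ
    have hA : ∀ i, MeasurableSet (A i) := by
      intro i
      by_cases hi : i ∈ s
      · simp only [A, hi, dif_pos]; exact hCm _ _ (B ⟨i, hi⟩).2
      · simp [A, hi]
    have hAB : ∀ i : s, A i = (B i).1 := by
      rintro ⟨i, hi⟩; simp [A, hi]
    have h1 := h s A (fun i _ => hA i)
    have h2 := condExp_indicator_ae_eq_condLaw (μ := μ) hm hY
      (s := ⋂ i ∈ s, φ i ⁻¹' A i) (s.measurableSet_biInter fun i _ => hφ i (hA i))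
    have h3 : ∀ᵐ ω ∂μ, ∀ i ∈ s, (μ[(Y ⁻¹' (φ i ⁻¹' A i)).indicator (fun _ => (1 : ℝ)) | m]) ω
        = (condLaw m Y μ ω).real (φ i ⁻¹' A i) := by
      rw [eventually_all_finset]
      exact fun i _ => condExp_indicator_ae_eq_condLaw (μ := μ) hm hY (hφ i (hA i))
    have e1 : Y ⁻¹' (⋂ i ∈ s, φ i ⁻¹' A i) = ⋂ i ∈ s, (fun ω => φ i (Y ω)) ⁻¹' A i := by
      ext; simp
    rw [e1] at h2
    filter_upwards [h1, h2, h3] with ω h1 h2 h3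
    have h4 : (condLaw m Y μ ω).real (⋂ i ∈ s, φ i ⁻¹' A i)
        = ∏ i ∈ s, (condLaw m Y μ ω).real (φ i ⁻¹' A i) := by
      rw [← h2, h1, Finset.prod_apply]
      exact Finset.prod_congr rfl fun i hi => h3 i hi
    have e2 : (⋂ i : s, φ i ⁻¹' (B i).1) = ⋂ i ∈ s, φ i ⁻¹' A i := by
      ext x
      simp only [Set.mem_iInter, ← hAB, Subtype.forall]
    have e3 : ∏ i : s, condLaw m Y μ ω (φ i ⁻¹' (B i).1)
        = ∏ i ∈ s, condLaw m Y μ ω (φ i ⁻¹' A i) := by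
      rw [← Finset.prod_coe_sort s (fun i => condLaw m Y μ ω (φ i ⁻¹' A i))]
      exact Finset.prod_congr rfl fun i _ => by rw [← hAB i]
    rw [e2, e3]
    rw [← ENNReal.toReal_eq_toReal_iff' (measure_ne_top _ _)
      (ENNReal.prod_ne_top fun i _ => measure_ne_top _ _), ENNReal.toReal_prod]
    exact h4
  rw [← ae_all_iff] at key
  filter_upwards [key] with ω hω
  rw [iIndepFun_iff_iIndep]
  refine iIndepSets.iIndep (fun i => (hφ i).comap_le) (fun i => {t | ∃ s ∈ C i, φ i ⁻¹' s = t})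
    (fun i => ?_) (fun i => ?_) ?_
  · exact IsPiSystem.comap (isSetAlgebra_generateSetAlgebra.isSetRing.isSetSemiring.isPiSystem) _
  · rw [hCgen i, MeasurableSpace.comap_generateFrom]; rfl
  · rw [iIndepSets_iff]
    intro s f hf
    choose! B hB hBf using hf
    have := hω ⟨s, fun i => ⟨B i, hB i i.2⟩⟩
    simp only at this
    rw [← Finset.prod_coe_sort]
    convert this using 2 with i
    · ext x
      simp only [Set.mem_iInter, Subtype.forall]
      exact forall₂_congr fun i hi => by rw [hBf i hi]
    · rw [hBf i.1 i.2]

end CondIndep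

/-! ### A Lyapunov bound for characteristic functions -/

section Lyapunov

lemma norm_prod_sub_prod_le_sum {ι : Type*} (s : Finset ι) (a b : ι → ℂ)
    (ha : ∀ i ∈ s, ‖a i‖ ≤ 1) (hb : ∀ i ∈ s, ‖b i‖ ≤ 1) :
    ‖∏ i ∈ s, a i - ∏ i ∈ s, b i‖ ≤ ∑ i ∈ s, ‖a i - b i‖ := by
  classical
  induction s using Finset.induction_on with
  | empty => simp
  | insert i s hi ih =>
    rw [Finset.prod_insert hi, Finset.prod_insert hi, Finset.sum_insert hi]
    have e : a i * ∏ j ∈ s, a j - b i * ∏ j ∈ s, b j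
        = (a i - b i) * ∏ j ∈ s, a j + b i * (∏ j ∈ s, a j - ∏ j ∈ s, b j) := by ring
    have h1 : ‖∏ j ∈ s, a j‖ ≤ 1 := by
      rw [norm_prod]
      exact Finset.prod_le_one (fun _ _ => norm_nonneg _)
        fun j hj => ha j (Finset.mem_insert_of_mem hj)
    have h2 := ih (fun j hj => ha j (Finset.mem_insert_of_mem hj))
      (fun j hj => hb j (Finset.mem_insert_of_mem hj))
    have h3 := hb i (Finset.mem_insert_self i s)
    rw [e]
    refine (norm_add_le _ _).trans ?_
    rw [norm_mul, norm_mul]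
    gcongr
    · exact mul_le_of_le_one_right (norm_nonneg _) h1
    · exact (mul_le_of_le_one_left (norm_nonneg _) h3).trans h2

/-- Second-order Taylor bound for `exp (i x)`, with the cubic remainder split between the second
and the fourth power so that no absolute third moment is needed. -/
lemma norm_cexp_mul_I_sub_le (x : ℝ) {η : ℝ} (hη : 0 < η) :
    ‖Complex.exp (x * Complex.I) - (1 + x * Complex.I - x ^ 2 / 2)‖
      ≤ 2 * η * x ^ 2 + 2 / η * x ^ 4 := by
  have h3 : ‖Complex.exp (x * Complex.I) - (1 + x * Complex.I - x ^ 2 / 2)‖ ≤ 4 * |x| ^ 3 := by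
    rcases le_or_gt |x| 1 with hx | hx
    · have hn : ‖(x : ℂ) * Complex.I‖ = |x| := by simp
      have h := Complex.exp_bound (x := x * Complex.I) (by rwa [hn]) (n := 3) (by norm_num)
      rw [hn] at h
      have e : ∑ m ∈ Finset.range 3, ((x : ℂ) * Complex.I) ^ m / (m.factorial : ℂ)
          = 1 + x * Complex.I - x ^ 2 / 2 := by
        simp [Finset.sum_range_succ, mul_pow]; ring
      rw [e] at h
      refine h.trans ?_
      have : 0 ≤ |x| ^ 3 := by positivity
      norm_num [Nat.factorial]
      linarith
    · have h1 : ‖Complex.exp (x * Complex.I)‖ = 1 := Complex.norm_exp_ofReal_mul_I x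
      have h2 : ‖(1 : ℂ) + x * Complex.I - x ^ 2 / 2‖ ≤ 1 + |x| + |x| ^ 2 / 2 := by
        refine (norm_sub_le _ _).trans ?_
        gcongr
        · refine (norm_add_le _ _).trans ?_
          simp
        · simp
      refine (norm_sub_le _ _).trans ?_
      rw [h1]
      have a1 : |x| ≤ |x| ^ 3 := by nlinarith [abs_nonneg x]
      have a2 : |x| ^ 2 ≤ |x| ^ 3 := by nlinarith [abs_nonneg x, sq_nonneg (|x|)]
      have a3 : 1 ≤ |x| := hx.le
      linarith
  refine h3.trans ?_
  have h4 : 0 ≤ x ^ 2 * (η - |x|) ^ 2 := by positivity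
  have e2 : |x| ^ 2 = x ^ 2 := sq_abs x
  have e3 : 4 * |x| ^ 3 = (2 / η) * (2 * η * (|x| * x ^ 2)) := by
    rw [pow_succ, e2]; field_simp; ring
  have e4 : 2 * η * x ^ 2 + 2 / η * x ^ 4 = (2 / η) * (η ^ 2 * x ^ 2 + x ^ 4) := by
    field_simp
  rw [e3, e4]
  gcongr
  nlinarith

variable {E : Type*} [MeasurableSpace E] {P : Measure E} [IsProbabilityMeasure P]

lemma norm_integral_cexp_sub_exp_le {ξ : E → ℝ} (hξ : MemLp ξ 4 P) (h0 : ∫ e, ξ e ∂P = 0)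
    {η : ℝ} (hη : 0 < η) :
    ‖∫ e, Complex.exp (ξ e * Complex.I) ∂P - Complex.exp (-((∫ e, ξ e ^ 2 ∂P : ℝ) : ℂ) / 2)‖
      ≤ 2 * η * ∫ e, ξ e ^ 2 ∂P + (2 / η + 1) * ∫ e, ξ e ^ 4 ∂P := by
  set σ2 := ∫ e, ξ e ^ 2 ∂P with hσ2
  have i1 : Integrable ξ P := hξ.integrable (by norm_num)
  have i2 : Integrable (fun e => ξ e ^ 2) P :=
    (hξ.mono_exponent (p := 2) (by norm_num)).integrable_sq
  have i4 : Integrable (fun e => ξ e ^ 4) P := by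
    have := hξ.integrable_norm_pow (p := 4) (by norm_num)
    refine this.congr (Eventually.of_forall fun e => ?_)
    simp [Real.norm_eq_abs, Even.pow_abs (⟨2, rfl⟩ : Even 4)]
  have ie : Integrable (fun e => Complex.exp (ξ e * Complex.I)) P := by
    refine Integrable.of_bound (C := 1) ?_ (Eventually.of_forall fun e => ?_)
    · have : Continuous fun x : ℝ => Complex.exp (x * Complex.I) := by fun_prop
      exact this.comp_aestronglyMeasurable hξ.1
    · rw [Complex.norm_exp_ofReal_mul_I]
  have ia : Integrable (fun e => (1 : ℂ) + ξ e * Complex.I) P :=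
    (integrable_const _).add (i1.ofReal.mul_const _)
  have j2 : Integrable (fun e => (ξ e : ℂ) ^ 2 / 2) P := by
    have := (i2.ofReal (𝕜 := ℂ)).div_const 2
    exact this.congr (Eventually.of_forall fun e => by push_cast; rfl)
  have ip : Integrable (fun e => (1 : ℂ) + ξ e * Complex.I - (ξ e : ℂ) ^ 2 / 2) P := ia.sub j2
  have e1 : ∫ e, ((1 : ℂ) + ξ e * Complex.I - (ξ e : ℂ) ^ 2 / 2) ∂P = 1 - (σ2 : ℂ) / 2 := by
    rw [integral_sub ia j2, integral_add (integrable_const _) (i1.ofReal.mul_const _),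
      integral_mul_const, integral_div]
    have k1 : ∫ e, (ξ e : ℂ) ∂P = 0 := by
      rw [integral_complex_ofReal, h0]; simp
    have k2 : ∫ e, (ξ e : ℂ) ^ 2 ∂P = σ2 := by
      rw [hσ2, ← integral_complex_ofReal]
      simp
    rw [k1, k2]; simp
  have hσ0 : 0 ≤ σ2 := integral_nonneg fun e => sq_nonneg _
  have hσ4 : σ2 ^ 2 ≤ ∫ e, ξ e ^ 4 ∂P := by
    have h : 0 ≤ ∫ e, (ξ e ^ 2 - σ2) ^ 2 ∂P := integral_nonneg fun e => sq_nonneg _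
    have e : ∀ e, (ξ e ^ 2 - σ2) ^ 2 = ξ e ^ 4 - 2 * σ2 * ξ e ^ 2 + σ2 ^ 2 := fun e => by ring
    simp_rw [e] at h
    have i42 : Integrable (fun e => ξ e ^ 4 - 2 * σ2 * ξ e ^ 2) P := i4.sub (i2.const_mul _)
    rw [integral_add i42 (integrable_const _),
      integral_sub i4 (i2.const_mul _), integral_const_mul, ← hσ2] at h
    simp at h
    nlinarith
  have b1 : ‖∫ e, Complex.exp (ξ e * Complex.I) ∂P - (1 - (σ2 : ℂ) / 2)‖
      ≤ 2 * η * σ2 + 2 / η * ∫ e, ξ e ^ 4 ∂P := by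
    rw [← e1, ← integral_sub ie ip]
    refine (norm_integral_le_integral_norm _).trans ?_
    rw [hσ2, ← integral_const_mul, ← integral_const_mul,
      ← integral_add (i2.const_mul _) (i4.const_mul _)]
    exact integral_mono_of_nonneg (Eventually.of_forall fun _ => norm_nonneg _)
      ((i2.const_mul _).add (i4.const_mul _))
      (Eventually.of_forall fun e => norm_cexp_mul_I_sub_le _ hη)
  have b2 : ‖(1 - (σ2 : ℂ) / 2) - Complex.exp (-(σ2 : ℂ) / 2)‖ ≤ σ2 ^ 2 := by
    have e : (1 - (σ2 : ℂ) / 2) - Complex.exp (-(σ2 : ℂ) / 2)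
        = ((1 - σ2 / 2 - Real.exp (-σ2 / 2) : ℝ) : ℂ) := by push_cast; ring
    rw [e, Complex.norm_real, Real.norm_eq_abs, abs_le]
    have l1 := Real.add_one_le_exp (-σ2 / 2)
    constructor
    · rcases le_or_gt (σ2 / 2) 1 with h | h
      · have := Real.norm_exp_sub_one_sub_id_le (x := -σ2 / 2)
          (by rw [Real.norm_eq_abs, abs_le]; constructor <;> linarith)
        rw [Real.norm_eq_abs, Real.norm_eq_abs, sq_abs] at this
        have := (abs_le.1 this).2
        nlinarith
      · have : Real.exp (-σ2 / 2) ≤ 1 := Real.exp_le_one_iff.2 (by linarith)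
        nlinarith
    · nlinarith
  calc _ ≤ ‖∫ e, Complex.exp (ξ e * Complex.I) ∂P - (1 - (σ2 : ℂ) / 2)‖
        + ‖(1 - (σ2 : ℂ) / 2) - Complex.exp (-(σ2 : ℂ) / 2)‖ :=
      norm_sub_le_norm_sub_add_norm_sub _ _ _
    _ ≤ _ := by linarith

/-- Quantitative form of Lyapunov's central limit theorem: the characteristic function of a sum of
independent centred variables is close to that of the Gaussian law with the same variance. -/
lemma iIndepFun.norm_integral_cexp_sum_sub_le {ι : Type*} [Fintype ι] {ξ : ι → E → ℝ}
    (hind : iIndepFun ξ P) (hξ : ∀ g, MemLp (ξ g) 4 P) (h0 : ∀ g, ∫ e, ξ g e ∂P = 0)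
    {η : ℝ} (hη : 0 < η) :
    ‖∫ e, Complex.exp ((∑ g, ξ g e : ℝ) * Complex.I) ∂P
        - Complex.exp (-((∑ g, ∫ e, ξ g e ^ 2 ∂P : ℝ) : ℂ) / 2)‖
      ≤ 2 * η * ∑ g, ∫ e, ξ g e ^ 2 ∂P + (2 / η + 1) * ∑ g, ∫ e, ξ g e ^ 4 ∂P := by
  have hae : ∀ g, AEMeasurable (ξ g) P := fun g => (hξ g).1.aemeasurable
  have hchar : ∀ X : E → ℝ, AEMeasurable X P →
      charFun (P.map X) 1 = ∫ e, Complex.exp (X e * Complex.I) ∂P := by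
    intro X hX
    rw [charFun_apply_real, integral_map hX (by fun_prop)]
    simp
  have h1 : ∫ e, Complex.exp ((∑ g, ξ g e : ℝ) * Complex.I) ∂P
      = ∏ g, ∫ e, Complex.exp (ξ g e * Complex.I) ∂P := by
    rw [← hchar (fun e => ∑ g, ξ g e) (Finset.aemeasurable_fun_sum _ fun g _ => hae g),
      hind.charFun_map_fun_sum_eq_prod hae, Finset.prod_apply]
    exact Finset.prod_congr rfl fun g _ => hchar _ (hae g)
  have h2 : Complex.exp (-((∑ g, ∫ e, ξ g e ^ 2 ∂P : ℝ) : ℂ) / 2)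
      = ∏ g, Complex.exp (-((∫ e, ξ g e ^ 2 ∂P : ℝ) : ℂ) / 2) := by
    rw [← Complex.exp_sum]
    congr 1
    push_cast
    rw [← Finset.sum_div, Finset.sum_neg_distrib]
  rw [h1, h2, Finset.mul_sum, Finset.mul_sum, ← Finset.sum_add_distrib]
  refine (norm_prod_sub_prod_le_sum _ _ _ (fun g _ => ?_) (fun g _ => ?_)).trans
    (Finset.sum_le_sum fun g _ => norm_integral_cexp_sub_exp_le (hξ g) (h0 g) hη)
  · refine (norm_integral_le_integral_norm _).trans ?_
    simp [Complex.norm_exp_ofReal_mul_I]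
  · have : -((∫ e, ξ g e ^ 2 ∂P : ℝ) : ℂ) / 2 = ((-(∫ e, ξ g e ^ 2 ∂P) / 2 : ℝ) : ℂ) := by
      push_cast; ring
    rw [this, Complex.norm_exp_ofReal, Real.exp_le_one_iff]
    have : 0 ≤ ∫ e, ξ g e ^ 2 ∂P := integral_nonneg fun e => sq_nonneg _
    linarith

end Lyapunov

/-! ### Second moments of linear and quadratic forms in clustered variables -/

section ClusterMoments

/-- The variables `v i` whose labels `c i` lie in disjoint sets of clusters are independent. -/
def ClusterIndep {ι κ E F : Type*} [MeasurableSpace E] [MeasurableSpace F] (c : ι → κ)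
    (v : ι → E → F) (P : Measure E) : Prop :=
  ∀ I J : Finset ι, (∀ i ∈ I, ∀ j ∈ J, c i ≠ c j) →
    IndepFun (fun e (i : I) => v i e) (fun e (j : J) => v j e) P

variable {ι κ E F : Type*} [MeasurableSpace E] [MeasurableSpace F] {P : Measure E}
  {c : ι → κ} {v : ι → E → F}

lemma iIndepFun.clusterIndep [Fintype ι] [DecidableEq ι]
    (G : Finpartition (Finset.univ : Finset ι)) (hv : ∀ i, Measurable (v i))
    (h : iIndepFun (fun (g : G.parts) e (i : g.1) => v i e) P) : ClusterIndep G.part v P := by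
  classical
  intro I J hIJ
  let S : Finset ι → Finset G.parts := fun I => Finset.univ.filter fun g => ∃ i ∈ I, G.part i = g.1
  have hd : Disjoint (S I) (S J) := by
    rw [Finset.disjoint_left]
    intro g hg hg'
    simp only [S, Finset.mem_filter, Finset.mem_univ, true_and] at hg hg'
    obtain ⟨i, hi, hgi⟩ := hg
    obtain ⟨j, hj, hgj⟩ := hg'
    exact hIJ i hi j hj (hgi.trans hgj.symm)
  have hp : ∀ i, G.part i ∈ G.parts := fun i => G.part_mem.2 (Finset.mem_univ i)
  have hS : ∀ (I : Finset ι) (i : I), (⟨G.part i, hp i⟩ : G.parts) ∈ S I := fun I i => by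
    simp only [S, Finset.mem_filter, Finset.mem_univ, true_and]
    exact ⟨i, i.2, rfl⟩
  have hmem : ∀ i : ι, i ∈ G.part i := fun i => G.mem_part (Finset.mem_univ i)
  have key := h.indepFun_finset (S I) (S J) hd
    (fun g => measurable_pi_lambda _ fun i => hv i)
  let ψ : ∀ I : Finset ι, ((g : S I) → ((i : g.1.1) → F)) → I → F :=
    fun I b i => b ⟨⟨G.part i, hp i⟩, hS I i⟩ ⟨i, hmem i⟩
  have hψ : ∀ I, Measurable (ψ I) := fun I => by
    refine measurable_pi_lambda _ fun i => ?_
    exact (measurable_pi_apply _).comp (measurable_pi_apply _)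
  exact key.comp (hψ I) (hψ J)

variable (hc : ClusterIndep c v P) (hv : ∀ i, Measurable (v i))
include hc hv

lemma ClusterIndep.integral_mul {I J : Finset ι} (hIJ : ∀ i ∈ I, ∀ j ∈ J, c i ≠ c j)
    {f : (I → F) → ℝ} {g : (J → F) → ℝ} (hf : Measurable f) (hg : Measurable g) :
    ∫ e, f (fun i => v i e) * g (fun j => v j e) ∂P
      = (∫ e, f (fun i => v i e) ∂P) * ∫ e, g (fun j => v j e) ∂P := by
  have h := (hc I J hIJ).comp hf hg
  refine h.integral_fun_mul_eq_mul_integral ?_ ?_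
  · exact (hf.comp (measurable_pi_lambda _ fun i => hv i)).aestronglyMeasurable
  · exact (hg.comp (measurable_pi_lambda _ fun i => hv i)).aestronglyMeasurable

variable {f₁ f₂ f₃ f₄ : F → ℝ} (h₁ : Measurable f₁) (h₂ : Measurable f₂) (h₃ : Measurable f₃)
  (h₄ : Measurable f₄)
include h₁ h₂

lemma ClusterIndep.integral_pair {i₁ i₂ : ι} (h : c i₁ ≠ c i₂) :
    ∫ e, f₁ (v i₁ e) * f₂ (v i₂ e) ∂P = (∫ e, f₁ (v i₁ e) ∂P) * ∫ e, f₂ (v i₂ e) ∂P := by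
  classical
  exact hc.integral_mul hv (I := {i₁}) (J := {i₂}) (by simpa using h)
    (f := fun b => f₁ (b ⟨i₁, by simp⟩)) (g := fun b => f₂ (b ⟨i₂, by simp⟩))
    (by fun_prop) (by fun_prop)

include h₃ h₄

lemma ClusterIndep.integral_pair_pair {i₁ i₂ i₃ i₄ : ι} (h13 : c i₁ ≠ c i₃) (h14 : c i₁ ≠ c i₄)
    (h23 : c i₂ ≠ c i₃) (h24 : c i₂ ≠ c i₄) :
    ∫ e, (f₁ (v i₁ e) * f₂ (v i₂ e)) * (f₃ (v i₃ e) * f₄ (v i₄ e)) ∂P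
      = (∫ e, f₁ (v i₁ e) * f₂ (v i₂ e) ∂P) * ∫ e, f₃ (v i₃ e) * f₄ (v i₄ e) ∂P := by
  classical
  exact hc.integral_mul hv (I := {i₁, i₂}) (J := {i₃, i₄}) (by simp; tauto)
    (f := fun b => f₁ (b ⟨i₁, by simp⟩) * f₂ (b ⟨i₂, by simp⟩))
    (g := fun b => f₃ (b ⟨i₃, by simp⟩) * f₄ (b ⟨i₄, by simp⟩))
    (by fun_prop) (by fun_prop)

/-- A centred variable that is alone in its cluster makes the mean of a product vanish. -/
lemma ClusterIndep.integral_isolated {i₁ i₂ i₃ i₄ : ι} (h12 : c i₁ ≠ c i₂) (h13 : c i₁ ≠ c i₃)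
    (h14 : c i₁ ≠ c i₄) (h0 : ∫ e, f₁ (v i₁ e) ∂P = 0) :
    ∫ e, f₁ (v i₁ e) * (f₂ (v i₂ e) * f₃ (v i₃ e) * f₄ (v i₄ e)) ∂P = 0 := by
  classical
  have := hc.integral_mul hv (I := {i₁}) (J := {i₂, i₃, i₄}) (by simp; tauto)
    (f := fun b => f₁ (b ⟨i₁, by simp⟩))
    (g := fun b => f₂ (b ⟨i₂, by simp⟩) * f₃ (b ⟨i₃, by simp⟩) * f₄ (b ⟨i₄, by simp⟩))
    (by fun_prop) (by fun_prop)
  simp only at this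
  rw [this, h0, zero_mul]

omit hc hv h₁ h₂ h₃ h₄

/-- If each of the square integrable variables `Z p` is uncorrelated with all but `N` of the
others, then the second moment of their sum is at most `N` times the sum of second moments. -/
lemma integral_sum_sq_le_of_uncorrelated {π : Type*} [Fintype π] {Z : π → E → ℝ}
    (hZ : ∀ p, MemLp (Z p) 2 P) (R : π → π → Prop) [DecidableRel R]
    (hsymm : ∀ p q, R p q → R q p) (h0 : ∀ p q, ¬ R p q → ∫ e, Z p e * Z q e ∂P = 0) {N : ℕ}
    (hN : ∀ p, (Finset.univ.filter (R p)).card ≤ N) :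
    ∫ e, (∑ p, Z p e) ^ 2 ∂P ≤ N * ∑ p, ∫ e, Z p e ^ 2 ∂P := by
  have hint : ∀ p q, Integrable (fun e => Z p e * Z q e) P := fun p q =>
    (hZ p).integrable_mul (hZ q)
  have hsq : ∀ p, Integrable (fun e => Z p e ^ 2) P := fun p => (hZ p).integrable_sq
  have e1 : ∫ e, (∑ p, Z p e) ^ 2 ∂P = ∑ p, ∑ q, ∫ e, Z p e * Z q e ∂P := by
    simp_rw [sq, Finset.sum_mul_sum]
    rw [integral_finsetSum _ fun p _ => integrable_finsetSum _ fun q _ => hint p q]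
    exact Finset.sum_congr rfl fun p _ => integral_finsetSum _ fun q _ => hint p q
  have hb : ∀ p q, ∫ e, Z p e * Z q e ∂P
      ≤ if R p q then (∫ e, Z p e ^ 2 ∂P) / 2 + (∫ e, Z q e ^ 2 ∂P) / 2 else 0 := by
    intro p q
    split_ifs with h
    · rw [← integral_div, ← integral_div,
        ← integral_add ((hsq p).div_const _) ((hsq q).div_const _)]
      refine integral_mono (hint p q) (((hsq p).div_const _).add ((hsq q).div_const _)) fun e => ?_
      simp only
      nlinarith [sq_nonneg (Z p e - Z q e)]
    · exact (h0 p q h).le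
  have hs : ∑ p, ∑ q, (if R p q then (∫ e, Z q e ^ 2 ∂P) / 2 else 0)
      = ∑ p, ∑ q, (if R p q then (∫ e, Z p e ^ 2 ∂P) / 2 else 0) := by
    rw [Finset.sum_comm]
    refine Finset.sum_congr rfl fun p _ => Finset.sum_congr rfl fun q _ => ?_
    exact if_congr ⟨hsymm _ _, hsymm _ _⟩ rfl rfl
  have hp : ∀ p, ∑ q, (if R p q then (∫ e, Z p e ^ 2 ∂P) / 2 else 0)
      ≤ N * ((∫ e, Z p e ^ 2 ∂P) / 2) := by
    intro p
    rw [← Finset.sum_filter, Finset.sum_const, nsmul_eq_mul]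
    have : 0 ≤ ∫ e, Z p e ^ 2 ∂P := integral_nonneg fun e => sq_nonneg _
    gcongr
    exact hN p
  calc ∫ e, (∑ p, Z p e) ^ 2 ∂P = ∑ p, ∑ q, ∫ e, Z p e * Z q e ∂P := e1
    _ ≤ ∑ p, ∑ q, (if R p q then (∫ e, Z p e ^ 2 ∂P) / 2 + (∫ e, Z q e ^ 2 ∂P) / 2 else 0) :=
        Finset.sum_le_sum fun p _ => Finset.sum_le_sum fun q _ => hb p q
    _ = ∑ p, ∑ q, (if R p q then (∫ e, Z p e ^ 2 ∂P) / 2 else 0)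
        + ∑ p, ∑ q, (if R p q then (∫ e, Z q e ^ 2 ∂P) / 2 else 0) := by
        rw [← Finset.sum_add_distrib]
        refine Finset.sum_congr rfl fun p _ => ?_
        rw [← Finset.sum_add_distrib]
        refine Finset.sum_congr rfl fun q _ => ?_
        split_ifs <;> simp
    _ ≤ ∑ p, N * ((∫ e, Z p e ^ 2 ∂P) / 2) + ∑ p, N * ((∫ e, Z p e ^ 2 ∂P) / 2) := by
        rw [hs]
        exact add_le_add (Finset.sum_le_sum fun p _ => hp p) (Finset.sum_le_sum fun p _ => hp p)
    _ = _ := by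
        rw [← Finset.sum_add_distrib, Finset.mul_sum]
        exact Finset.sum_congr rfl fun p _ => by ring

lemma integrable_pow_four {f : E → ℝ} (hf : MemLp f 4 P) : Integrable (fun e => f e ^ 4) P := by
  refine (hf.integrable_norm_pow (p := 4) (by norm_num)).congr (Eventually.of_forall fun e => ?_)
  simp [Real.norm_eq_abs, Even.pow_abs (⟨2, rfl⟩ : Even 4)]

lemma MemLp.mul_of_four {f g : E → ℝ} (hf : MemLp f 4 P) (hg : MemLp g 4 P) :
    MemLp (fun e => f e * g e) 2 P := by
  have hm : AEStronglyMeasurable (fun e => f e * g e) P := hf.1.mul hg.1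
  rw [memLp_two_iff_integrable_sq hm]
  refine (((integrable_pow_four hf).add (integrable_pow_four hg)).mono'
    (hm.pow 2) (Eventually.of_forall fun e => ?_))
  simp only [Pi.add_apply, Real.norm_eq_abs]
  rw [abs_of_nonneg (sq_nonneg _)]
  nlinarith [sq_nonneg (f e ^ 2 - g e ^ 2), sq_nonneg (f e ^ 2), sq_nonneg (g e ^ 2)]

variable [IsProbabilityMeasure P] [Fintype ι] [DecidableEq κ] {x y : F → ℝ}

/-- The second moment of a linear form in centred clustered variables: each term is correlated
with at most `C` others. -/
lemma ClusterIndep.integral_linear_sq_le (hc : ClusterIndep c v P) (hv : ∀ i, Measurable (v i))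
    (hx : Measurable x) (hx4 : ∀ i, MemLp (fun e => x (v i e)) 4 P)
    (hx0 : ∀ i, ∫ e, x (v i e) ∂P = 0) {K : ℝ} (hK : ∀ i, ∫ e, x (v i e) ^ 4 ∂P ≤ K) {C : ℕ}
    (hC : ∀ i, (Finset.univ.filter fun j => c i = c j).card ≤ C) (b : ι → ℝ) :
    ∫ e, (∑ i, b i * x (v i e)) ^ 2 ∂P ≤ C * ((1 + K) * ∑ i, b i ^ 2) := by
  have h2 : ∀ i, MemLp (fun e => x (v i e)) 2 P := fun i => (hx4 i).mono_exponent (by norm_num)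
  refine (integral_sum_sq_le_of_uncorrelated (fun i => (h2 i).const_mul (b i))
    (fun i j => c i = c j) (fun _ _ h => h.symm) (fun i j hij => ?_) hC).trans ?_
  · have := hc.integral_pair hv hx hx hij
    rw [hx0, zero_mul] at this
    calc _ = ∫ e, (b i * b j) * (x (v i e) * x (v j e)) ∂P := by
          congr 1; ext e; ring
      _ = 0 := by rw [integral_const_mul, this, mul_zero]
  · rw [Finset.mul_sum Finset.univ _ (1 + K)]
    gcongr with i
    simp_rw [mul_pow]
    rw [integral_const_mul, mul_comm]
    gcongr
    calc ∫ e, x (v i e) ^ 2 ∂P ≤ ∫ e, (1 + x (v i e) ^ 4) ∂P := by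
          refine integral_mono (h2 i).integrable_sq
            ((integrable_const _).add (integrable_pow_four (hx4 i))) fun e => ?_
          simp only
          nlinarith [sq_nonneg (x (v i e) ^ 2 - 1), sq_nonneg (x (v i e) ^ 2)]
      _ ≤ 1 + K := by
          rw [integral_add (integrable_const _) (integrable_pow_four (hx4 i))]
          simpa using hK i

/-- The variance of a quadratic form in centred clustered variables. Two of the products
`x (v j) y (v l)` are uncorrelated unless they involve the same pair of clusters, which leaves at
most `2 C ^ 2` correlated partners for each. -/
lemma ClusterIndep.integral_quadratic_sq_le (hc : ClusterIndep c v P)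
    (hv : ∀ i, Measurable (v i)) (hx : Measurable x) (hy : Measurable y)
    (hx4 : ∀ i, MemLp (fun e => x (v i e)) 4 P) (hy4 : ∀ i, MemLp (fun e => y (v i e)) 4 P)
    (hx0 : ∀ i, ∫ e, x (v i e) ∂P = 0) (hy0 : ∀ i, ∫ e, y (v i e) ∂P = 0) {K : ℝ}
    (hxK : ∀ i, ∫ e, x (v i e) ^ 4 ∂P ≤ K) (hyK : ∀ i, ∫ e, y (v i e) ^ 4 ∂P ≤ K) {C : ℕ}
    (hC : ∀ i, (Finset.univ.filter fun j => c i = c j).card ≤ C) (m : ι → ι → ℝ) :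
    ∫ e, (∑ j, ∑ l, m j l * (x (v j e) * y (v l e) - ∫ e', x (v j e') * y (v l e') ∂P)) ^ 2 ∂P
      ≤ (2 * C ^ 2 : ℕ) * (K * ∑ j, ∑ l, m j l ^ 2) := by
  classical
  set A : ι × ι → E → ℝ := fun p e => x (v p.1 e) * y (v p.2 e) with hA
  set Z : ι × ι → E → ℝ := fun p e => m p.1 p.2 * (A p e - ∫ e', A p e' ∂P) with hZ
  have hA2 : ∀ p, MemLp (A p) 2 P := fun p => MemLp.mul_of_four (hx4 p.1) (hy4 p.2)
  have hAi : ∀ p, Integrable (A p) P := fun p => (hA2 p).integrable (by norm_num)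
  have hZ2 : ∀ p, MemLp (Z p) 2 P := fun p => ((hA2 p).sub (memLp_const _)).const_mul _
  let R : ι × ι → ι × ι → Prop := fun p q =>
    (c p.1 = c q.1 ∧ c p.2 = c q.2) ∨ (c p.1 = c q.2 ∧ c p.2 = c q.1)
  have hcov : ∀ p q, ¬ R p q → ∫ e, A p e * A q e ∂P = (∫ e, A p e ∂P) * ∫ e, A q e ∂P := by
    rintro ⟨j, l⟩ ⟨j', l'⟩ hR
    have hpair : ∀ j l, c j ≠ c l → ∫ e, A (j, l) e ∂P = 0 := fun j l h => by
      simp only [hA]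
      rw [hc.integral_pair hv hx hy h, hx0, zero_mul]
    by_cases s1 : c j ≠ c l ∧ c j ≠ c j' ∧ c j ≠ c l'
    · rw [hpair j l s1.1, zero_mul]
      rw [← hc.integral_isolated hv hx hy hx hy s1.1 s1.2.1 s1.2.2 (hx0 j)]
      exact integral_congr_ae (Eventually.of_forall fun e => by simp only [hA]; ring)
    by_cases s2 : c l ≠ c j ∧ c l ≠ c j' ∧ c l ≠ c l'
    · rw [hpair j l s2.1.symm, zero_mul]
      rw [← hc.integral_isolated hv hy hx hx hy s2.1 s2.2.1 s2.2.2 (hy0 l)]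
      exact integral_congr_ae (Eventually.of_forall fun e => by simp only [hA]; ring)
    by_cases s3 : c j' ≠ c l' ∧ c j' ≠ c j ∧ c j' ≠ c l
    · rw [hpair j' l' s3.1, mul_zero]
      rw [← hc.integral_isolated hv hx hy hx hy s3.1 s3.2.1 s3.2.2 (hx0 j')]
      exact integral_congr_ae (Eventually.of_forall fun e => by simp only [hA]; ring)
    by_cases s4 : c l' ≠ c j' ∧ c l' ≠ c j ∧ c l' ≠ c l
    · rw [hpair j' l' s4.1.symm, mul_zero]
      rw [← hc.integral_isolated hv hy hx hx hy s4.1 s4.2.1 s4.2.2 (hy0 l')]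
      exact integral_congr_ae (Eventually.of_forall fun e => by simp only [hA]; ring)
    -- Otherwise no index is alone in its cluster, so each product lives in one cluster of its own.
    refine hc.integral_pair_pair hv hx hy hx hy ?_ ?_ ?_ ?_ <;> simp only [R] at hR <;> grind
  have hsum : ∀ e, ∑ j, ∑ l, m j l * (x (v j e) * y (v l e) - ∫ e', x (v j e') * y (v l e') ∂P)
      = ∑ p, Z p e := fun e => by
    rw [Fintype.sum_prod_type]
  simp_rw [hsum]
  refine (integral_sum_sq_le_of_uncorrelated (N := 2 * C ^ 2) hZ2 R (fun p q h => ?_)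
    (fun p q h => ?_) fun p => ?_).trans ?_
  · simp only [R] at h ⊢
    tauto
  · have e1 : ∀ e, Z p e * Z q e = (m p.1 p.2 * m q.1 q.2) * (A p e * A q e
        - (∫ e', A q e' ∂P) * A p e - (∫ e', A p e' ∂P) * A q e
        + (∫ e', A p e' ∂P) * ∫ e', A q e' ∂P) := fun e => by simp only [hZ]; ring
    simp_rw [e1]
    have i1 : Integrable (fun e => A p e * A q e) P := (hA2 p).integrable_mul (hA2 q)
    have i2 : Integrable (fun e => A p e * A q e - (∫ e', A q e' ∂P) * A p e) P :=
      i1.sub ((hAi p).const_mul _)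
    have i3 : Integrable (fun e => A p e * A q e - (∫ e', A q e' ∂P) * A p e
        - (∫ e', A p e' ∂P) * A q e) P := i2.sub ((hAi q).const_mul _)
    rw [integral_const_mul, integral_add i3 (integrable_const _),
      integral_sub i2 ((hAi q).const_mul _), integral_sub i1 ((hAi p).const_mul _), hcov p q h,
      integral_const_mul, integral_const_mul, integral_const]
    simp; right; ring
  · have hsub : Finset.univ.filter (R p) ⊆
        ((Finset.univ.filter fun j => c p.1 = c j) ×ˢ (Finset.univ.filter fun j => c p.2 = c j)) ∪
        ((Finset.univ.filter fun j => c p.2 = c j) ×ˢ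
          (Finset.univ.filter fun j => c p.1 = c j)) := by
      intro q hq
      simp only [R, Finset.mem_filter, Finset.mem_univ, true_and, Finset.mem_union,
        Finset.mem_product] at hq ⊢
      tauto
    refine (Finset.card_le_card hsub).trans ((Finset.card_union_le _ _).trans ?_)
    rw [Finset.card_product, Finset.card_product]
    have a := hC p.1
    have b := hC p.2
    nlinarith [Nat.mul_le_mul a b]
  · rw [← Fintype.sum_prod_type' (f := fun j l => m j l ^ 2), Finset.mul_sum Finset.univ _ K]
    gcongr with p
    simp only [hZ]
    simp_rw [mul_pow]
    rw [integral_const_mul, mul_comm]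
    gcongr
    have hvar : ∫ e, (A p e - ∫ e', A p e' ∂P) ^ 2 ∂P ≤ ∫ e, A p e ^ 2 ∂P := by
      rw [← variance_eq_integral (hA2 p).1.aemeasurable]
      exact variance_le_expectation_sq (hA2 p).1
    refine hvar.trans ?_
    have i4x := integrable_pow_four (hx4 p.1)
    have i4y := integrable_pow_four (hy4 p.2)
    calc ∫ e, A p e ^ 2 ∂P ≤ ∫ e, (x (v p.1 e) ^ 4 / 2 + y (v p.2 e) ^ 4 / 2) ∂P := by
          refine integral_mono (hA2 p).integrable_sq ((i4x.div_const _).add (i4y.div_const _))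
            fun e => ?_
          simp only [hA]
          nlinarith [sq_nonneg (x (v p.1 e) ^ 2 - y (v p.2 e) ^ 2)]
      _ ≤ K := by
          rw [integral_add (i4x.div_const _) (i4y.div_const _), integral_div, integral_div]
          linarith [hxK p.1, hyK p.2]

end ClusterMoments

/-! ### Smallest eigenvalues -/

section LamMin

variable {r : ℕ} {A : Matrix (Fin r) (Fin r) ℝ}

lemma det_ne_zero_of_lamMin_pos (h : 0 < lamMin A) : A.det ≠ 0 := by
  intro h0
  have : (0 : ℝ) ∈ spectrum ℝ A := by
    rw [spectrum.zero_mem_iff, Matrix.isUnit_iff_isUnit_det, h0]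
    simp
  have h1 : lamMin A ≤ ENNReal.ofReal 0 := iInf₂_le (0 : ℝ) this
  simp at h1
  exact h.ne' h1

lemma lamMin_pos_iff_det_ne_zero (hA : A.PosSemidef) : 0 < lamMin A ↔ A.det ≠ 0 := by
  refine ⟨det_ne_zero_of_lamMin_pos, fun h => ?_⟩
  have hpos : ∀ i, 0 < hA.1.eigenvalues i := fun i => by
    refine lt_of_le_of_ne (hA.eigenvalues_nonneg i) fun h0 => h ?_
    have : (0 : ℝ) ∈ spectrum ℝ A := by
      rw [hA.1.spectrum_real_eq_range_eigenvalues]; exact ⟨i, h0.symm⟩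
    rw [spectrum.zero_mem_iff, Matrix.isUnit_iff_isUnit_det, isUnit_iff_ne_zero, not_not] at this
    exact this
  have e : lamMin A = ⨅ i, ENNReal.ofReal (hA.1.eigenvalues i) := by
    unfold lamMin
    rw [hA.1.spectrum_real_eq_range_eigenvalues, iInf_range]
  rw [e]
  cases isEmpty_or_nonempty (Fin r) with
  | inl _ => rw [iInf_of_empty]; exact ENNReal.zero_lt_top
  | inr _ =>
    obtain ⟨i, hi⟩ := exists_eq_ciInf_of_finite (f := fun i => ENNReal.ofReal (hA.1.eigenvalues i))
    rw [← hi]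
    simpa using hpos i

lemma dotProduct_mulVec_ge_of_inv_lamMin_le (hA : A.IsHermitian) {K : ℝ≥0} (hK : K ≠ 0)
    (h : (lamMin A)⁻¹ ≤ K) (a : Fin r → ℝ) : (K : ℝ)⁻¹ * (a ⬝ᵥ a) ≤ a ⬝ᵥ A *ᵥ a := by
  have hKpos : 0 < K := pos_iff_ne_zero.2 hK
  have hspec : ∀ t ∈ spectrum ℝ A, (K : ℝ)⁻¹ ≤ t := by
    intro t ht
    have h1 : lamMin A ≤ ENNReal.ofReal t := iInf₂_le t ht
    have h2 : (K : ℝ≥0∞)⁻¹ ≤ ENNReal.ofReal t := (ENNReal.inv_le_iff_inv_le.1 h).trans h1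
    rw [← ENNReal.coe_inv hK] at h2
    have h3 : (0 : ℝ) < (K⁻¹ : ℝ≥0) := by positivity
    have h4 : ENNReal.ofReal (K⁻¹ : ℝ≥0) ≤ ENNReal.ofReal t := by
      rwa [ENNReal.ofReal_coe_nnreal]
    have := (ENNReal.ofReal_le_ofReal_iff' ).1 h4
    rcases this with h | h
    · simpa using h
    · exact absurd h (not_le.2 h3)
  set B := A - algebraMap ℝ (Matrix (Fin r) (Fin r) ℝ) (K : ℝ)⁻¹ with hB
  have hBh : B.IsHermitian := by
    refine hA.sub ?_
    rw [Matrix.algebraMap_eq_diagonal]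
    exact Matrix.isHermitian_diagonal _
  have hBp : B.PosSemidef := by
    rw [hBh.posSemidef_iff_eigenvalues_nonneg]
    intro i
    have h1 : hBh.eigenvalues i ∈ spectrum ℝ B := by
      rw [hBh.spectrum_real_eq_range_eigenvalues]; exact ⟨i, rfl⟩
    obtain ⟨t, ht, s, hs, hts⟩ := (spectrum.sub_singleton_eq A (K : ℝ)⁻¹).symm ▸ h1
    have := hspec t ht
    rw [Set.mem_singleton_iff] at hs
    subst hs
    change t - (K : ℝ)⁻¹ = _ at hts
    simp only [Pi.zero_apply]
    linarith
  have := hBp.dotProduct_mulVec_nonneg a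
  rw [hB, Matrix.sub_mulVec, dotProduct_sub, Algebra.algebraMap_eq_smul_one, Matrix.smul_mulVec,
    Matrix.one_mulVec, dotProduct_smul, smul_eq_mul] at this
  simpa using this

end LamMin

/-! ### The inverse square root -/

section InvSqrt

/-- Matrices carry the product σ-algebra of their entries. -/
instance Matrix.measurableSpaceReal {r s : Type*} : MeasurableSpace (Matrix r s ℝ) :=
  inferInstanceAs (MeasurableSpace (r → s → ℝ))

instance Matrix.standardBorelSpaceReal {r s : Type*} [Countable r] [Countable s] :
    StandardBorelSpace (Matrix r s ℝ) :=
  inferInstanceAs (StandardBorelSpace (r → s → ℝ))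

instance Matrix.borelSpaceReal {r s : Type*} [Countable r] [Countable s] :
    BorelSpace (Matrix r s ℝ) :=
  inferInstanceAs (BorelSpace (r → s → ℝ))

lemma measurable_matrix_iff {Ω : Type*} {_ : MeasurableSpace Ω} {r s : Type*}
    {f : Ω → Matrix r s ℝ} :
    Measurable f ↔ ∀ i j, Measurable fun ω => f ω i j := by
  refine Iff.trans (measurable_pi_iff (X := fun _ : r => s → ℝ)) (forall_congr' fun i => ?_)
  exact measurable_pi_iff

variable {r : ℕ}

lemma measurableSet_posSemidef :
    MeasurableSet {A : Matrix (Fin r) (Fin r) ℝ | A.PosSemidef} := by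
  have e : {A : Matrix (Fin r) (Fin r) ℝ | A.PosSemidef}
      = {A | Aᵀ = A} ∩ ⋂ x : Fin r → ℝ, {A | 0 ≤ x ⬝ᵥ A *ᵥ x} := by
    ext A
    simp [Matrix.posSemidef_iff_dotProduct_mulVec, Matrix.IsHermitian,
      Matrix.conjTranspose_eq_transpose_of_trivial]
  rw [e]
  refine (IsClosed.inter ?_ (isClosed_iInter fun x => ?_)).measurableSet
  · exact isClosed_eq (by fun_prop) continuous_id
  · exact isClosed_le continuous_const (by fun_prop)

/-- The square root is Borel, as the inverse of squaring, an injective Borel map on the positive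
semidefinite matrices (Lusin–Souslin); elsewhere it takes the value zero. -/
lemma measurable_sqrt : Measurable (CFC.sqrt : Matrix (Fin r) (Fin r) ℝ → _) := by
  intro S hS
  set p : Set (Matrix (Fin r) (Fin r) ℝ) := {A | A.PosSemidef} with hp
  have hpm : MeasurableSet p := measurableSet_posSemidef
  have hsq : Measurable fun A : Matrix (Fin r) (Fin r) ℝ => A * A := by
    exact (by fun_prop : Continuous fun A : Matrix (Fin r) (Fin r) ℝ => A * A).measurable
  have hsqrt : ∀ A ∈ p, CFC.sqrt (A * A) = A := fun A hA =>
    CFC.sqrt_unique rfl (Matrix.nonneg_iff_posSemidef.2 hA)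
  have hinj : Set.InjOn (fun A : Matrix (Fin r) (Fin r) ℝ => A * A) (S ∩ p) := by
    intro A hA B hB hAB
    rw [← hsqrt A hA.2, ← hsqrt B hB.2]
    exact congrArg _ hAB
  have e : CFC.sqrt ⁻¹' S = (fun A => A * A) '' (S ∩ p) ∪ (pᶜ ∩ {A | (0 : Matrix _ _ ℝ) ∈ S}) := by
    ext A
    constructor
    · intro hA
      by_cases hAp : A ∈ p
      · have hA0 : (0 : Matrix (Fin r) (Fin r) ℝ) ≤ A := Matrix.nonneg_iff_posSemidef.2 hAp
        exact Or.inl ⟨CFC.sqrt A, ⟨hA, Matrix.nonneg_iff_posSemidef.1 (CFC.sqrt_nonneg A)⟩,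
          CFC.sqrt_mul_sqrt_self A hA0⟩
      · refine Or.inr ⟨hAp, ?_⟩
        have : CFC.sqrt A = 0 := cfcₙ_apply_of_not_predicate A
          (fun h => hAp (Matrix.nonneg_iff_posSemidef.1 h))
        change CFC.sqrt A ∈ S at hA
        rwa [this] at hA
    · rintro (⟨B, ⟨hB, hBp⟩, rfl⟩ | ⟨hAp, h0⟩)
      · change CFC.sqrt (B * B) ∈ S
        rwa [hsqrt B hBp]
      · have : CFC.sqrt A = 0 := cfcₙ_apply_of_not_predicate A
          (fun h => hAp (Matrix.nonneg_iff_posSemidef.1 h))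
        change CFC.sqrt A ∈ S
        rwa [this]
  rw [e]
  exact ((hS.inter hpm).image_of_measurable_injOn hsq hinj).union
    (hpm.compl.inter (MeasurableSet.const _))

lemma measurable_matrix_det {ι : Type*} [Fintype ι] [DecidableEq ι] :
    Measurable fun A : Matrix ι ι ℝ => A.det :=
  (by fun_prop : Continuous fun A : Matrix ι ι ℝ => A.det).measurable

lemma measurable_matrix_inv {ι : Type*} [Fintype ι] [DecidableEq ι] :
    Measurable fun A : Matrix ι ι ℝ => A⁻¹ := by
  rw [measurable_matrix_iff]
  intro i j
  have hadj : Measurable fun A : Matrix ι ι ℝ => A.adjugate i j := by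
    have : Continuous fun A : Matrix ι ι ℝ => A.adjugate i j := by fun_prop
    exact this.measurable
  simp_rw [Matrix.inv_def, Matrix.smul_apply, Ring.inverse_eq_inv', smul_eq_mul]
  exact measurable_matrix_det.inv.mul hadj

lemma measurable_invSqrt : Measurable (invSqrt : Matrix (Fin r) (Fin r) ℝ → _) :=
  measurable_matrix_inv.comp measurable_sqrt

lemma Measurable.matrix_mul {Ω : Type*} {_ : MeasurableSpace Ω} {l m n : Type*} [Fintype m]
    {A : Ω → Matrix l m ℝ} {B : Ω → Matrix m n ℝ} (hA : Measurable A) (hB : Measurable B) :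
    Measurable fun ω => A ω * B ω := by
  rw [measurable_matrix_iff] at *
  intro i j
  simp only [Matrix.mul_apply]
  exact Finset.measurable_fun_sum _ fun k _ => (hA i k).mul (hB k j)

lemma Measurable.act {Ω : Type*} {_ : MeasurableSpace Ω} {r s : ℕ}
    {A : Ω → Matrix (Fin r) (Fin s) ℝ} {v : Ω → Vec s} (hA : Measurable A) (hv : Measurable v) :
    Measurable fun ω => act (A ω) (v ω) := by
  rw [measurable_matrix_iff] at hA
  refine (WithLp.measurable_toLp 2 _).comp (measurable_pi_iff.2 fun i => ?_)
  simp only [Matrix.mulVec, dotProduct]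
  refine Finset.measurable_fun_sum _ fun k _ => (hA i k).mul ?_
  exact (measurable_pi_iff.1 ((WithLp.measurable_ofLp 2 _).comp hv) k)

lemma transpose_invSqrt (A : Matrix (Fin r) (Fin r) ℝ) : (invSqrt A)ᵀ = invSqrt A := by
  have h : (CFC.sqrt A).PosSemidef := Matrix.nonneg_iff_posSemidef.1 (CFC.sqrt_nonneg A)
  have h1 : (CFC.sqrt A)ᵀ = CFC.sqrt A := by
    simpa [Matrix.conjTranspose_eq_transpose_of_trivial] using h.1.eq
  rw [invSqrt, Matrix.transpose_nonsing_inv, h1]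

lemma invSqrt_mul_mul_invSqrt {A : Matrix (Fin r) (Fin r) ℝ} (hA : A.PosSemidef)
    (hdet : A.det ≠ 0) : invSqrt A * A * invSqrt A = 1 := by
  have h0 : CFC.sqrt A * CFC.sqrt A = A :=
    CFC.sqrt_mul_sqrt_self A (Matrix.nonneg_iff_posSemidef.2 hA)
  have hd : IsUnit (CFC.sqrt A).det := by
    rw [isUnit_iff_ne_zero]
    intro h
    apply hdet
    rw [← h0, Matrix.det_mul, h, zero_mul]
  calc invSqrt A * A * invSqrt A
      = invSqrt A * (CFC.sqrt A * CFC.sqrt A) * invSqrt A := by rw [h0]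
    _ = ((CFC.sqrt A)⁻¹ * CFC.sqrt A) * (CFC.sqrt A * (CFC.sqrt A)⁻¹) := by
        simp only [invSqrt, Matrix.mul_assoc]
    _ = 1 := by rw [Matrix.nonsing_inv_mul _ hd, Matrix.mul_nonsing_inv _ hd, Matrix.mul_one]

end InvSqrt

/-! ### The annihilator matrix -/

section Annihilator

variable {n k : Type*} [Fintype n] [DecidableEq n] [Fintype k] [DecidableEq k]

/-- The residual maker `I - W (W'W)⁻¹ W'`; it is the identity when `W'W` is singular. -/
noncomputable def annihilator (W : Matrix n k ℝ) : Matrix n n ℝ := 1 - W * (Wᵀ * W)⁻¹ * Wᵀ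

variable (W : Matrix n k ℝ)

lemma transpose_annihilator : (annihilator W)ᵀ = annihilator W := by
  simp only [annihilator, Matrix.transpose_sub, Matrix.transpose_one, Matrix.transpose_mul,
    Matrix.transpose_transpose, Matrix.transpose_nonsing_inv, Matrix.mul_assoc]

lemma annihilator_mul_self : annihilator W * annihilator W = annihilator W := by
  by_cases h : IsUnit (Wᵀ * W).det
  · have e : W * (Wᵀ * W)⁻¹ * Wᵀ * (W * (Wᵀ * W)⁻¹ * Wᵀ) = W * (Wᵀ * W)⁻¹ * Wᵀ := by
      calc _ = W * ((Wᵀ * W)⁻¹ * (Wᵀ * W)) * (Wᵀ * W)⁻¹ * Wᵀ := by simp only [Matrix.mul_assoc]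
        _ = _ := by rw [Matrix.nonsing_inv_mul _ h, Matrix.mul_one]
    simp only [annihilator, Matrix.mul_sub, Matrix.sub_mul, Matrix.one_mul, Matrix.mul_one, e]
    abel
  · simp [annihilator, Matrix.nonsing_inv_apply_not_isUnit _ h]

lemma annihilator_mul (h : (Wᵀ * W).det ≠ 0) : annihilator W * W = 0 := by
  rw [annihilator, Matrix.sub_mul, Matrix.one_mul, Matrix.mul_assoc, Matrix.mul_assoc,
    Matrix.nonsing_inv_mul _ (isUnit_iff_ne_zero.2 h), Matrix.mul_one, sub_self]

lemma annihilator_symm (i j : n) : annihilator W i j = annihilator W j i := by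
  conv_lhs => rw [← transpose_annihilator, Matrix.transpose_apply]

lemma sum_annihilator_mul (i l : n) :
    ∑ j, annihilator W i j * annihilator W j l = annihilator W i l := by
  rw [← Matrix.mul_apply, annihilator_mul_self]

lemma sum_sq_annihilator (i : n) : ∑ j, annihilator W i j ^ 2 = annihilator W i i := by
  rw [← sum_annihilator_mul W i i]
  exact Finset.sum_congr rfl fun j _ => by rw [sq, annihilator_symm W j i]

lemma annihilator_diag_le_one (i : n) : annihilator W i i ≤ 1 := by
  have h : annihilator W i i ^ 2 ≤ annihilator W i i := by
    conv_rhs => rw [← sum_sq_annihilator]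
    exact Finset.single_le_sum (f := fun j => annihilator W i j ^ 2) (fun j _ => sq_nonneg _)
      (Finset.mem_univ i)
  nlinarith

lemma sum_sq_annihilator_le_one (i : n) : ∑ j, annihilator W i j ^ 2 ≤ 1 := by
  rw [sum_sq_annihilator]; exact annihilator_diag_le_one W i

lemma abs_annihilator_le_one (i j : n) : |annihilator W i j| ≤ 1 := by
  have h := Finset.single_le_sum (f := fun j => annihilator W i j ^ 2) (fun j _ => sq_nonneg _)
    (Finset.mem_univ j)
  exact abs_le_one_iff_mul_self_le_one.2
    (by rw [← sq]; exact h.trans (sum_sq_annihilator_le_one W i))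

lemma sum_annihilator_sum_mul (a b : n → ℝ) :
    ∑ i, (∑ j, annihilator W i j * a j) * (∑ l, annihilator W i l * b l)
      = ∑ j, ∑ l, annihilator W j l * (a j * b l) := by
  simp_rw [Finset.sum_mul_sum]
  rw [Finset.sum_comm]
  refine Finset.sum_congr rfl fun j _ => ?_
  rw [Finset.sum_comm]
  refine Finset.sum_congr rfl fun l _ => ?_
  rw [← sum_annihilator_mul W j l, Finset.sum_mul]
  exact Finset.sum_congr rfl fun i _ => by rw [annihilator_symm W i j]; ring

/-- The annihilator is a contraction. -/
lemma sum_sq_annihilator_sum_le (a : n → ℝ) :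
    ∑ i, (∑ j, annihilator W i j * a j) ^ 2 ≤ ∑ i, a i ^ 2 := by
  have h1 : ∑ i, (∑ j, annihilator W i j * a j) ^ 2
      = ∑ i, a i * ∑ j, annihilator W i j * a j := by
    simp_rw [sq]
    rw [sum_annihilator_sum_mul]
    refine Finset.sum_congr rfl fun i _ => ?_
    rw [Finset.mul_sum]
    exact Finset.sum_congr rfl fun j _ => by ring
  have h2 : 0 ≤ ∑ i, (a i - ∑ j, annihilator W i j * a j) ^ 2 :=
    Finset.sum_nonneg fun i _ => sq_nonneg _
  have h3 : ∀ i, (a i - ∑ j, annihilator W i j * a j) ^ 2 = a i ^ 2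
      - 2 * (a i * ∑ j, annihilator W i j * a j) + (∑ j, annihilator W i j * a j) ^ 2 :=
    fun i => by ring
  simp_rw [h3] at h2
  rw [Finset.sum_add_distrib, Finset.sum_sub_distrib, ← Finset.mul_sum, ← h1] at h2
  linarith

lemma measurable_annihilator : Measurable fun W : Matrix n k ℝ => annihilator W := by
  have ht : Measurable fun W : Matrix n k ℝ => Wᵀ :=
    measurable_matrix_iff.2 fun i j => measurable_matrix_iff.1 measurable_id j i
  have h : Measurable fun W : Matrix n k ℝ => W * (Wᵀ * W)⁻¹ * Wᵀ :=
    (measurable_id.matrix_mul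
      (measurable_matrix_inv.comp (ht.matrix_mul measurable_id))).matrix_mul ht
  refine measurable_matrix_iff.2 fun i j => ?_
  simp only [annihilator, Matrix.sub_apply]
  exact (measurable_matrix_iff.1 h i j).const_sub _

end Annihilator

/-! ### Algebra and measurability of the sample quantities -/

namespace PLSample

variable {d k n : ℕ} {Ω : Type*} [mΩ : MeasurableSpace Ω] {μ : Measure Ω} {β : Vec d}
  (D : PLSample d k n μ β)

lemma M_eq_annihilator (ω : Ω) : D.M ω = annihilator (D.W ω) := rfl

lemma gramW_eq (ω : Ω) : D.gramW ω = (D.W ω)ᵀ * D.W ω := by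
  ext a b
  simp [gramW, outer, W, Matrix.mul_apply, Matrix.sum_apply, Matrix.vecMulVec_apply]

lemma 𝒲_le_𝒳𝒲 : D.𝒲 ≤ D.𝒳𝒲 := le_sup_right

lemma 𝒳𝒲_le : D.𝒳𝒲 ≤ mΩ :=
  sup_le (iSup_le fun i => (D.measurable_x i).comap_le) D.𝒲_le

lemma measurable_x_𝒳𝒲 (i : Fin n) : Measurable[D.𝒳𝒲] (D.x i) :=
  Measurable.of_comap_le ((le_iSup (fun i => MeasurableSpace.comap (D.x i) inferInstance) i).trans
    le_sup_left)

lemma measurable_W : Measurable[D.𝒲] D.W := by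
  refine (@measurable_matrix_iff Ω D.𝒲 _ _ _).2 fun i a => ?_
  exact (by fun_prop : Measurable fun v : Vec k => v a).comp (D.measurable_w i)

lemma measurable_M (i j : Fin n) : Measurable[D.𝒲] fun ω => D.M ω i j :=
  (measurable_matrix_iff.1 measurable_annihilator i j).comp D.measurable_W

lemma measurable_vhat (i : Fin n) : Measurable[D.𝒳𝒲] (D.vhat i) := by
  refine Finset.measurable_fun_sum _ fun j _ => ?_
  exact ((D.measurable_M i j).mono D.𝒲_le_𝒳𝒲 le_rfl).smul (D.measurable_x_𝒳𝒲 j)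

lemma measurable_Γhat : Measurable[D.𝒳𝒲] D.Γhat := by
  refine (@measurable_matrix_iff Ω D.𝒳𝒲 _ _ _).2 fun a b => ?_
  have : (fun ω => D.Γhat ω a b) = fun ω => (n : ℝ)⁻¹ * ∑ i, D.vhat i ω a * D.vhat i ω b := by
    ext ω
    simp [Γhat, outer, Matrix.sum_apply, Matrix.vecMulVec_apply]
  rw [this]
  have hc : ∀ i a, Measurable[D.𝒳𝒲] fun ω => D.vhat i ω a := fun i a =>
    (by fun_prop : Measurable fun v : Vec d => v a).comp (D.measurable_vhat i)
  exact (Finset.measurable_fun_sum _ fun i _ => (hc i a).mul (hc i b)).const_mul _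

lemma measurable_SigmaHat : Measurable[D.𝒳𝒲] D.SigmaHat := by
  refine (@measurable_matrix_iff Ω D.𝒳𝒲 _ _ _).2 fun a b => ?_
  have : (fun ω => D.SigmaHat ω a b) = fun ω => (n : ℝ)⁻¹ * ∑ g ∈ D.G.parts, ∑ i ∈ g, ∑ j ∈ g,
      (μ[fun ω' => D.u i ω' * D.u j ω' | D.𝒳𝒲]) ω * (D.vhat i ω a * D.vhat j ω b) := by
    ext ω
    simp [SigmaHat, outer, Matrix.sum_apply, Matrix.vecMulVec_apply]
  rw [this]
  have hc : ∀ i a, Measurable[D.𝒳𝒲] fun ω => D.vhat i ω a := fun i a =>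
    (by fun_prop : Measurable fun v : Vec d => v a).comp (D.measurable_vhat i)
  refine (Finset.measurable_fun_sum _ fun g _ => Finset.measurable_fun_sum _ fun i _ =>
    Finset.measurable_fun_sum _ fun j _ => ?_).const_mul _
  exact stronglyMeasurable_condExp.measurable.mul ((hc i a).mul (hc j b))

lemma measurable_sandwich : Measurable[D.𝒳𝒲] D.sandwich :=
  ((measurable_matrix_inv.comp D.measurable_Γhat).matrix_mul D.measurable_SigmaHat).matrix_mul
    (measurable_matrix_inv.comp D.measurable_Γhat)

lemma measurable_V (i : Fin n) : Measurable (D.V i) :=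
  (D.measurable_x i).sub (stronglyMeasurable_condExp.measurable.mono D.𝒲_le le_rfl)

/-- The quadratic form of `Γ̂`. -/
lemma dotProduct_Γhat_mulVec (ω : Ω) (a : Fin d → ℝ) :
    a ⬝ᵥ D.Γhat ω *ᵥ a = (n : ℝ)⁻¹ * ∑ i, (∑ p, a p * D.vhat i ω p) ^ 2 := by
  simp only [Γhat, outer, Matrix.smul_mulVec, dotProduct_smul, Matrix.sum_mulVec, dotProduct_sum,
    Matrix.vecMulVec_mulVec, smul_eq_mul]
  congr 1
  refine Finset.sum_congr rfl fun i _ => ?_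
  simp only [dotProduct, Finset.sum_mul, sq]
  simp [Finset.sum_mul, Finset.mul_sum]
  rw [Finset.sum_comm]
  exact Finset.sum_congr rfl fun p _ => Finset.sum_congr rfl fun q _ => by ring

lemma transpose_Γhat (ω : Ω) : (D.Γhat ω)ᵀ = D.Γhat ω := by
  ext a b
  simp [Γhat, outer, Matrix.sum_apply, Matrix.vecMulVec_apply, mul_comm]

lemma posSemidef_Γhat (ω : Ω) : (D.Γhat ω).PosSemidef := by
  refine Matrix.PosSemidef.of_dotProduct_mulVec_nonneg ?_ fun a => ?_
  · rw [Matrix.IsHermitian, Matrix.conjTranspose_eq_transpose_of_trivial, D.transpose_Γhat]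
  · rw [star_trivial, dotProduct_Γhat_mulVec]
    positivity

/-- Coordinates of the partialled-out variables, for an arbitrary array. -/
lemma sum_M_smul_apply (ω : Ω) (z : Fin n → Vec d) (i : Fin n) (p : Fin d) :
    (∑ j, D.M ω i j • z j) p = ∑ j, D.M ω i j * z j p := by
  simp

lemma vhat_apply (ω : Ω) (i : Fin n) (p : Fin d) :
    D.vhat i ω p = ∑ j, annihilator (D.W ω) i j * D.x j ω p :=
  D.sum_M_smul_apply ω (fun j => D.x j ω) i p

lemma sum_M_mul_w (ω : Ω) (h : 0 < lamMin (D.gramW ω)) (i : Fin n) (a : Fin k) :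
    ∑ j, D.M ω i j * D.w j ω a = 0 := by
  have := annihilator_mul (D.W ω) (by rw [← gramW_eq]; exact det_ne_zero_of_lamMin_pos h)
  have h2 := congrFun (congrFun this i) a
  simpa [Matrix.mul_apply, W, M_eq_annihilator] using h2

/-- Where `W'W` is nonsingular, the linear prediction of `x_i` from `w_i` is annihilated. -/
lemma sum_M_smul_act_w (ω : Ω) (h : 0 < lamMin (D.gramW ω)) (B : Matrix (Fin d) (Fin k) ℝ)
    (i : Fin n) : ∑ j, D.M ω i j • act B (D.w j ω) = 0 := by
  ext p
  rw [D.sum_M_smul_apply ω (fun j => act B (D.w j ω))]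
  simp only [act, Matrix.mulVec, dotProduct, Finset.mul_sum]
  rw [Finset.sum_comm]
  simp only [PiLp.zero_apply]
  refine Finset.sum_eq_zero fun a _ => ?_
  have := D.sum_M_mul_w ω h i a
  calc ∑ j, D.M ω i j * (B p a * D.w j ω a) = B p a * ∑ j, D.M ω i j * D.w j ω a := by
        rw [Finset.mul_sum]; exact Finset.sum_congr rfl fun j _ => by ring
    _ = 0 := by rw [this, mul_zero]

/-- As `M` is a symmetric idempotent, the cross moments of `v̂` and `x` are those of `v̂` with
itself. -/
lemma sum_vhat_mul_x (ω : Ω) (a b : Fin d) :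
    ∑ i, D.vhat i ω a * D.x i ω b = ∑ i, D.vhat i ω a * D.vhat i ω b := by
  simp only [vhat_apply]
  rw [sum_annihilator_sum_mul (D.W ω) (fun j => D.x j ω a) (fun j => D.x j ω b)]
  simp_rw [Finset.sum_mul]
  rw [Finset.sum_comm]
  refine Finset.sum_congr rfl fun j _ => Finset.sum_congr rfl fun l _ => ?_
  rw [annihilator_symm]; ring

lemma sum_vhat_mul_w (ω : Ω) (h : 0 < lamMin (D.gramW ω)) (a : Fin d) (b : Fin k) :
    ∑ i, D.vhat i ω a * D.w i ω b = 0 := by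
  simp only [vhat, D.sum_M_smul_apply ω (fun j => D.x j ω)]
  simp_rw [Finset.sum_mul]
  rw [Finset.sum_comm]
  refine Finset.sum_eq_zero fun j _ => ?_
  have := D.sum_M_mul_w ω h j b
  calc ∑ i, D.M ω i j * D.x j ω a * D.w i ω b = D.x j ω a * ∑ i, D.M ω j i * D.w i ω b := by
        rw [Finset.mul_sum]
        refine Finset.sum_congr rfl fun i _ => ?_
        rw [M_eq_annihilator, annihilator_symm]; ring
    _ = 0 := by rw [this, mul_zero]

/-- The estimation error is the score premultiplied by the inverse of `Γ̂`. -/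
lemma sqrt_smul_βhat_sub (ω : Ω) (hw : 0 < lamMin (D.gramW ω)) (hΓ : 0 < lamMin (D.Γhat ω)) :
    Real.sqrt n • (D.βhat ω - β) = act (D.Γhat ω)⁻¹ (D.S ω) := by
  have hdet : IsUnit (D.Γhat ω).det := isUnit_iff_ne_zero.2 (det_ne_zero_of_lamMin_pos hΓ)
  have hnum : ((n : ℝ)⁻¹ • ∑ i, D.y i ω • D.vhat i ω)
      = act (D.Γhat ω) β + (n : ℝ)⁻¹ • ∑ i, D.u i ω • D.vhat i ω := by
    ext a
    have hy : ∀ i, D.y i ω = ∑ b, β b * D.x i ω b + ∑ b, D.γ b * D.w i ω b + D.u i ω := by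
      intro i
      rw [D.model]
      simp [PiLp.inner_apply, mul_comm]
    have e1 : ∑ i, D.y i ω * D.vhat i ω a
        = ∑ b, (∑ i, D.vhat i ω a * D.vhat i ω b) * β b + ∑ i, D.u i ω * D.vhat i ω a := by
      calc ∑ i, D.y i ω * D.vhat i ω a
          = ∑ b, (∑ i, D.vhat i ω a * D.x i ω b) * β b
            + ∑ b, (∑ i, D.vhat i ω a * D.w i ω b) * D.γ b + ∑ i, D.u i ω * D.vhat i ω a := by
            simp_rw [hy, add_mul, Finset.sum_add_distrib, Finset.sum_mul]
            congr 2
            · rw [Finset.sum_comm]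
              exact Finset.sum_congr rfl fun _ _ => Finset.sum_congr rfl fun _ _ => by ring
            · rw [Finset.sum_comm]
              exact Finset.sum_congr rfl fun _ _ => Finset.sum_congr rfl fun _ _ => by ring
        _ = _ := by
            simp_rw [D.sum_vhat_mul_w ω hw, D.sum_vhat_mul_x, zero_mul]
            simp
    have e2 : (act (D.Γhat ω) β) a = (n : ℝ)⁻¹ * ∑ b, (∑ i, D.vhat i ω a * D.vhat i ω b) * β b := by
      simp only [act, Matrix.mulVec, dotProduct]
      rw [Finset.mul_sum]
      refine Finset.sum_congr rfl fun b _ => ?_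
      simp [Γhat, outer, Matrix.sum_apply, Matrix.vecMulVec_apply]
      ring
    rw [PiLp.add_apply, e2]
    simp only [PiLp.smul_apply, WithLp.ofLp_sum, Finset.sum_apply, WithLp.ofLp_smul, Pi.smul_apply,
      smul_eq_mul]
    rw [e1]; ring
  have hact : ∀ u v : Vec d, act (D.Γhat ω)⁻¹ (u + v)
      = act (D.Γhat ω)⁻¹ u + act (D.Γhat ω)⁻¹ v := fun u v => by
    simp [act, Matrix.mulVec_add]
  have hinv : act (D.Γhat ω)⁻¹ (act (D.Γhat ω) β) = β := by
    simp [act, Matrix.mulVec_mulVec, Matrix.nonsing_inv_mul _ hdet]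
  rw [βhat, if_pos hΓ, hnum, hact, hinv, add_sub_cancel_left]
  have hsm : ∀ (c : ℝ) (v : Vec d), act (D.Γhat ω)⁻¹ (c • v) = c • act (D.Γhat ω)⁻¹ v :=
    fun c v => by simp [act, Matrix.mulVec_smul]
  rw [S, hsm, hsm, smul_smul]
  congr 1
  rcases Nat.eq_zero_or_pos n with h | h
  · simp [h]
  · have : (0 : ℝ) < n := by exact_mod_cast h
    have hs : Real.sqrt n ≠ 0 := (Real.sqrt_pos.2 this).ne'
    field_simp
    rw [Real.sq_sqrt this.le]

lemma measurable_βhat [IsFiniteMeasure μ] : Measurable D.βhat := by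
  classical
  have hvh : ∀ i, Measurable (D.vhat i) := fun i => (D.measurable_vhat i).mono D.𝒳𝒲_le le_rfl
  have hΓ : Measurable D.Γhat := D.measurable_Γhat.mono D.𝒳𝒲_le le_rfl
  have hset : {ω | 0 < lamMin (D.Γhat ω)} = {ω | (D.Γhat ω).det ≠ 0} := by
    ext ω; exact lamMin_pos_iff_det_ne_zero (D.posSemidef_Γhat ω)
  have hms : MeasurableSet {ω | 0 < lamMin (D.Γhat ω)} := by
    rw [hset]
    exact ((measurable_matrix_det.comp hΓ) (measurableSet_singleton (0 : ℝ))).compl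
  have hy : ∀ i, Measurable (D.y i) := fun i => by
    have : D.y i = fun ω => inner ℝ β (D.x i ω) + inner ℝ D.γ (D.w i ω) + D.u i ω :=
      funext fun ω => D.model i ω
    rw [this]
    have hw : Measurable (D.w i) := (D.measurable_w i).mono D.𝒲_le le_rfl
    have hx := D.measurable_x i
    have hu := D.measurable_u i
    fun_prop
  unfold βhat
  refine Measurable.ite hms ?_ measurable_const
  refine Measurable.act (measurable_matrix_inv.comp hΓ) ?_
  exact (Finset.measurable_fun_sum _ fun i _ => (hy i).smul (hvh i)).const_smul (n : ℝ)⁻¹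

end PLSample

/-! ### The conditional law of the auxiliary errors -/

lemma memLp_four_of_lintegral_le {E : Type*} [MeasurableSpace E] {P : Measure E} {f : E → ℝ}
    (hf : Measurable f) {K : ℝ≥0} (h : ∫⁻ e, ‖f e‖ₑ ^ 4 ∂P ≤ K) :
    MemLp f 4 P ∧ ∫ e, f e ^ 4 ∂P ≤ K := by
  constructor
  · refine ⟨hf.aestronglyMeasurable, ?_⟩
    rw [eLpNorm_lt_top_iff_lintegral_rpow_enorm_lt_top (by norm_num) (by norm_num)]
    have : (4 : ℝ≥0∞).toReal = ((4 : ℕ) : ℝ) := by norm_num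
    simp_rw [this, ENNReal.rpow_natCast]
    exact h.trans_lt ENNReal.coe_lt_top
  · rw [integral_eq_lintegral_of_nonneg_ae (Eventually.of_forall fun e => by positivity)
      (hf.pow_const 4).aestronglyMeasurable]
    have e1 : ∀ e, ENNReal.ofReal (f e ^ 4) = ‖f e‖ₑ ^ 4 := fun e => by
      rw [← Even.pow_abs (⟨2, rfl⟩ : Even 4), ENNReal.ofReal_pow (abs_nonneg _),
        ← Real.norm_eq_abs, ofReal_norm]
    simp_rw [e1]
    exact (ENNReal.toReal_mono ENNReal.coe_ne_top h).trans (by simp)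

lemma Finpartition.card_filter_part_eq_le {n : ℕ} (G : Finpartition (Finset.univ : Finset (Fin n)))
    (i : Fin n) :
    (Finset.univ.filter fun j => G.part i = G.part j).card ≤ G.parts.sup Finset.card := by
  have h1 : G.part i ∈ G.parts := G.part_mem.2 (Finset.mem_univ i)
  refine (Finset.card_le_card fun j hj => ?_).trans (Finset.le_sup (f := Finset.card) h1)
  rw [(Finset.mem_filter.1 hj).2]
  exact G.mem_part (Finset.mem_univ j)

namespace PLSample

variable {d k n : ℕ} {Ω : Type*} [mΩ : MeasurableSpace Ω] {μ : Measure Ω} {β : Vec d}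
  (D : PLSample d k n μ β)

/-- The array `(V_1, …, V_n)`. -/
noncomputable def Vvec (ω : Ω) : Fin n → Vec d := fun i => D.V i ω

lemma measurable_Vvec : Measurable D.Vvec := measurable_pi_iff.2 D.measurable_V

/-- The `(p, q)` entry of `(1/n) ∑_i Ṽ_i Ṽ_i'`, as a function of the array of the `V_i`; it is
the quadratic form with matrix `M / n`, because `M` is a symmetric idempotent. -/
noncomputable def quadV (p q : Fin d) (ω : Ω) (e : Fin n → Vec d) : ℝ :=
  ∑ j, ∑ l, ((n : ℝ)⁻¹ * annihilator (D.W ω) j l) * (e j p * e l q)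

/-- The `(p, q)` entry of `(1/n) ∑_i Ṽ_i Q_i'`, as a function of the array of the `V_i`. Given
`𝒲` it is a linear form, whose coefficients are the partialled-out `Q_j / n`. -/
noncomputable def crossV (p q : Fin d) (ω : Ω) (e : Fin n → Vec d) : ℝ :=
  ∑ j, ((n : ℝ)⁻¹ * ∑ l, annihilator (D.W ω) j l * D.Q l ω q) * e j p

/-- The sum of the squared deviations of the entries of `(1/n) ∑_i Ṽ_i Ṽ_i'` and
`(1/n) ∑_i Ṽ_i Q_i'` from their conditional means given `𝒲`, zero in the second case. -/
noncomputable def deviation (ω : Ω) (e : Fin n → Vec d) : ℝ :=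
  ∑ p, ∑ q, ((D.quadV p q ω e - D.condGramVtilde ω p q) ^ 2 + D.crossV p q ω e ^ 2)

lemma measurable_quadV (p q : Fin d) :
    Measurable[D.𝒲.prod inferInstance] (Function.uncurry (D.quadV p q)) := by
  change Measurable[D.𝒲.prod inferInstance] fun z : Ω × (Fin n → Vec d) =>
    ∑ j, ∑ l, ((n : ℝ)⁻¹ * annihilator (D.W z.1) j l) * (z.2 j p * z.2 l q)
  refine Finset.measurable_fun_sum _ fun j _ => Finset.measurable_fun_sum _ fun l _ => ?_
  have hM : Measurable[D.𝒲.prod inferInstance]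
      fun z : Ω × (Fin n → Vec d) => annihilator (D.W z.1) j l :=
    (D.measurable_M j l).comp measurable_fst
  have he : ∀ j p, Measurable[D.𝒲.prod inferInstance]
      fun z : Ω × (Fin n → Vec d) => z.2 j p := fun j p =>
    (by fun_prop : Measurable fun e : Fin n → Vec d => e j p).comp measurable_snd
  exact (hM.const_mul _).mul ((he j p).mul (he l q))

lemma measurable_Q (l : Fin n) : Measurable[D.𝒲] (D.Q l) := stronglyMeasurable_condExp.measurable

lemma measurable_crossV (p q : Fin d) :
    Measurable[D.𝒲.prod inferInstance] (Function.uncurry (D.crossV p q)) := by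
  change Measurable[D.𝒲.prod inferInstance] fun z : Ω × (Fin n → Vec d) =>
    ∑ j, ((n : ℝ)⁻¹ * ∑ l, annihilator (D.W z.1) j l * D.Q l z.1 q) * z.2 j p
  refine Finset.measurable_fun_sum _ fun j _ => ?_
  have he : Measurable[D.𝒲.prod inferInstance]
      fun z : Ω × (Fin n → Vec d) => z.2 j p :=
    (by fun_prop : Measurable fun e : Fin n → Vec d => e j p).comp measurable_snd
  have hb : Measurable[D.𝒲] fun ω =>
      (n : ℝ)⁻¹ * ∑ l, annihilator (D.W ω) j l * D.Q l ω q := by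
    refine (Finset.measurable_fun_sum _ fun l _ => (D.measurable_M j l).mul ?_).const_mul _
    exact (by fun_prop : Measurable fun v : Vec d => v q).comp (D.measurable_Q l)
  exact (hb.comp measurable_fst).mul he

lemma measurable_deviation :
    Measurable[D.𝒲.prod inferInstance] (Function.uncurry D.deviation) := by
  change Measurable[D.𝒲.prod inferInstance] fun z : Ω × (Fin n → Vec d) =>
    ∑ p, ∑ q, ((D.quadV p q z.1 z.2 - D.condGramVtilde z.1 p q) ^ 2 + D.crossV p q z.1 z.2 ^ 2)
  refine Finset.measurable_fun_sum _ fun p _ => Finset.measurable_fun_sum _ fun q _ => ?_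
  have hc : Measurable[D.𝒲] fun ω => D.condGramVtilde ω p q :=
    stronglyMeasurable_condExp.measurable
  exact (((D.measurable_quadV p q).sub (hc.comp measurable_fst)).pow_const 2).add
    ((D.measurable_crossV p q).pow_const 2)

lemma quadV_Vvec (p q : Fin d) (ω : Ω) :
    D.quadV p q ω (D.Vvec ω) = (n : ℝ)⁻¹ * ∑ i, D.Vtilde i ω p * D.Vtilde i ω q := by
  have h : ∀ i p, D.Vtilde i ω p = ∑ j, annihilator (D.W ω) i j * D.V j ω p := fun i p =>
    D.sum_M_smul_apply ω (fun j => D.V j ω) i p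
  simp_rw [h]
  rw [sum_annihilator_sum_mul (D.W ω) (fun j => D.V j ω p) (fun j => D.V j ω q), Finset.mul_sum]
  refine Finset.sum_congr rfl fun j _ => ?_
  rw [Finset.mul_sum]
  exact Finset.sum_congr rfl fun l _ => by simp [Vvec, mul_assoc]

lemma memLp_V (i : Fin n) : MemLp (D.V i) 2 μ :=
  (D.memLp_x i).sub ((D.memLp_x i).condExp (by norm_num))

lemma memLp_coord {f : Ω → Vec d} (hf : MemLp f 2 μ) (p : Fin d) :
    MemLp (fun ω => f ω p) 2 μ :=
  hf.mono ((by fun_prop : Continuous fun v : Vec d => v p).comp_aestronglyMeasurable hf.1)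
    (Eventually.of_forall fun ω => PiLp.norm_apply_le (f ω) p)

lemma integrable_quadV_Vvec (p q : Fin d) :
    Integrable (fun ω => D.quadV p q ω (D.Vvec ω)) μ := by
  refine integrable_finsetSum _ fun j _ => integrable_finsetSum _ fun l _ => ?_
  have h1 : Integrable (fun ω => D.V j ω p * D.V l ω q) μ :=
    (memLp_coord (D.memLp_V j) p).integrable_mul (memLp_coord (D.memLp_V l) q)
  refine Integrable.bdd_mul (c := |(n : ℝ)⁻¹|) h1 ?_ (Eventually.of_forall fun ω => ?_)
  · exact (((D.measurable_M j l).mono D.𝒲_le le_rfl).const_mul _).aestronglyMeasurable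
  · rw [Real.norm_eq_abs, abs_mul]
    exact mul_le_of_le_one_right (abs_nonneg _) (abs_annihilator_le_one _ _ _)

variable [IsProbabilityMeasure μ]

lemma ae_condGramVtilde_eq : ∀ᵐ ω ∂μ, ∀ p q,
    D.condGramVtilde ω p q = ∫ e, D.quadV p q ω e ∂condLaw D.𝒲 D.Vvec μ ω := by
  refine ae_all_iff.2 fun p => ae_all_iff.2 fun q => ?_
  have h := condExp_ae_eq_integral_condLaw (μ := μ) D.𝒲_le D.measurable_Vvec
    (D.measurable_quadV p q).stronglyMeasurable (D.integrable_quadV_Vvec p q)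
  filter_upwards [h] with ω hω
  rw [← hω]
  simp only [condGramVtilde, Matrix.of_apply]
  simp_rw [quadV_Vvec]

lemma ae_integral_coord_Vvec : ∀ᵐ ω ∂μ, ∀ i p,
    ∫ e : Fin n → Vec d, e i p ∂condLaw D.𝒲 D.Vvec μ ω = 0 := by
  refine ae_all_iff.2 fun i => ae_all_iff.2 fun p => ?_
  have hx : Integrable (D.x i) μ := (D.memLp_x i).integrable (by norm_num)
  have h0 : μ[D.V i | D.𝒲] =ᵐ[μ] 0 := by
    have h1 := condExp_sub hx (integrable_condExp (m := D.𝒲) (f := D.x i) (μ := μ)) D.𝒲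
    have h2 : μ[μ[D.x i | D.𝒲] | D.𝒲] = μ[D.x i | D.𝒲] :=
      condExp_of_stronglyMeasurable D.𝒲_le stronglyMeasurable_condExp integrable_condExp
    rw [h2, sub_self] at h1
    exact h1
  have hV : Integrable (D.V i) μ := (D.memLp_V i).integrable (by norm_num)
  have h3 := (EuclideanSpace.proj (𝕜 := ℝ) p : Vec d →L[ℝ] ℝ).comp_condExp_comm (m := D.𝒲) hV
  have h := condExp_ae_eq_integral_condLaw (μ := μ) D.𝒲_le D.measurable_Vvec
    (f := fun _ (e : Fin n → Vec d) => e i p)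
    ((by fun_prop : Measurable fun e : Fin n → Vec d => e i p).comp
      measurable_snd).stronglyMeasurable
    ((memLp_coord (D.memLp_V i) p).integrable (by norm_num))
  filter_upwards [h0, h3, h] with ω h0 h3 h
  rw [← h]
  have h4 : (μ[fun ω => D.V i ω p | D.𝒲]) ω = (μ[D.V i | D.𝒲] ω) p := h3.symm
  change (μ[fun ω => D.V i ω p | D.𝒲]) ω = 0
  rw [h4, h0]; rfl

lemma ae_memLp_coord_Vvec : ∀ᵐ ω ∂μ, ∀ K : ℝ≥0,
    (∀ i, condLExp D.𝒲 μ (fun ω' => ‖D.V i ω'‖ₑ ^ 4) ω ≤ K) → ∀ i p,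
      MemLp (fun e : Fin n → Vec d => e i p) 4 (condLaw D.𝒲 D.Vvec μ ω) ∧
        ∫ e, e i p ^ 4 ∂condLaw D.𝒲 D.Vvec μ ω ≤ K := by
  have h : ∀ᵐ ω ∂μ, ∀ i, condLExp D.𝒲 μ (fun ω' => ‖D.V i ω'‖ₑ ^ 4) ω
      = ∫⁻ e : Fin n → Vec d, ‖e i‖ₑ ^ 4 ∂condLaw D.𝒲 D.Vvec μ ω := by
    refine ae_all_iff.2 fun i => ?_
    exact condLExp_ae_eq_lintegral_condLaw D.𝒲_le D.measurable_Vvec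
      (f := fun _ (e : Fin n → Vec d) => ‖e i‖ₑ ^ 4)
      ((by fun_prop : Measurable fun e : Fin n → Vec d => ‖e i‖ₑ ^ 4).comp measurable_snd)
  filter_upwards [h] with ω hω K hK i p
  refine memLp_four_of_lintegral_le (by fun_prop) (le_trans (lintegral_mono fun e => ?_)
    ((hω i).symm.le.trans (hK i)))
  have h1 : ‖e i p‖ₑ ≤ ‖e i‖ₑ := by
    rw [enorm_le_iff_norm_le]; exact PiLp.norm_apply_le (e i) p
  simp only
  gcongr

lemma ae_clusterIndep_V (h : CondIndepFamily μ D.𝒲 D.clusterV) : ∀ᵐ ω ∂μ,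
    ClusterIndep D.G.part (fun i (e : Fin n → Vec d) => e i) (condLaw D.𝒲 D.Vvec μ ω) := by
  have h1 := CondIndepFamily.ae_iIndepFun (μ := μ) D.𝒲_le D.measurable_Vvec
    (φ := fun (g : D.G.parts) (e : Fin n → Vec d) (i : g.1) => e i)
    (fun g => measurable_pi_lambda _ fun i => measurable_pi_apply _) h
  filter_upwards [h1] with ω hω
  exact iIndepFun.clusterIndep D.G (fun i => measurable_pi_apply i) hω

/-- The conditional mean of the squared deviation is of order `1 / n`. -/
lemma ae_lintegral_deviation_le (h : CondIndepFamily μ D.𝒲 D.clusterV) (hn : 0 < n) :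
    ∀ᵐ ω ∂μ, ∀ (K L : ℝ≥0) (C : ℕ), D.maxClusterSize ≤ C →
      (∀ i, condLExp D.𝒲 μ (fun ω' => ‖D.V i ω'‖ₑ ^ 4) ω ≤ K) →
      (n : ℝ)⁻¹ * ∑ i, ‖D.Q i ω‖ ^ 2 ≤ L →
      ∫⁻ e, ENNReal.ofReal (D.deviation ω e) ∂condLaw D.𝒲 D.Vvec μ ω
        ≤ ENNReal.ofReal (d ^ 2 * (2 * C ^ 2 * K + C * ((1 + K) * L)) / n) := by
  filter_upwards [D.ae_condGramVtilde_eq, D.ae_integral_coord_Vvec, D.ae_memLp_coord_Vvec,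
    D.ae_clusterIndep_V h] with ω hgram h0 h4 hind K L C hC hK hL
  set P := condLaw D.𝒲 D.Vvec μ ω with hP
  have h4 := h4 K hK
  have hcard : ∀ i, (Finset.univ.filter fun j => D.G.part i = D.G.part j).card ≤ C := fun i =>
    (D.G.card_filter_part_eq_le i).trans hC
  have hn' : (0 : ℝ) < n := by exact_mod_cast hn
  have hmul : ∀ j l p q, Integrable (fun e : Fin n → Vec d => e j p * e l q) P := fun j l p q =>
    (MemLp.mul_of_four (h4 j p).1 (h4 l q).1).integrable (by norm_num)
  have hdev : ∀ p q e, D.quadV p q ω e - D.condGramVtilde ω p q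
      = ∑ j, ∑ l, ((n : ℝ)⁻¹ * annihilator (D.W ω) j l) *
        (e j p * e l q - ∫ e' : Fin n → Vec d, e' j p * e' l q ∂P) := by
    intro p q e
    rw [hgram]
    simp only [quadV]
    rw [integral_finsetSum _ fun j _ =>
        integrable_finsetSum _ fun l _ => (hmul j l p q).const_mul _,
      ← Finset.sum_sub_distrib]
    refine Finset.sum_congr rfl fun j _ => ?_
    rw [integral_finsetSum _ fun l _ => (hmul j l p q).const_mul _, ← Finset.sum_sub_distrib]
    refine Finset.sum_congr rfl fun l _ => ?_
    rw [integral_const_mul]; ring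
  have hmeas : ∀ p, Measurable fun v : Vec d => v p := fun p => by fun_prop
  have hq : ∀ p q, ∫ e, (D.quadV p q ω e - D.condGramVtilde ω p q) ^ 2 ∂P
      ≤ 2 * C ^ 2 * K / n := by
    intro p q
    simp_rw [hdev]
    refine (hind.integral_quadratic_sq_le (fun i => measurable_pi_apply i) (hmeas p) (hmeas q)
      (fun i => (h4 i p).1) (fun i => (h4 i q).1) (fun i => h0 i p) (fun i => h0 i q)
      (fun i => (h4 i p).2) (fun i => (h4 i q).2) hcard _).trans ?_
    have hs : ∑ j, ∑ l, ((n : ℝ)⁻¹ * annihilator (D.W ω) j l) ^ 2 ≤ (n : ℝ)⁻¹ := by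
      calc ∑ j, ∑ l, ((n : ℝ)⁻¹ * annihilator (D.W ω) j l) ^ 2
          = ((n : ℝ)⁻¹) ^ 2 * ∑ j, ∑ l, annihilator (D.W ω) j l ^ 2 := by
            simp_rw [mul_pow, Finset.mul_sum]
        _ ≤ ((n : ℝ)⁻¹) ^ 2 * ∑ j : Fin n, 1 := by
            gcongr with j; exact sum_sq_annihilator_le_one (D.W ω) j
        _ = (n : ℝ)⁻¹ := by simp; field_simp
    calc _ ≤ ((2 * C ^ 2 : ℕ) : ℝ) * (K * (n : ℝ)⁻¹) := by gcongr
      _ = _ := by push_cast; field_simp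
  have hl : ∀ p q, ∫ e, D.crossV p q ω e ^ 2 ∂P ≤ C * ((1 + K) * L) / n := by
    intro p q
    refine (hind.integral_linear_sq_le (fun i => measurable_pi_apply i) (hmeas p)
      (fun i => (h4 i p).1) (fun i => h0 i p) (fun i => (h4 i p).2) hcard _).trans ?_
    have hs : ∑ j, ((n : ℝ)⁻¹ * ∑ l, annihilator (D.W ω) j l * D.Q l ω q) ^ 2 ≤ (n : ℝ)⁻¹ * L := by
      calc ∑ j, ((n : ℝ)⁻¹ * ∑ l, annihilator (D.W ω) j l * D.Q l ω q) ^ 2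
          = ((n : ℝ)⁻¹) ^ 2 * ∑ j, (∑ l, annihilator (D.W ω) j l * D.Q l ω q) ^ 2 := by
            rw [Finset.mul_sum]
            exact Finset.sum_congr rfl fun j _ => by rw [mul_pow]
        _ ≤ ((n : ℝ)⁻¹) ^ 2 * ∑ j, ‖D.Q j ω‖ ^ 2 := by
            refine mul_le_mul_of_nonneg_left ?_ (by positivity)
            refine (sum_sq_annihilator_sum_le (D.W ω) fun l => D.Q l ω q).trans
              (Finset.sum_le_sum fun j _ => ?_)
            rw [← sq_abs]
            gcongr
            exact PiLp.norm_apply_le (D.Q j ω) q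
        _ = (n : ℝ)⁻¹ * ((n : ℝ)⁻¹ * ∑ j, ‖D.Q j ω‖ ^ 2) := by ring
        _ ≤ _ := by gcongr
    calc _ ≤ (C : ℝ) * ((1 + K) * ((n : ℝ)⁻¹ * L)) := by gcongr
      _ = _ := by field_simp
  have hqi : ∀ p q, Integrable (fun e => (D.quadV p q ω e - D.condGramVtilde ω p q) ^ 2) P := by
    intro p q
    simp_rw [hdev]
    refine MemLp.integrable_sq (memLp_finsetSum _ fun j _ => memLp_finsetSum _ fun l _ => ?_)
    exact ((MemLp.mul_of_four (h4 j p).1 (h4 l q).1).sub (memLp_const _)).const_mul _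
  have hli : ∀ p q, Integrable (fun e => D.crossV p q ω e ^ 2) P := by
    intro p q
    refine MemLp.integrable_sq (memLp_finsetSum _ fun j _ => ?_)
    exact ((h4 j p).1.mono_exponent (by norm_num)).const_mul _
  have hi : ∀ p q, Integrable (fun e => (D.quadV p q ω e - D.condGramVtilde ω p q) ^ 2
      + D.crossV p q ω e ^ 2) P := fun p q => (hqi p q).add (hli p q)
  have hint : Integrable (D.deviation ω) P :=
    integrable_finsetSum _ fun p _ => integrable_finsetSum _ fun q _ => hi p q
  rw [← ofReal_integral_eq_lintegral_ofReal hint (Eventually.of_forall fun e =>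
    Finset.sum_nonneg fun p _ => Finset.sum_nonneg fun q _ => by positivity)]
  refine ENNReal.ofReal_le_ofReal ?_
  simp only [deviation]
  rw [integral_finsetSum _ fun p _ => integrable_finsetSum _ fun q _ => hi p q]
  calc ∑ p, ∫ e, ∑ q, ((D.quadV p q ω e - D.condGramVtilde ω p q) ^ 2 + D.crossV p q ω e ^ 2) ∂P
      ≤ ∑ p : Fin d, ∑ q : Fin d, (2 * C ^ 2 * K / n + C * ((1 + K) * L) / n : ℝ) := by
        refine Finset.sum_le_sum fun p _ => ?_
        rw [integral_finsetSum _ fun q _ => hi p q]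
        refine Finset.sum_le_sum fun q _ => ?_
        rw [integral_add (hqi p q) (hli p q)]
        exact add_le_add (hq p q) (hl p q)
    _ = _ := by simp; ring

end PLSample

/-! ### A lower bound for `Γ̂` -/

namespace PLSample

section

variable {d k n : ℕ} {Ω : Type*} [mΩ : MeasurableSpace Ω] {μ : Measure Ω} {β : Vec d}
  (D : PLSample d k n μ β)

lemma posSemidef_gramW (ω : Ω) : (D.gramW ω).PosSemidef := by
  rw [gramW_eq, ← Matrix.conjTranspose_eq_transpose_of_trivial]
  exact Matrix.posSemidef_conjTranspose_mul_self _

lemma measurableSet_lamMin_gramW_pos : MeasurableSet {ω | 0 < lamMin (D.gramW ω)} := by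
  have hset : {ω | 0 < lamMin (D.gramW ω)} = {ω | (D.gramW ω).det ≠ 0} := by
    ext ω; exact lamMin_pos_iff_det_ne_zero (D.posSemidef_gramW ω)
  have hW : Measurable D.W := D.measurable_W.mono D.𝒲_le le_rfl
  have hWt : Measurable fun ω => (D.W ω)ᵀ :=
    measurable_matrix_iff.2 fun i j => measurable_matrix_iff.1 hW j i
  have hg : Measurable D.gramW := by
    have : D.gramW = fun ω => (D.W ω)ᵀ * D.W ω := funext D.gramW_eq
    rw [this]; exact hWt.matrix_mul hW
  rw [hset]
  exact ((measurable_matrix_det.comp hg) (measurableSet_singleton (0 : ℝ))).compl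

lemma memLp_act {r s : ℕ} (A : Matrix (Fin r) (Fin s) ℝ) {f : Ω → Vec s} (hf : MemLp f 2 μ) :
    MemLp (fun ω => act A (f ω)) 2 μ :=
  (LinearMap.toContinuousLinearMap (Matrix.toEuclideanLin A)).comp_memLp' hf

lemma memLp_v (i : Fin n) : MemLp (D.v i) 2 μ :=
  (D.memLp_x i).sub (memLp_act D.αT (D.memLp_w i))

lemma memLp_Q (i : Fin n) : MemLp (D.Q i) 2 μ := (D.memLp_v i).condExp (by norm_num)

lemma condLExp_le_of_momentBound_le {K : ℝ≥0∞} {ω : Ω} (h : D.momentBound ω ≤ K) (i : Fin n) :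
    condLExp D.𝒳𝒲 μ (fun ω' => ‖D.u i ω'‖ₑ ^ 4) ω ≤ K ∧
    condLExp D.𝒲 μ (fun ω' => ‖D.V i ω'‖ₑ ^ 4) ω ≤ K ∧
    (lamMin (D.errCov ω))⁻¹ ≤ K ∧ (lamMin (D.condGramVtilde ω))⁻¹ ≤ K := by
  have h := (le_iSup (fun i : Fin n => _) i).trans h
  refine ⟨le_trans ?_ h, le_trans ?_ h, le_trans ?_ h, le_trans ?_ h⟩
  · exact le_add_right (le_add_right le_self_add)
  · exact le_add_right (le_add_right le_add_self)
  · exact le_add_right le_add_self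
  · exact le_add_self

variable [IsProbabilityMeasure μ]

lemma ae_x_eq : ∀ᵐ ω ∂μ, ∀ i, D.x i ω = D.V i ω + D.Q i ω + act D.αT (D.w i ω) := by
  refine ae_all_iff.2 fun i => ?_
  have hx : Integrable (D.x i) μ := (D.memLp_x i).integrable (by norm_num)
  have hw : Integrable (fun ω => act D.αT (D.w i ω)) μ :=
    (memLp_act D.αT (D.memLp_w i)).integrable (by norm_num)
  have hm : StronglyMeasurable[D.𝒲] fun ω => act D.αT (D.w i ω) :=
    (Measurable.act measurable_const (D.measurable_w i)).stronglyMeasurable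
  have h1 := condExp_sub hx hw D.𝒲
  rw [condExp_of_stronglyMeasurable D.𝒲_le hm hw] at h1
  filter_upwards [h1] with ω hω
  have hω' : D.Q i ω = (μ[D.x i | D.𝒲]) ω - act D.αT (D.w i ω) := hω
  rw [hω', V]; abel

/-- Where the nuisance design is nonsingular, `Γ̂` inherits the smallest eigenvalue of
`E[(1/n) ∑_i Ṽ_i Ṽ_i' | 𝒲]` up to the deviation: the contribution of the approximation errors
`Q_i` is nonnegative, apart from a cross term. -/
lemma ae_dotProduct_Γhat_ge : ∀ᵐ ω ∂μ, ∀ (K : ℝ≥0) (δ : ℝ), K ≠ 0 → 0 ≤ δ →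
    0 < lamMin (D.gramW ω) → (lamMin (D.condGramVtilde ω))⁻¹ ≤ K →
    D.deviation ω (D.Vvec ω) ≤ δ ^ 2 → ∀ a : Fin d → ℝ,
      ((K : ℝ)⁻¹ - 3 * d * δ) * (a ⬝ᵥ a) ≤ a ⬝ᵥ D.Γhat ω *ᵥ a := by
  filter_upwards [D.ae_x_eq] with ω hx K δ hK hδ hw hlam hdev a
  set A := annihilator (D.W ω) with hA
  set Vt : Fin n → Fin d → ℝ := fun i p => ∑ j, A i j * D.V j ω p with hVt
  set Qt : Fin n → Fin d → ℝ := fun i p => ∑ j, A i j * D.Q j ω p with hQt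
  have hvhat : ∀ i p, D.vhat i ω p = Vt i p + Qt i p := by
    intro i p
    have h0 := congrArg (fun v : Vec d => v p) (D.sum_M_smul_act_w ω hw D.αT i)
    simp only at h0
    rw [D.sum_M_smul_apply ω (fun j => act D.αT (D.w j ω))] at h0
    have h1 : ∑ j, A i j * act D.αT (D.w j ω) p = 0 := h0
    rw [vhat_apply]
    have h2 : ∀ j, D.x j ω p = D.V j ω p + D.Q j ω p + act D.αT (D.w j ω) p := fun j => by
      conv_lhs => rw [hx j]
      rfl
    simp_rw [h2, mul_add, Finset.sum_add_distrib]
    rw [h1, add_zero]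
  have hquad : ∀ p q, D.quadV p q ω (D.Vvec ω) = (n : ℝ)⁻¹ * ∑ i, Vt i p * Vt i q := by
    intro p q
    rw [quadV_Vvec]
    have h : ∀ i p, D.Vtilde i ω p = Vt i p := fun i p =>
      D.sum_M_smul_apply ω (fun j => D.V j ω) i p
    simp_rw [h]
  have hcross : ∀ p q, D.crossV p q ω (D.Vvec ω) = (n : ℝ)⁻¹ * ∑ i, Vt i p * Qt i q := by
    intro p q
    simp only [hVt, hQt, hA]
    rw [sum_annihilator_sum_mul (D.W ω) (fun j => D.V j ω p) (fun j => D.Q j ω q), Finset.mul_sum]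
    simp only [crossV]
    refine Finset.sum_congr rfl fun j _ => ?_
    simp only [Finset.mul_sum, Finset.sum_mul]
    exact Finset.sum_congr rfl fun l _ => by simp only [Vvec]; ring
  have hterm : ∀ p q, |D.quadV p q ω (D.Vvec ω) - D.condGramVtilde ω p q| ≤ δ
      ∧ |D.crossV p q ω (D.Vvec ω)| ≤ δ := by
    intro p q
    have h1 : (D.quadV p q ω (D.Vvec ω) - D.condGramVtilde ω p q) ^ 2
        + D.crossV p q ω (D.Vvec ω) ^ 2 ≤ δ ^ 2 := by
      refine le_trans ?_ hdev
      refine le_trans ?_ (Finset.single_le_sum (f := fun p => ∑ q,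
        ((D.quadV p q ω (D.Vvec ω) - D.condGramVtilde ω p q) ^ 2
          + D.crossV p q ω (D.Vvec ω) ^ 2))
        (fun p _ => Finset.sum_nonneg fun q _ => by positivity) (Finset.mem_univ p))
      exact Finset.single_le_sum (f := fun q =>
        ((D.quadV p q ω (D.Vvec ω) - D.condGramVtilde ω p q) ^ 2
          + D.crossV p q ω (D.Vvec ω) ^ 2))
        (fun q _ => by positivity) (Finset.mem_univ q)
    exact ⟨abs_le_of_sq_le_sq (by nlinarith [sq_nonneg (D.crossV p q ω (D.Vvec ω))]) hδ,
      abs_le_of_sq_le_sq (by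
        nlinarith [sq_nonneg (D.quadV p q ω (D.Vvec ω) - D.condGramVtilde ω p q)]) hδ⟩
  have hsymm : (D.condGramVtilde ω).IsHermitian := by
    rw [Matrix.IsHermitian, Matrix.conjTranspose_eq_transpose_of_trivial]
    ext p q
    simp only [Matrix.transpose_apply, condGramVtilde, Matrix.of_apply]
    simp_rw [mul_comm]
  have hlow := dotProduct_mulVec_ge_of_inv_lamMin_le hsymm hK hlam a
  have hexp : ∀ z : Fin n → Fin d → ℝ, ∀ y : Fin n → Fin d → ℝ,
      (n : ℝ)⁻¹ * ∑ i, (∑ p, a p * z i p) * (∑ q, a q * y i q)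
        = ∑ p, ∑ q, a p * a q * ((n : ℝ)⁻¹ * ∑ i, z i p * y i q) := by
    intro z y
    simp_rw [Finset.sum_mul_sum, Finset.mul_sum]
    rw [Finset.sum_comm]
    refine Finset.sum_congr rfl fun p _ => ?_
    rw [Finset.sum_comm]
    exact Finset.sum_congr rfl fun q _ => Finset.sum_congr rfl fun i _ => by ring
  have hΓ : ∑ p, ∑ q, a p * a q * (D.quadV p q ω (D.Vvec ω) + 2 * D.crossV p q ω (D.Vvec ω))
      ≤ a ⬝ᵥ D.Γhat ω *ᵥ a := by
    rw [dotProduct_Γhat_mulVec]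
    have e1 : ∑ p, ∑ q, a p * a q *
          (D.quadV p q ω (D.Vvec ω) + 2 * D.crossV p q ω (D.Vvec ω))
        = (n : ℝ)⁻¹ * ∑ i, ((∑ p, a p * Vt i p) * (∑ q, a q * Vt i q)
          + 2 * ((∑ p, a p * Vt i p) * (∑ q, a q * Qt i q))) := by
      rw [Finset.sum_add_distrib, ← Finset.mul_sum, mul_add, ← mul_assoc _ (2 : ℝ),
        mul_comm _ (2 : ℝ), mul_assoc (2 : ℝ), hexp, hexp, Finset.mul_sum, ← Finset.sum_add_distrib]
      refine Finset.sum_congr rfl fun p _ => ?_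
      rw [Finset.mul_sum, ← Finset.sum_add_distrib]
      refine Finset.sum_congr rfl fun q _ => ?_
      rw [hquad, hcross]; ring
    rw [e1]
    refine mul_le_mul_of_nonneg_left (Finset.sum_le_sum fun i _ => ?_) (by positivity)
    simp_rw [hvhat, mul_add, Finset.sum_add_distrib]
    nlinarith [sq_nonneg (∑ p, a p * Qt i p)]
  have hC : a ⬝ᵥ D.condGramVtilde ω *ᵥ a = ∑ p, ∑ q, a p * a q * D.condGramVtilde ω p q := by
    simp only [dotProduct, Matrix.mulVec, Finset.mul_sum]
    exact Finset.sum_congr rfl fun p _ => Finset.sum_congr rfl fun q _ => by ring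
  have hdiff : ∑ p, ∑ q, a p * a q * D.condGramVtilde ω p q - 3 * δ * (∑ p, |a p|) ^ 2
      ≤ ∑ p, ∑ q, a p * a q *
        (D.quadV p q ω (D.Vvec ω) + 2 * D.crossV p q ω (D.Vvec ω)) := by
    rw [sq, Finset.sum_mul_sum, Finset.mul_sum, ← Finset.sum_sub_distrib]
    refine Finset.sum_le_sum fun p _ => ?_
    rw [Finset.mul_sum, ← Finset.sum_sub_distrib]
    refine Finset.sum_le_sum fun q _ => ?_
    obtain ⟨h1, h2⟩ := hterm p q
    have h3 : |a p * a q * ((D.quadV p q ω (D.Vvec ω) - D.condGramVtilde ω p q)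
        + 2 * D.crossV p q ω (D.Vvec ω))| ≤ 3 * δ * (|a p| * |a q|) := by
      rw [abs_mul, abs_mul, mul_comm]
      gcongr
      refine (abs_add_le _ _).trans ?_
      rw [abs_mul, abs_two]
      linarith
    have h4 := (abs_le.1 h3).1
    linarith
  have hsq : (∑ p, |a p|) ^ 2 ≤ d * (a ⬝ᵥ a) := by
    have := sq_sum_le_card_mul_sum_sq (s := Finset.univ) (f := fun p => |a p|)
    simp only [sq_abs, Finset.card_univ, Fintype.card_fin] at this
    refine this.trans_eq ?_
    simp [dotProduct, sq]
  rw [hC] at hlow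
  have := mul_le_mul_of_nonneg_left hsq (by positivity : 0 ≤ 3 * δ)
  linarith

lemma measure_mean_sq_Q_gt_le {L : ℝ} (hL : 0 < L) :
    μ {ω | L < (n : ℝ)⁻¹ * ∑ i, ‖D.Q i ω‖ ^ 2} ≤ ENNReal.ofReal (D.χ / L) := by
  have hi : ∀ i, Integrable (fun ω => ‖D.Q i ω‖ ^ 2) μ := fun i =>
    (D.memLp_Q i).integrable_norm_pow (p := 2) (by norm_num)
  have hint : Integrable (fun ω => (n : ℝ)⁻¹ * ∑ i, ‖D.Q i ω‖ ^ 2) μ :=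
    (integrable_finsetSum _ fun i _ => hi i).const_mul _
  have hχ : D.χ = ∫ ω, (n : ℝ)⁻¹ * ∑ i, ‖D.Q i ω‖ ^ 2 ∂μ := by
    rw [integral_const_mul, integral_finsetSum _ fun i _ => hi i, χ]
  have h := mul_meas_ge_le_integral_of_nonneg
    (f := fun ω => (n : ℝ)⁻¹ * ∑ i, ‖D.Q i ω‖ ^ 2)
    (Eventually.of_forall fun ω => by positivity) hint L
  rw [← hχ] at h
  refine (measure_mono (t := {ω | L ≤ (n : ℝ)⁻¹ * ∑ i, ‖D.Q i ω‖ ^ 2})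
    fun ω (hω : L < _) => hω.le).trans ?_
  rw [← ofReal_measureReal]
  refine ENNReal.ofReal_le_ofReal ?_
  rw [le_div_iff₀ hL, mul_comm]
  exact h

end

section Sequence

variable {d : ℕ} {k : ℕ → ℕ} {Ω : ℕ → Type*} [∀ n, MeasurableSpace (Ω n)]
  {μ : ∀ n, Measure (Ω n)} [∀ n, IsProbabilityMeasure (μ n)] {β : Vec d}
  {D : ∀ n, PLSample d (k n) n (μ n) β}

lemma eventually_measure_gramW_singular_le (h₂ : DesignAssumption D) {ε : ℝ≥0∞} (hε : 0 < ε) :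
    ∀ᶠ n in atTop, μ n {ω | ¬ 0 < lamMin ((D n).gramW ω)} ≤ ε := by
  have h : Tendsto (fun n => 1 - μ n {ω | 0 < lamMin ((D n).gramW ω)}) atTop (𝓝 (1 - 1)) :=
    ENNReal.Tendsto.sub tendsto_const_nhds h₂.nonsingular (Or.inl ENNReal.one_ne_top)
  rw [tsub_self] at h
  filter_upwards [h.eventually_le_const hε] with n hn
  have := prob_compl_eq_one_sub (μ := μ n) (D n).measurableSet_lamMin_gramW_pos
  rwa [← this] at hn

lemma exists_eventually_le_of_isBigO_one {f : ℕ → ℝ} (h : f =O[atTop] fun _ => (1 : ℝ)) :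
    ∃ C : ℕ, ∀ᶠ n in atTop, f n ≤ C := by
  obtain ⟨c, hc⟩ := h.bound
  refine ⟨⌈c⌉₊, hc.mono fun n hn => ?_⟩
  simp only [norm_one, mul_one] at hn
  exact (le_abs_self _).trans (hn.trans (Nat.le_ceil c))

/-- `1 / λ_min(Γ̂) = O_p(1)`. -/
lemma exists_eventually_measure_Γhat_lt_le (h₁ : SamplingAssumption D) (h₂ : DesignAssumption D)
    (h₃ : ExogeneityAssumption D) {ε : ℝ≥0∞} (hε : 0 < ε) :
    ∃ K : ℝ≥0, K ≠ 0 ∧ ∀ᶠ n in atTop, μ n {ω | ¬ ∀ a : Fin d → ℝ,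
      (K : ℝ)⁻¹ * (a ⬝ᵥ a) ≤ a ⬝ᵥ (D n).Γhat ω *ᵥ a} ≤ ε := by
  set ε' : ℝ≥0∞ := ε / 5 with hε'
  have hε0 : 0 < ε' := ENNReal.div_pos hε.ne' (by norm_num)
  obtain ⟨K₀, hK₀⟩ := h₂.moments ε' hε0
  set K : ℝ≥0 := max K₀ 1 with hKdef
  have hK1 : 1 ≤ K := le_max_right _ _
  have hK0 : K ≠ 0 := (zero_lt_one.trans_le hK1).ne'
  have hKr : (0 : ℝ) < K := by exact_mod_cast pos_iff_ne_zero.2 hK0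
  obtain ⟨C, hC⟩ := exists_eventually_le_of_isBigO_one h₁.bounded_clusters
  obtain ⟨X, hX⟩ := exists_eventually_le_of_isBigO_one h₃.projection
  obtain ⟨L, hL0, hL⟩ : ∃ L : ℝ≥0, 0 < L ∧ ENNReal.ofReal (X / L) ≤ ε' := by
    have ht : Tendsto (fun m : ℕ => ENNReal.ofReal ((X : ℝ) / (m : ℝ))) atTop (𝓝 0) := by
      have := ENNReal.tendsto_ofReal (tendsto_const_div_atTop_nhds_zero_nat (X : ℝ))
      simpa using this
    obtain ⟨m, hm, hm0⟩ := ((ht.eventually_le_const hε0).and (eventually_gt_atTop 0)).exists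
    exact ⟨m, by exact_mod_cast hm0, by simpa using hm⟩
  -- The deviation threshold is chosen so that at most half of the smallest eigenvalue is lost.
  set δ : ℝ := (K : ℝ)⁻¹ / (6 * (d + 1)) with hδ
  have hδ0 : 0 < δ := by positivity
  have hδK : (2 * (K : ℝ))⁻¹ ≤ (K : ℝ)⁻¹ - 3 * d * δ := by
    have : 3 * d * δ = (K : ℝ)⁻¹ * (d / (2 * (d + 1))) := by
      rw [hδ]; field_simp; ring
    rw [this, mul_inv]
    have h2 : (d : ℝ) / (2 * (d + 1)) ≤ 1 / 2 := by
      rw [div_le_div_iff₀ (by positivity) (by norm_num)]; linarith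
    have := mul_le_mul_of_nonneg_left h2 (inv_nonneg.2 hKr.le)
    linarith
  set B : ℝ := d ^ 2 * (2 * C ^ 2 * K + C * ((1 + K) * L)) with hB
  have hBt : Tendsto (fun n : ℕ => ENNReal.ofReal (B / n) / ENNReal.ofReal (δ ^ 2)) atTop
      (𝓝 0) := by
    have h := ENNReal.tendsto_ofReal (tendsto_const_div_atTop_nhds_zero_nat B)
    rw [ENNReal.ofReal_zero] at h
    have := ENNReal.Tendsto.div_const (b := ENNReal.ofReal (δ ^ 2)) h
      (Or.inr (by simpa using hδ0.ne'))
    simpa using this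
  refine ⟨2 * K, by simpa using hK0, ?_⟩
  filter_upwards [hK₀, hC, hX, hBt.eventually_le_const hε0,
    eventually_measure_gramW_singular_le h₂ hε0, eventually_gt_atTop 0]
    with n hmom hC hX hBn hgram hn
  have hC' : (D n).maxClusterSize ≤ C := by exact_mod_cast hC
  have hmom' : ∀ ω, ¬ (K₀ : ℝ≥0∞) < (D n).momentBound ω → (D n).momentBound ω ≤ (K : ℝ≥0∞) :=
    fun ω h => (not_lt.1 h).trans (by exact_mod_cast le_max_left _ _)
  have hQ : μ n {ω | (L : ℝ) < (n : ℝ)⁻¹ * ∑ i, ‖(D n).Q i ω‖ ^ 2} ≤ ε' := by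
    refine ((D n).measure_mean_sq_Q_gt_le (by exact_mod_cast hL0)).trans (le_trans ?_ hL)
    gcongr
  set f : Ω n → (Fin n → Vec d) → ℝ≥0∞ := fun ω e => ENNReal.ofReal ((D n).deviation ω e) with hf
  have hfm : Measurable[(D n).𝒲.prod inferInstance] (Function.uncurry f) :=
    (D n).measurable_deviation.ennreal_ofReal
  have hmarkov := measure_ge_le_add_div (μ := μ n) (D n).𝒲_le (D n).measurable_Vvec hfm
    (b := ENNReal.ofReal (B / n)) (c := ENNReal.ofReal (δ ^ 2))
    (by simpa using hδ0.ne') ENNReal.ofReal_ne_top prob_le_one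
  have hcond : μ n {ω | ENNReal.ofReal (B / n)
      < ∫⁻ e, f ω e ∂condLaw (D n).𝒲 (D n).Vvec (μ n) ω} ≤ ε' + ε' := by
    refine le_trans (measure_mono_ae (t := {ω | (K₀ : ℝ≥0∞) < (D n).momentBound ω} ∪
      {ω | (L : ℝ) < (n : ℝ)⁻¹ * ∑ i, ‖(D n).Q i ω‖ ^ 2}) ?_)
      ((measure_union_le _ _).trans (add_le_add hmom hQ))
    filter_upwards [(D n).ae_lintegral_deviation_le (h₁.indep_V n) hn] with ω hω hlt
    by_contra hcon
    have hcon' : ¬ ((K₀ : ℝ≥0∞) < (D n).momentBound ω ∨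
      (L : ℝ) < (n : ℝ)⁻¹ * ∑ i, ‖(D n).Q i ω‖ ^ 2) := hcon
    rw [not_or] at hcon'
    exact absurd hlt (not_lt.2 (hω K L C hC'
      (fun i => ((D n).condLExp_le_of_momentBound_le (hmom' ω hcon'.1) i).2.1) (not_lt.1 hcon'.2)))
  have hdev : μ n {ω | ENNReal.ofReal (δ ^ 2) ≤ f ω ((D n).Vvec ω)} ≤ ε' + ε' + ε' :=
    hmarkov.trans (add_le_add hcond hBn)
  calc μ n {ω | ¬ ∀ a : Fin d → ℝ,
        ((2 * K : ℝ≥0) : ℝ)⁻¹ * (a ⬝ᵥ a) ≤ a ⬝ᵥ (D n).Γhat ω *ᵥ a}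
      ≤ μ n ({ω | ¬ 0 < lamMin ((D n).gramW ω)} ∪ {ω | (K₀ : ℝ≥0∞) < (D n).momentBound ω} ∪
          {ω | ENNReal.ofReal (δ ^ 2) ≤ f ω ((D n).Vvec ω)}) := by
        refine measure_mono_ae ?_
        filter_upwards [(D n).ae_dotProduct_Γhat_ge] with ω hω hnot
        by_contra hcon
        have hcon' : ¬ ((¬ 0 < lamMin ((D n).gramW ω) ∨ (K₀ : ℝ≥0∞) < (D n).momentBound ω) ∨
          ENNReal.ofReal (δ ^ 2) ≤ f ω ((D n).Vvec ω)) := hcon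
        rw [not_or, not_or, not_not] at hcon'
        obtain ⟨⟨hg, hm⟩, hd⟩ := hcon'
        refine hnot fun a => ?_
        have hd' : (D n).deviation ω ((D n).Vvec ω) ≤ δ ^ 2 := by
          by_contra h
          exact hd (ENNReal.ofReal_le_ofReal (not_le.1 h).le)
        have hlam := ((D n).condLExp_le_of_momentBound_le (hmom' ω hm) ⟨0, hn⟩).2.2.2
        refine le_trans ?_ (hω K δ hK0 hδ0.le hg hlam hd' a)
        push_cast
        exact mul_le_mul_of_nonneg_right hδK (Finset.sum_nonneg fun p _ => mul_self_nonneg _)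
    _ ≤ ε' + ε' + (ε' + ε' + ε') :=
        (measure_union_le _ _).trans (add_le_add ((measure_union_le _ _).trans
          (add_le_add hgram hmom)) hdev)
    _ = 5 * (ε / 5) := by rw [hε']; ring
    _ = ε := ENNReal.mul_div_cancel (by norm_num) (by norm_num)

end Sequence

end PLSample

/-! ### The central limit theorem conditional on the regressors -/

lemma pow_four_sum_le {ι : Type*} (s : Finset ι) (f : ι → ℝ) :
    (∑ i ∈ s, f i) ^ 4 ≤ (s.card : ℝ) ^ 3 * ∑ i ∈ s, f i ^ 4 := by
  have h1 := sq_sum_le_card_mul_sum_sq (s := s) (f := f)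
  have h2 := sq_sum_le_card_mul_sum_sq (s := s) (f := fun i => f i ^ 2)
  calc (∑ i ∈ s, f i) ^ 4 = ((∑ i ∈ s, f i) ^ 2) ^ 2 := by ring
    _ ≤ (s.card * ∑ i ∈ s, f i ^ 2) ^ 2 := by gcongr
    _ = (s.card : ℝ) ^ 2 * (∑ i ∈ s, f i ^ 2) ^ 2 := by ring
    _ ≤ (s.card : ℝ) ^ 2 * (s.card * ∑ i ∈ s, (f i ^ 2) ^ 2) := by gcongr
    _ = _ := by
      have : ∀ i, (f i ^ 2) ^ 2 = f i ^ 4 := fun i => by ring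
      simp_rw [this]; ring

lemma Finpartition.sum_parts_sum {ι M : Type*} [Fintype ι] [DecidableEq ι] [AddCommMonoid M]
    (G : Finpartition (Finset.univ : Finset ι)) (f : ι → M) :
    ∑ g ∈ G.parts, ∑ i ∈ g, f i = ∑ i, f i := by
  have h := Finset.sum_biUnion (s := G.parts) (t := id) (f := f) G.disjoint
  rw [G.biUnion_parts] at h
  exact h.symm

namespace PLSample

variable {d k n : ℕ} {Ω : Type*} [mΩ : MeasurableSpace Ω] {μ : Measure Ω} {β : Vec d}
  (D : PLSample d k n μ β)

/-- The array `(u_1, …, u_n)`. -/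
noncomputable def Uvec (ω : Ω) : Fin n → ℝ := fun i => D.u i ω

lemma measurable_Uvec : Measurable D.Uvec := measurable_pi_iff.2 D.measurable_u

lemma errCov_symm (ω : Ω) (i j : Fin n) : D.errCov ω i j = D.errCov ω j i := by
  simp only [errCov, Matrix.of_apply]
  simp_rw [mul_comm]

lemma isHermitian_errCov (ω : Ω) : (D.errCov ω).IsHermitian := by
  rw [Matrix.IsHermitian, Matrix.conjTranspose_eq_transpose_of_trivial]
  ext i j
  exact D.errCov_symm ω j i

/-- The conditional variance of `∑_i c_i u_i` when the errors are uncorrelated across clusters. -/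
noncomputable def clusterVar (ω : Ω) (c : Fin n → ℝ) : ℝ :=
  ∑ g ∈ D.G.parts, ∑ i ∈ g, ∑ j ∈ g, c i * c j * D.errCov ω i j

lemma clusterVar_ge {ω : Ω} {K : ℝ≥0} (hK : K ≠ 0) (h : (lamMin (D.errCov ω))⁻¹ ≤ K)
    (c : Fin n → ℝ) : (K : ℝ)⁻¹ * ∑ i, c i ^ 2 ≤ D.clusterVar ω c := by
  rw [← D.G.sum_parts_sum (fun i => c i ^ 2), Finset.mul_sum, clusterVar]
  refine Finset.sum_le_sum fun g _ => ?_
  rw [Finset.mul_sum]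
  have h1 := dotProduct_mulVec_ge_of_inv_lamMin_le (D.isHermitian_errCov ω) hK h
    (fun i => if i ∈ g then c i else 0)
  have e1 : (fun i => if i ∈ g then c i else 0) ⬝ᵥ (fun i => if i ∈ g then c i else 0)
      = ∑ i ∈ g, c i ^ 2 := by
    simp [dotProduct, sq]
  have e2 : (fun i => if i ∈ g then c i else 0) ⬝ᵥ D.errCov ω *ᵥ
        (fun i => if i ∈ g then c i else 0)
      = ∑ i ∈ g, ∑ j ∈ g, c i * c j * D.errCov ω i j := by
    simp only [dotProduct, Matrix.mulVec, ite_mul, mul_ite, zero_mul, mul_zero,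
      Finset.sum_ite_mem, Finset.univ_inter]
    simp_rw [Finset.mul_sum]
    exact Finset.sum_congr rfl fun i _ => Finset.sum_congr rfl fun j _ => by ring
  rwa [e1, e2, Finset.mul_sum] at h1

section

variable [IsProbabilityMeasure μ]

lemma ae_iIndepFun_u (h : CondIndepFamily μ D.𝒳𝒲 D.clusterUV) : ∀ᵐ ω ∂μ,
    iIndepFun (fun (g : D.G.parts) (e : Fin n → ℝ) (i : g.1) => e i)
      (condLaw D.𝒳𝒲 D.Uvec μ ω) := by
  refine CondIndepFamily.ae_iIndepFun D.𝒳𝒲_le D.measurable_Uvec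
    (fun g => measurable_pi_lambda _ fun i => measurable_pi_apply _) ?_
  exact h.comp (φ := fun g z i => (z i).1) fun g =>
    measurable_pi_lambda _ fun i => measurable_fst.comp (measurable_pi_apply i)

lemma ae_integral_Uvec (h : ∀ i, μ[D.u i | D.𝒳𝒲] =ᵐ[μ] 0) : ∀ᵐ ω ∂μ, ∀ i,
    ∫ e : Fin n → ℝ, e i ∂condLaw D.𝒳𝒲 D.Uvec μ ω = 0 := by
  refine ae_all_iff.2 fun i => ?_
  have h1 := condExp_ae_eq_integral_condLaw (μ := μ) D.𝒳𝒲_le D.measurable_Uvec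
    (f := fun _ (e : Fin n → ℝ) => e i)
    ((measurable_pi_apply i).comp measurable_snd).stronglyMeasurable
    ((D.memLp_u i).integrable (by norm_num))
  filter_upwards [h i, h1] with ω h h1
  exact h1.symm.trans h

lemma ae_integral_mul_Uvec : ∀ᵐ ω ∂μ, ∀ i j,
    ∫ e : Fin n → ℝ, e i * e j ∂condLaw D.𝒳𝒲 D.Uvec μ ω = D.errCov ω i j := by
  refine ae_all_iff.2 fun i => ae_all_iff.2 fun j => ?_
  have h1 := condExp_ae_eq_integral_condLaw (μ := μ) D.𝒳𝒲_le D.measurable_Uvec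
    (f := fun _ (e : Fin n → ℝ) => e i * e j)
    ((by fun_prop : Measurable fun e : Fin n → ℝ => e i * e j).comp
      measurable_snd).stronglyMeasurable
    ((D.memLp_u i).integrable_mul (D.memLp_u j))
  filter_upwards [h1] with ω h1
  exact h1.symm

lemma ae_memLp_Uvec : ∀ᵐ ω ∂μ, ∀ K : ℝ≥0,
    (∀ i, condLExp D.𝒳𝒲 μ (fun ω' => ‖D.u i ω'‖ₑ ^ 4) ω ≤ K) → ∀ i,
      MemLp (fun e : Fin n → ℝ => e i) 4 (condLaw D.𝒳𝒲 D.Uvec μ ω) ∧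
        ∫ e, e i ^ 4 ∂condLaw D.𝒳𝒲 D.Uvec μ ω ≤ K := by
  have h : ∀ᵐ ω ∂μ, ∀ i, condLExp D.𝒳𝒲 μ (fun ω' => ‖D.u i ω'‖ₑ ^ 4) ω
      = ∫⁻ e : Fin n → ℝ, ‖e i‖ₑ ^ 4 ∂condLaw D.𝒳𝒲 D.Uvec μ ω := by
    refine ae_all_iff.2 fun i => ?_
    exact condLExp_ae_eq_lintegral_condLaw D.𝒳𝒲_le D.measurable_Uvec
      (f := fun _ (e : Fin n → ℝ) => ‖e i‖ₑ ^ 4)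
      ((by fun_prop : Measurable fun e : Fin n → ℝ => ‖e i‖ₑ ^ 4).comp measurable_snd)
  filter_upwards [h] with ω hω K hK i
  exact memLp_four_of_lintegral_le (by fun_prop) ((hω i).symm.le.trans (hK i))

/-- Gaussian approximation of the conditional characteristic function of `∑_i c_i u_i`, where the
weights `c_i` may depend on the conditioning variables. -/
lemma ae_norm_integral_cexp_sub_le (h : CondIndepFamily μ D.𝒳𝒲 D.clusterUV)
    (hexo : ∀ i, μ[D.u i | D.𝒳𝒲] =ᵐ[μ] 0) : ∀ᵐ ω ∂μ, ∀ (K : ℝ≥0) (C : ℕ) (η : ℝ), 0 < η →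
      D.maxClusterSize ≤ C → (∀ i, condLExp D.𝒳𝒲 μ (fun ω' => ‖D.u i ω'‖ₑ ^ 4) ω ≤ K) →
      ∀ c : Fin n → ℝ,
        ‖∫ e : Fin n → ℝ, Complex.exp ((∑ i, c i * e i : ℝ) * Complex.I)
            ∂condLaw D.𝒳𝒲 D.Uvec μ ω - Complex.exp (-(D.clusterVar ω c : ℂ) / 2)‖
          ≤ 2 * η * D.clusterVar ω c + (2 / η + 1) * (C ^ 3 * K * ∑ i, c i ^ 4) := by
  filter_upwards [D.ae_iIndepFun_u h, D.ae_integral_Uvec hexo, D.ae_integral_mul_Uvec,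
    D.ae_memLp_Uvec] with ω hind h0 hcov h4 K C η hη hC hK c
  set P := condLaw D.𝒳𝒲 D.Uvec μ ω with hP
  have h4 := h4 K hK
  let ξ : D.G.parts → (Fin n → ℝ) → ℝ := fun g e => ∑ i ∈ g.1, c i * e i
  have hξind : iIndepFun ξ P := by
    have := hind.comp (fun (g : D.G.parts) (z : (i : g.1) → ℝ) => ∑ i : g.1, c i * z i)
      (fun g => by fun_prop)
    convert this using 2 with g
    ext e
    exact (Finset.sum_coe_sort g.1 (fun i => c i * e i)).symm
  have hint : ∀ i, Integrable (fun e : Fin n → ℝ => e i) P := fun i =>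
    (h4 i).1.integrable (by norm_num)
  have hmul : ∀ i j, Integrable (fun e : Fin n → ℝ => e i * e j) P := fun i j =>
    (MemLp.mul_of_four (h4 i).1 (h4 j).1).integrable (by norm_num)
  have hξ4 : ∀ g, MemLp (ξ g) 4 P := fun g =>
    memLp_finsetSum _ fun i _ => (h4 i).1.const_mul (c i)
  have hξ0 : ∀ g, ∫ e, ξ g e ∂P = 0 := fun g => by
    simp only [ξ]
    rw [integral_finsetSum _ fun i _ => (hint i).const_mul _]
    exact Finset.sum_eq_zero fun i _ => by rw [integral_const_mul, h0, mul_zero]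
  have hvar : ∑ g, ∫ e, ξ g e ^ 2 ∂P = D.clusterVar ω c := by
    rw [clusterVar, ← Finset.sum_coe_sort D.G.parts
      (fun g => ∑ i ∈ g, ∑ j ∈ g, c i * c j * D.errCov ω i j)]
    refine Finset.sum_congr rfl fun g _ => ?_
    have e1 : ∀ e, ξ g e ^ 2 = ∑ i ∈ g.1, ∑ j ∈ g.1, c i * c j * (e i * e j) := fun e => by
      simp only [ξ, sq, Finset.sum_mul_sum]
      exact Finset.sum_congr rfl fun i _ => Finset.sum_congr rfl fun j _ => by ring
    simp_rw [e1]
    rw [integral_finsetSum _ fun i _ => integrable_finsetSum _ fun j _ => (hmul i j).const_mul _]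
    refine Finset.sum_congr rfl fun i _ => ?_
    rw [integral_finsetSum _ fun j _ => (hmul i j).const_mul _]
    refine Finset.sum_congr rfl fun j _ => ?_
    rw [integral_const_mul, hcov]
  have hsum : ∀ e, ∑ g, ξ g e = ∑ i, c i * e i := fun e => by
    rw [← D.G.sum_parts_sum]
    exact Finset.sum_coe_sort D.G.parts (fun g => ∑ i ∈ g, c i * e i)
  have hfour : ∑ g, ∫ e, ξ g e ^ 4 ∂P ≤ C ^ 3 * K * ∑ i, c i ^ 4 := by
    rw [← D.G.sum_parts_sum (fun i => c i ^ 4),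
      ← Finset.sum_coe_sort D.G.parts (fun g => ∑ i ∈ g, c i ^ 4), Finset.mul_sum]
    refine Finset.sum_le_sum fun g _ => ?_
    have hi : ∀ i, Integrable (fun e : Fin n → ℝ => (c i * e i) ^ 4) P := fun i =>
      integrable_pow_four ((h4 i).1.const_mul (c i))
    calc ∫ e, ξ g e ^ 4 ∂P ≤ ∫ e, (g.1.card : ℝ) ^ 3 * ∑ i ∈ g.1, (c i * e i) ^ 4 ∂P :=
          integral_mono (integrable_pow_four (hξ4 g))
            ((integrable_finsetSum _ fun i _ => hi i).const_mul _) fun e => pow_four_sum_le _ _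
      _ = (g.1.card : ℝ) ^ 3 * ∑ i ∈ g.1, c i ^ 4 * ∫ e, e i ^ 4 ∂P := by
          rw [integral_const_mul, integral_finsetSum _ fun i _ => hi i]
          congr 1
          refine Finset.sum_congr rfl fun i _ => ?_
          simp_rw [mul_pow]
          rw [integral_const_mul]
      _ ≤ (C : ℝ) ^ 3 * ∑ i ∈ g.1, c i ^ 4 * K := by
          have hg : g.1.card ≤ C := (Finset.le_sup (f := Finset.card) g.2).trans hC
          have hnn : ∀ i ∈ g.1, 0 ≤ c i ^ 4 * ∫ e, e i ^ 4 ∂P := fun i _ =>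
            mul_nonneg (by positivity) (integral_nonneg fun e => by positivity)
          refine mul_le_mul (by gcongr) (Finset.sum_le_sum fun i _ => ?_)
            (Finset.sum_nonneg hnn) (by positivity)
          exact mul_le_mul_of_nonneg_left (h4 i).2 (by positivity)
      _ = _ := by rw [← Finset.sum_mul]; ring
  have key := _root_.iIndepFun.norm_integral_cexp_sum_sub_le hξind hξ4 hξ0 hη
  rw [hvar] at key
  simp_rw [hsum] at key
  refine key.trans ?_
  have : 0 ≤ 2 / η + 1 := by positivity
  gcongr

end

/-- `Γ̂⁻¹ Ω^{-1/2} t`: the direction in which the score `S` enters the inner product of the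
standardized estimator with `t`. -/
noncomputable def scoreDir (t : Vec d) (ω : Ω) : Fin d → ℝ :=
  (D.Γhat ω)⁻¹ *ᵥ (invSqrt (D.sandwich ω) *ᵥ t.ofLp)

/-- The coefficient of `u_i` in the standardized score in the direction `t`. -/
noncomputable def weight (t : Vec d) (ω : Ω) (i : Fin n) : ℝ :=
  (Real.sqrt n)⁻¹ * ∑ p, D.scoreDir t ω p * D.vhat i ω p

lemma measurable_weight (t : Vec d) (i : Fin n) : Measurable[D.𝒳𝒲] fun ω => D.weight t ω i := by
  have hG : Measurable[D.𝒳𝒲] fun ω => (D.Γhat ω)⁻¹ := measurable_matrix_inv.comp D.measurable_Γhat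
  have hB : Measurable[D.𝒳𝒲] fun ω => invSqrt (D.sandwich ω) :=
    measurable_invSqrt.comp D.measurable_sandwich
  have hGB := hG.matrix_mul hB
  have hs : ∀ p, Measurable[D.𝒳𝒲] fun ω => D.scoreDir t ω p := fun p => by
    have e : (fun ω => D.scoreDir t ω p)
        = fun ω => ∑ q, ((D.Γhat ω)⁻¹ * invSqrt (D.sandwich ω)) p q * t q := by
      ext ω
      rw [scoreDir, Matrix.mulVec_mulVec]
      rfl
    rw [e]
    exact Finset.measurable_fun_sum _ fun q _ =>
      ((@measurable_matrix_iff Ω D.𝒳𝒲 _ _ _).1 hGB p q).mul_const _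
  have hv : ∀ p, Measurable[D.𝒳𝒲] fun ω => D.vhat i ω p := fun p =>
    (by fun_prop : Measurable fun v : Vec d => v p).comp (D.measurable_vhat i)
  exact (Finset.measurable_fun_sum _ fun p _ => (hs p).mul (hv p)).const_mul _

/-- The standardized score, in the direction `t`, as a linear form in the errors. -/
lemma inner_standardized_score (t : Vec d) (ω : Ω) :
    inner ℝ (act (invSqrt (D.sandwich ω)) (act (D.Γhat ω)⁻¹ (D.S ω))) t
      = ∑ i, D.weight t ω i * D.u i ω := by
  set B := invSqrt (D.sandwich ω) with hB
  have hBt : Bᵀ = B := transpose_invSqrt _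
  have hGt : ((D.Γhat ω)⁻¹)ᵀ = (D.Γhat ω)⁻¹ := by
    rw [Matrix.transpose_nonsing_inv, D.transpose_Γhat]
  have e1 : inner ℝ (act B (act (D.Γhat ω)⁻¹ (D.S ω))) t
      = (D.S ω).ofLp ⬝ᵥ D.scoreDir t ω := by
    rw [EuclideanSpace.inner_eq_star_dotProduct, star_trivial]
    change t.ofLp ⬝ᵥ B *ᵥ ((D.Γhat ω)⁻¹ *ᵥ (D.S ω).ofLp) = _
    rw [Matrix.dotProduct_mulVec, Matrix.dotProduct_mulVec, ← Matrix.mulVec_transpose B, hBt,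
      ← Matrix.mulVec_transpose, hGt, dotProduct_comm]
    rfl
  rw [e1]
  simp only [S, weight, dotProduct, WithLp.ofLp_smul, WithLp.ofLp_sum, Pi.smul_apply,
    Finset.sum_apply, smul_eq_mul]
  simp_rw [Finset.mul_sum, Finset.sum_mul]
  rw [Finset.sum_comm]
  exact Finset.sum_congr rfl fun i _ => Finset.sum_congr rfl fun p _ => by ring

lemma transpose_SigmaHat (ω : Ω) : (D.SigmaHat ω)ᵀ = D.SigmaHat ω := by
  ext a b
  simp only [SigmaHat, outer, Matrix.transpose_apply, Matrix.smul_apply, Matrix.sum_apply,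
    Matrix.vecMulVec_apply, smul_eq_mul]
  congr 1
  refine Finset.sum_congr rfl fun g _ => ?_
  rw [Finset.sum_comm]
  refine Finset.sum_congr rfl fun i _ => Finset.sum_congr rfl fun j _ => ?_
  have := D.errCov_symm ω j i
  simp only [errCov, Matrix.of_apply] at this
  rw [this]; ring

/-- The quadratic form of `Σ` is a cluster variance. -/
lemma dotProduct_SigmaHat_mulVec (ω : Ω) (s : Fin d → ℝ) :
    s ⬝ᵥ D.SigmaHat ω *ᵥ s
      = D.clusterVar ω fun i => (Real.sqrt n)⁻¹ * ∑ p, s p * D.vhat i ω p := by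
  have hn : (n : ℝ)⁻¹ = (Real.sqrt n)⁻¹ * (Real.sqrt n)⁻¹ := by
    rw [← mul_inv, Real.mul_self_sqrt (Nat.cast_nonneg n)]
  simp only [SigmaHat, Matrix.smul_mulVec, dotProduct_smul, Matrix.sum_mulVec, dotProduct_sum,
    smul_eq_mul, clusterVar]
  rw [Finset.mul_sum]
  refine Finset.sum_congr rfl fun g _ => ?_
  rw [Finset.mul_sum]
  refine Finset.sum_congr rfl fun i _ => ?_
  rw [Finset.mul_sum]
  refine Finset.sum_congr rfl fun j _ => ?_
  have e : s ⬝ᵥ outer (D.vhat i ω) (D.vhat j ω) *ᵥ s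
      = (∑ p, s p * D.vhat i ω p) * ∑ p, s p * D.vhat j ω p := by
    simp only [outer, Matrix.vecMulVec_mulVec, dotProduct, Finset.sum_mul_sum]
    simp only [Pi.smul_apply, MulOpposite.smul_eq_mul_unop, MulOpposite.unop_op, Finset.mul_sum]
    exact Finset.sum_congr rfl fun p _ => Finset.sum_congr rfl fun q _ => by ring
  rw [e, hn, errCov, Matrix.of_apply]
  ring

section Bounds

variable {D} {ω : Ω} {K : ℝ≥0}

lemma dotProduct_SigmaHat_ge (hK : K ≠ 0) (hE : (lamMin (D.errCov ω))⁻¹ ≤ K)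
    (s : Fin d → ℝ) :
    (K : ℝ)⁻¹ * (s ⬝ᵥ D.Γhat ω *ᵥ s) ≤ s ⬝ᵥ D.SigmaHat ω *ᵥ s := by
  rw [dotProduct_SigmaHat_mulVec, dotProduct_Γhat_mulVec]
  refine le_trans (le_of_eq ?_) (D.clusterVar_ge hK hE _)
  have hn : (n : ℝ)⁻¹ = (Real.sqrt n)⁻¹ ^ 2 := by
    rw [inv_pow, Real.sq_sqrt (Nat.cast_nonneg n)]
  rw [hn, Finset.mul_sum]
  simp_rw [mul_pow]

variable (hK : K ≠ 0)
  (hΓ : ∀ a : Fin d → ℝ, (K : ℝ)⁻¹ * (a ⬝ᵥ a) ≤ a ⬝ᵥ D.Γhat ω *ᵥ a)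
include hK hΓ

lemma det_Γhat_ne_zero : (D.Γhat ω).det ≠ 0 := by
  have hKr : (0 : ℝ) < (K : ℝ)⁻¹ := inv_pos.2 (by exact_mod_cast pos_iff_ne_zero.2 hK)
  have h : (D.Γhat ω).PosDef := by
    refine Matrix.PosDef.of_dotProduct_mulVec_pos (D.posSemidef_Γhat ω).1 fun a ha => ?_
    rw [star_trivial]
    refine lt_of_lt_of_le (mul_pos hKr ?_) (hΓ a)
    simpa using Matrix.dotProduct_star_self_pos_iff.2 ha
  exact isUnit_iff_ne_zero.1 ((Matrix.isUnit_iff_isUnit_det _).1 h.isUnit)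

variable (hE : (lamMin (D.errCov ω))⁻¹ ≤ K)
include hE

/-- The standardized score has the identity as its conditional covariance matrix. -/
lemma scoreDir_dotProduct_SigmaHat (t : Vec d) :
    D.scoreDir t ω ⬝ᵥ D.SigmaHat ω *ᵥ D.scoreDir t ω = ‖t‖ ^ 2 := by
  have hKr : (0 : ℝ) < (K : ℝ)⁻¹ := inv_pos.2 (by exact_mod_cast pos_iff_ne_zero.2 hK)
  have hpos : (D.SigmaHat ω).PosDef := by
    refine Matrix.PosDef.of_dotProduct_mulVec_pos ?_ fun a ha => ?_
    · rw [Matrix.IsHermitian, Matrix.conjTranspose_eq_transpose_of_trivial, D.transpose_SigmaHat]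
    · rw [star_trivial]
      refine lt_of_lt_of_le (mul_pos hKr (lt_of_lt_of_le (mul_pos hKr ?_) (hΓ a)))
        (dotProduct_SigmaHat_ge hK hE a)
      simpa using Matrix.dotProduct_star_self_pos_iff.2 ha
  have hGt : ((D.Γhat ω)⁻¹)ᵀ = (D.Γhat ω)⁻¹ := by
    rw [Matrix.transpose_nonsing_inv, D.transpose_Γhat]
  have hΩ : (D.sandwich ω).PosSemidef := by
    have := hpos.posSemidef.conjTranspose_mul_mul_same (D.Γhat ω)⁻¹
    rwa [Matrix.conjTranspose_eq_transpose_of_trivial, hGt] at this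
  have hGdet : (D.Γhat ω)⁻¹.det ≠ 0 := by
    rw [Matrix.det_nonsing_inv, Ring.inverse_eq_inv']
    exact inv_ne_zero (det_Γhat_ne_zero hK hΓ)
  have hdet : (D.sandwich ω).det ≠ 0 := by
    rw [sandwich, Matrix.det_mul, Matrix.det_mul]
    exact mul_ne_zero (mul_ne_zero hGdet
      (isUnit_iff_ne_zero.1 ((Matrix.isUnit_iff_isUnit_det _).1 hpos.isUnit))) hGdet
  have hone := invSqrt_mul_mul_invSqrt hΩ hdet
  have hBt := transpose_invSqrt (D.sandwich ω)
  set B := invSqrt (D.sandwich ω) with hB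
  calc D.scoreDir t ω ⬝ᵥ D.SigmaHat ω *ᵥ D.scoreDir t ω
      = t.ofLp ⬝ᵥ (B * D.sandwich ω * B) *ᵥ t.ofLp := by
        have e1 : D.scoreDir t ω = ((D.Γhat ω)⁻¹ * B) *ᵥ t.ofLp := by
          rw [scoreDir, Matrix.mulVec_mulVec]
        have e2 : ((D.Γhat ω)⁻¹ * B)ᵀ = B * (D.Γhat ω)⁻¹ := by
          rw [Matrix.transpose_mul, hBt, hGt]
        rw [e1, Matrix.mulVec_mulVec, dotProduct_comm, Matrix.dotProduct_mulVec,
          ← Matrix.mulVec_transpose, e2, Matrix.mulVec_mulVec, dotProduct_comm]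
        simp only [sandwich, Matrix.mul_assoc]
    _ = ‖t‖ ^ 2 := by
        rw [hone, Matrix.one_mulVec, EuclideanSpace.real_norm_sq_eq]
        simp [dotProduct, sq]

lemma clusterVar_weight (t : Vec d) : D.clusterVar ω (D.weight t ω) = ‖t‖ ^ 2 := by
  rw [← scoreDir_dotProduct_SigmaHat hK hΓ hE t, dotProduct_SigmaHat_mulVec]
  rfl

/-- The fourth powers in Lyapunov's condition are controlled by the largest leverage. -/
lemma sum_weight_pow_four_le {δ : ℝ} (hv : ∀ i, ‖D.vhat i ω‖ ≤ δ * Real.sqrt n) (t : Vec d) :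
    ∑ i, D.weight t ω i ^ 4 ≤ δ ^ 2 * K ^ 3 * ‖t‖ ^ 4 := by
  have hKr : (0 : ℝ) < K := by exact_mod_cast pos_iff_ne_zero.2 hK
  set s := D.scoreDir t ω with hs
  have hsq : ∑ i, D.weight t ω i ^ 2 ≤ K * ‖t‖ ^ 2 := by
    have h := D.clusterVar_ge hK hE (D.weight t ω)
    rw [clusterVar_weight hK hΓ hE] at h
    rwa [inv_mul_le_iff₀ hKr] at h
  have hss : s ⬝ᵥ s ≤ K ^ 2 * ‖t‖ ^ 2 := by
    have h1 := hΓ s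
    have h2 := dotProduct_SigmaHat_ge hK hE s
    rw [scoreDir_dotProduct_SigmaHat hK hΓ hE t] at h2
    rw [inv_mul_le_iff₀ hKr] at h1 h2
    nlinarith [mul_le_mul_of_nonneg_left h2 hKr.le]
  have hmax : ∀ i, D.weight t ω i ^ 2 ≤ δ ^ 2 * (K ^ 2 * ‖t‖ ^ 2) := by
    intro i
    have hn : 0 < Real.sqrt n := Real.sqrt_pos.2 (by exact_mod_cast i.pos)
    have hcs : (∑ p, s p * D.vhat i ω p) ^ 2 ≤ (s ⬝ᵥ s) * ‖D.vhat i ω‖ ^ 2 := by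
      rw [EuclideanSpace.real_norm_sq_eq]
      refine (Finset.sum_mul_sq_le_sq_mul_sq _ _ _).trans_eq ?_
      simp [dotProduct, sq]
    have hv2 : ‖D.vhat i ω‖ ^ 2 ≤ δ ^ 2 * n := by
      calc ‖D.vhat i ω‖ ^ 2 ≤ (δ * Real.sqrt n) ^ 2 := by gcongr; exact hv i
        _ = _ := by rw [mul_pow, Real.sq_sqrt (Nat.cast_nonneg n)]
    have hn0 : (0 : ℝ) < n := by exact_mod_cast i.pos
    have hss0 : 0 ≤ s ⬝ᵥ s := Finset.sum_nonneg fun p _ => mul_self_nonneg _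
    calc D.weight t ω i ^ 2 = (n : ℝ)⁻¹ * (∑ p, s p * D.vhat i ω p) ^ 2 := by
          rw [weight, mul_pow, inv_pow, Real.sq_sqrt (Nat.cast_nonneg n)]
      _ ≤ (n : ℝ)⁻¹ * ((K ^ 2 * ‖t‖ ^ 2) * (δ ^ 2 * n)) := by
          refine mul_le_mul_of_nonneg_left (hcs.trans ?_) (by positivity)
          exact mul_le_mul hss hv2 (by positivity) (by positivity)
      _ = _ := by field_simp
  calc ∑ i, D.weight t ω i ^ 4 = ∑ i, D.weight t ω i ^ 2 * D.weight t ω i ^ 2 :=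
        Finset.sum_congr rfl fun i _ => by ring
    _ ≤ ∑ i, δ ^ 2 * (K ^ 2 * ‖t‖ ^ 2) * D.weight t ω i ^ 2 :=
        Finset.sum_le_sum fun i _ => mul_le_mul_of_nonneg_right (hmax i) (sq_nonneg _)
    _ = δ ^ 2 * (K ^ 2 * ‖t‖ ^ 2) * ∑ i, D.weight t ω i ^ 2 := by rw [Finset.mul_sum]
    _ ≤ δ ^ 2 * (K ^ 2 * ‖t‖ ^ 2) * (K * ‖t‖ ^ 2) :=
        mul_le_mul_of_nonneg_left hsq (by positivity)
    _ = _ := by ring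

end Bounds

end PLSample

/-! ### Convergence in distribution -/

lemma norm_integral_le_add_of_forall_notMem {Ω : Type*} [MeasurableSpace Ω] {μ : Measure Ω}
    [IsProbabilityMeasure μ] {f : Ω → ℂ} {B : Set Ω} {r ε : ℝ} (hr : 0 ≤ r) (hε : 0 ≤ ε)
    (hf : ∀ ω, ‖f ω‖ ≤ 2) (hB : ∀ᵐ ω ∂μ, ω ∉ B → ‖f ω‖ ≤ r) (hμ : μ B ≤ ENNReal.ofReal ε) :
    ‖∫ ω, f ω ∂μ‖ ≤ r + 2 * ε := by
  set B' := toMeasurable μ B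
  have hB' : MeasurableSet B' := measurableSet_toMeasurable μ B
  have hi : Integrable (B'.indicator fun _ => (2 : ℝ)) μ := (integrable_const _).indicator hB'
  calc ‖∫ ω, f ω ∂μ‖ ≤ ∫ ω, (r + B'.indicator (fun _ => (2 : ℝ)) ω) ∂μ := by
        refine norm_integral_le_of_norm_le ((integrable_const r).add hi) ?_
        filter_upwards [hB] with ω hω
        by_cases h : ω ∈ B'
        · rw [Set.indicator_of_mem h]
          linarith [hf ω]
        · rw [Set.indicator_of_notMem h, add_zero]
          exact hω fun h' => h (subset_toMeasurable μ B h')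
    _ = r + 2 * μ.real B := by
        rw [integral_add (integrable_const r) hi, integral_indicator_const _ hB', integral_const,
          measureReal_def, measureReal_def, measureReal_def, measure_toMeasurable]
        simp [mul_comm]
    _ ≤ r + 2 * ε := by
        gcongr
        exact ENNReal.toReal_le_of_le_ofReal hε hμ

namespace PLSample

variable {d k n : ℕ} {Ω : Type*} [mΩ : MeasurableSpace Ω] {μ : Measure Ω} [IsProbabilityMeasure μ]
  {β : Vec d} (D : PLSample d k n μ β)

lemma measurable_standardized :
    Measurable fun ω => act (invSqrt (D.sandwich ω)) (Real.sqrt n • (D.βhat ω - β)) :=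
  Measurable.act (measurable_invSqrt.comp (D.measurable_sandwich.mono D.𝒳𝒲_le le_rfl))
    ((D.measurable_βhat.sub_const β).const_smul (Real.sqrt n))

omit [IsProbabilityMeasure μ] in
lemma measurable_cexp_weight (t : Vec d) :
    Measurable[D.𝒳𝒲.prod inferInstance] (Function.uncurry fun ω (e : Fin n → ℝ) =>
      Complex.exp ((∑ i, D.weight t ω i * e i : ℝ) * Complex.I)) := by
  have h : Measurable[D.𝒳𝒲.prod inferInstance] fun p : Ω × (Fin n → ℝ) =>
      ∑ i, D.weight t p.1 i * p.2 i :=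
    Finset.measurable_fun_sum _ fun i _ =>
      ((D.measurable_weight t i).comp (@measurable_fst _ _ D.𝒳𝒲 _)).mul
        ((measurable_pi_apply i).comp (@measurable_snd _ _ D.𝒳𝒲 _))
  exact (by fun_prop : Measurable fun r : ℝ => Complex.exp (r * Complex.I)).comp h

lemma integrable_cexp_inner_standardized_score (t : Vec d) :
    Integrable (fun ω => Complex.exp ((∑ i, D.weight t ω i * D.u i ω : ℝ) * Complex.I)) μ := by
  have hm : Measurable fun ω => ∑ i, D.weight t ω i * D.u i ω :=
    Finset.measurable_fun_sum _ fun i _ =>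
      ((D.measurable_weight t i).mono D.𝒳𝒲_le le_rfl).mul (D.measurable_u i)
  refine Integrable.of_bound (C := 1) (((by fun_prop :
    Measurable fun r : ℝ => Complex.exp (r * Complex.I)).comp hm).aestronglyMeasurable)
    (ae_of_all _ fun ω => ?_)
  exact (Complex.norm_exp_ofReal_mul_I _).le

/-- Finite-sample bound on the distance between the characteristic function of the standardized
estimator and that of the standard normal law; `B` is the event that the design is ill-behaved. -/
lemma norm_charFun_standardized_sub_le (hUV : CondIndepFamily μ D.𝒳𝒲 D.clusterUV)
    (hexo : ∀ i, μ[D.u i | D.𝒳𝒲] =ᵐ[μ] 0) (hn : 0 < n) {K : ℝ≥0} (hK : K ≠ 0) {C : ℕ}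
    (hC : D.maxClusterSize ≤ C) {η δ ε : ℝ} (hη : 0 < η) (hε : 0 ≤ ε) {B : Set Ω}
    (hB : μ B ≤ ENNReal.ofReal ε)
    (hw : ∀ ω, ω ∉ B → 0 < lamMin (D.gramW ω))
    (hmom : ∀ ω, ω ∉ B → D.momentBound ω ≤ K)
    (hΓ : ∀ ω, ω ∉ B → ∀ a : Fin d → ℝ, (K : ℝ)⁻¹ * (a ⬝ᵥ a) ≤ a ⬝ᵥ D.Γhat ω *ᵥ a)
    (hv : ∀ ω, ω ∉ B → ∀ i, ‖D.vhat i ω‖ ≤ δ * Real.sqrt n) (t : Vec d) :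
    ‖charFun (μ.map fun ω => act (invSqrt (D.sandwich ω)) (Real.sqrt n • (D.βhat ω - β))) t
        - Complex.exp (-(‖t‖ : ℂ) ^ 2 / 2)‖
      ≤ 2 * η * ‖t‖ ^ 2 + (2 / η + 1) * (C ^ 3 * K * (δ ^ 2 * K ^ 3 * ‖t‖ ^ 4)) + 4 * ε := by
  set E : ℝ → ℂ := fun r => Complex.exp (r * Complex.I) with hE
  have hEm : Measurable E := by fun_prop
  have hE1 : ∀ r, ‖E r‖ = 1 := Complex.norm_exp_ofReal_mul_I
  set Z := fun ω => act (invSqrt (D.sandwich ω)) (Real.sqrt n • (D.βhat ω - β)) with hZ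
  set Z' := fun ω => act (invSqrt (D.sandwich ω)) (act (D.Γhat ω)⁻¹ (D.S ω)) with hZ'
  have hZm : Measurable Z := D.measurable_standardized
  have hinner : ∀ ω, E (inner ℝ (Z' ω) t) = E (∑ i, D.weight t ω i * D.u i ω) := fun ω => by
    rw [hZ', inner_standardized_score]
  have hZi : Integrable (fun ω => E (inner ℝ (Z ω) t)) μ :=
    Integrable.of_bound (C := 1) (hEm.comp (hZm.inner measurable_const)).aestronglyMeasurable
      (ae_of_all _ fun ω => (hE1 _).le)
  have hZ'i : Integrable (fun ω => E (inner ℝ (Z' ω) t)) μ := by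
    simp_rw [hinner]
    exact D.integrable_cexp_inner_standardized_score t
  set ψ : Ω → ℂ := fun ω => ∫ e : Fin n → ℝ, E (∑ i, D.weight t ω i * e i)
    ∂condLaw D.𝒳𝒲 D.Uvec μ ω with hψ
  set c : ℂ := Complex.exp (-(‖t‖ : ℂ) ^ 2 / 2) with hc
  have hc1 : ‖c‖ ≤ 1 := by
    have : -(‖t‖ : ℂ) ^ 2 / 2 = ((-‖t‖ ^ 2 / 2 : ℝ) : ℂ) := by push_cast; ring
    rw [hc, this, Complex.norm_exp_ofReal, Real.exp_le_one_iff]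
    have := sq_nonneg ‖t‖
    linarith
  have hψ1 : ∀ ω, ‖ψ ω‖ ≤ 1 := fun ω => by
    have := norm_integral_le_of_norm_le_const (μ := condLaw D.𝒳𝒲 D.Uvec μ ω) (C := 1)
      (ae_of_all _ fun e : Fin n → ℝ => (hE1 (∑ i, D.weight t ω i * e i)).le)
    simpa using this
  have hψi : Integrable ψ μ :=
    integrable_condExp.congr (condExp_ae_eq_integral_condLaw D.𝒳𝒲_le D.measurable_Uvec
      (D.measurable_cexp_weight t).stronglyMeasurable
      (D.integrable_cexp_inner_standardized_score t))
  have hψint : ∫ ω, E (inner ℝ (Z' ω) t) ∂μ = ∫ ω, ψ ω ∂μ := by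
    simp_rw [hinner]
    exact (integral_condLaw D.𝒳𝒲_le D.measurable_Uvec
      (D.measurable_cexp_weight t).stronglyMeasurable
      (D.integrable_cexp_inner_standardized_score t)).symm
  have hcf : charFun (μ.map Z) t = ∫ ω, E (inner ℝ (Z ω) t) ∂μ := by
    rw [charFun_apply, integral_map hZm.aemeasurable]
    exact (Measurable.aestronglyMeasurable (by fun_prop))
  have hstep : charFun (μ.map Z) t - c
      = (∫ ω, (E (inner ℝ (Z ω) t) - E (inner ℝ (Z' ω) t)) ∂μ) + ∫ ω, (ψ ω - c) ∂μ := by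
    rw [integral_sub hZi hZ'i, integral_sub hψi (integrable_const c), hcf, hψint, integral_const,
      probReal_univ, one_smul, sub_add_sub_cancel]
  set r : ℝ := 2 * η * ‖t‖ ^ 2 + (2 / η + 1) * (C ^ 3 * K * (δ ^ 2 * K ^ 3 * ‖t‖ ^ 4)) with hr
  have hr0 : 0 ≤ r := by positivity
  have h1 : ‖∫ ω, (E (inner ℝ (Z ω) t) - E (inner ℝ (Z' ω) t)) ∂μ‖ ≤ 0 + 2 * ε := by
    refine norm_integral_le_add_of_forall_notMem le_rfl hε (fun ω => ?_)
      (ae_of_all _ fun ω hω => ?_) hB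
    · refine (norm_sub_le _ _).trans ?_
      rw [hE1, hE1]; norm_num
    · have hlam := (lamMin_pos_iff_det_ne_zero (D.posSemidef_Γhat ω)).2
        (det_Γhat_ne_zero hK (hΓ ω hω))
      have : Z ω = Z' ω := by
        simp only [hZ, hZ', D.sqrt_smul_βhat_sub ω (hw ω hω) hlam]
      rw [this, sub_self, norm_zero]
  have h2 : ‖∫ ω, (ψ ω - c) ∂μ‖ ≤ r + 2 * ε := by
    refine norm_integral_le_add_of_forall_notMem hr0 hε (fun ω => ?_) ?_ hB
    · refine (norm_sub_le _ _).trans ?_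
      linarith [hψ1 ω]
    · filter_upwards [D.ae_norm_integral_cexp_sub_le hUV hexo] with ω hω hωB
      have hm := D.condLExp_le_of_momentBound_le (hmom ω hωB)
      have herr := (hm ⟨0, hn⟩).2.2.1
      have hG := hΓ ω hωB
      have h := hω K C η hη hC (fun i => (hm i).1) (D.weight t ω)
      rw [clusterVar_weight hK hG herr] at h
      have h4 := sum_weight_pow_four_le hK hG herr (hv ω hωB) t
      refine le_trans (le_of_eq ?_) (h.trans ?_)
      · simp only [hψ, hc, hE]
        push_cast
        rfl
      · have : 0 ≤ 2 / η + 1 := by positivity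
        rw [hr]
        gcongr
  rw [hstep]
  refine (norm_add_le _ _).trans ?_
  linarith

end PLSample

theorem theorem3p1 {d : ℕ} {k : ℕ → ℕ} {Ω : ℕ → Type*} [∀ n, MeasurableSpace (Ω n)]
    (μ : ∀ n, Measure (Ω n)) [∀ n, IsProbabilityMeasure (μ n)] (β : Vec d)
    (D : ∀ n, PLSample d (k n) n (μ n) β)
    (h₁ : SamplingAssumption D) (h₂ : DesignAssumption D) (h₃ : ExogeneityAssumption D) :
    (∀ n ω, 0 < lamMin ((D n).gramW ω) → 0 < lamMin ((D n).Γhat ω) →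
      Real.sqrt n • ((D n).βhat ω - β) = act ((D n).Γhat ω)⁻¹ ((D n).S ω)) ∧
    TendstoInDistribution
      (fun n ω => act (invSqrt ((D n).sandwich ω)) (Real.sqrt n • ((D n).βhat ω - β)))
      atTop (id : Vec d → Vec d) μ (ProbabilityTheory.stdGaussian (Vec d)) := by
  refine ⟨fun n ω hw hΓ => (D n).sqrt_smul_βhat_sub ω hw hΓ,
    fun n => (D n).measurable_standardized.aemeasurable, aemeasurable_id, ?_⟩
  refine ProbabilityMeasure.tendsto_iff_tendsto_charFun.2 fun t => ?_
  simp only [ProbabilityMeasure.coe_mk, Measure.map_id, charFun_stdGaussian]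
  refine Metric.tendsto_atTop'.2 fun ε hε => ?_
  suffices h : ∀ᶠ n in atTop, ‖charFun ((μ n).map fun ω =>
      act (invSqrt ((D n).sandwich ω)) (Real.sqrt n • ((D n).βhat ω - β))) t
        - Complex.exp (-(‖t‖ : ℂ) ^ 2 / 2)‖ < ε by
    obtain ⟨N, hN⟩ := eventually_atTop.1 h
    exact ⟨N, fun n hn => by rw [dist_eq_norm]; exact hN n hn.le⟩
  -- Each of four exceptional events gets probability `ε / 64`; their union counts four times.
  set ε' : ℝ≥0∞ := ENNReal.ofReal (ε / 64) with hε'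
  have hε'0 : 0 < ε' := ENNReal.ofReal_pos.2 (by positivity)
  obtain ⟨K₀, hK₀⟩ := h₂.moments ε' hε'0
  obtain ⟨K₁, hK₁0, hK₁⟩ := PLSample.exists_eventually_measure_Γhat_lt_le h₁ h₂ h₃ hε'0
  obtain ⟨C, hC⟩ := PLSample.exists_eventually_le_of_isBigO_one h₁.bounded_clusters
  set K : ℝ≥0 := max K₀ K₁ with hKdef
  have hK : K ≠ 0 := ((pos_iff_ne_zero.2 hK₁0).trans_le (le_max_right _ _)).ne'
  -- `η` makes the second-moment part of the Gaussian approximation error small; given `η`, the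
  -- leverage bound `δ` makes the fourth-moment part small.
  set η : ℝ := ε / (8 * (‖t‖ ^ 2 + 1)) with hηdef
  have hη : 0 < η := by positivity
  have hη' : 2 * η * ‖t‖ ^ 2 ≤ ε / 4 := by
    rw [hηdef]
    field_simp
    nlinarith [sq_nonneg ‖t‖]
  set A : ℝ := (2 / η + 1) * (C ^ 3 * K * (K ^ 3 * ‖t‖ ^ 4)) with hA
  have hA0 : 0 ≤ A := by positivity
  set δ : ℝ := Real.sqrt (ε / (4 * (A + 1))) with hδdef
  have hδ : 0 < δ := Real.sqrt_pos.2 (by positivity)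
  have hδ' : (2 / η + 1) * (C ^ 3 * K * (δ ^ 2 * K ^ 3 * ‖t‖ ^ 4)) ≤ ε / 4 := by
    have e : (2 / η + 1) * (C ^ 3 * K * (δ ^ 2 * K ^ 3 * ‖t‖ ^ 4)) = A * δ ^ 2 := by
      rw [hA]; ring
    rw [e, hδdef, Real.sq_sqrt (by positivity)]
    field_simp
    linarith
  filter_upwards [hK₀, hK₁, hC, PLSample.eventually_measure_gramW_singular_le h₂ hε'0,
    (h₃.leverage δ hδ).eventually_le_const hε'0, eventually_gt_atTop 0]
    with n hmom hΓ hCn hw hlev hn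
  set B₁ := {ω | ¬ 0 < lamMin ((D n).gramW ω)}
  set B₂ := {ω | (K₀ : ℝ≥0∞) < (D n).momentBound ω}
  set B₃ := {ω | ¬ ∀ a : Fin d → ℝ, (K₁ : ℝ)⁻¹ * (a ⬝ᵥ a) ≤ a ⬝ᵥ (D n).Γhat ω *ᵥ a}
  set B₄ := {ω | δ < |(⨆ i, ‖(D n).vhat i ω‖) / Real.sqrt n|}
  have hB : μ n (B₁ ∪ B₂ ∪ B₃ ∪ B₄) ≤ ENNReal.ofReal (ε / 16) := by
    calc μ n (B₁ ∪ B₂ ∪ B₃ ∪ B₄) ≤ ε' + ε' + ε' + ε' :=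
          (measure_union_le _ _).trans (add_le_add ((measure_union_le _ _).trans
            (add_le_add ((measure_union_le _ _).trans (add_le_add hw hmom)) hΓ)) hlev)
      _ = ENNReal.ofReal (ε / 16) := by
          rw [hε', ← ENNReal.ofReal_add (by positivity) (by positivity),
            ← ENNReal.ofReal_add (by positivity) (by positivity),
            ← ENNReal.ofReal_add (by positivity) (by positivity)]
          congr 1; ring
  have hsub : ∀ ω, ω ∉ B₁ ∪ B₂ ∪ B₃ ∪ B₄ → ω ∉ B₁ ∧ ω ∉ B₂ ∧ ω ∉ B₃ ∧ ω ∉ B₄ := fun ω h => by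
    simp only [Set.mem_union, not_or] at h
    tauto
  have hsqrt : 0 < Real.sqrt n := Real.sqrt_pos.2 (by exact_mod_cast hn)
  have key := (D n).norm_charFun_standardized_sub_le (h₁.indep_uV n) (h₃.exogenous n) hn hK
    (by exact_mod_cast hCn) hη (δ := δ) (ε := ε / 16) (by positivity) hB
    (fun ω hω => not_not.1 (hsub ω hω).1)
    (fun ω hω => (not_lt.1 (hsub ω hω).2.1).trans (by exact_mod_cast le_max_left K₀ K₁))
    (fun ω hω a => ?_) (fun ω hω i => ?_) t
  · linarith
  · refine le_trans (mul_le_mul_of_nonneg_right ?_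
      (Finset.sum_nonneg fun p _ => mul_self_nonneg _)) (not_not.1 (hsub ω hω).2.2.1 a)
    have h1 : (0 : ℝ) < K₁ := by exact_mod_cast pos_iff_ne_zero.2 hK₁0
    exact inv_anti₀ h1 (by exact_mod_cast le_max_right K₀ K₁)
  · have h : (⨆ i, ‖(D n).vhat i ω‖) / Real.sqrt n ≤ δ :=
      (le_abs_self _).trans (not_lt.1 (hsub ω hω).2.2.2)
    rw [div_le_iff₀ hsqrt] at h
    exact (le_ciSup (f := fun i => ‖(D n).vhat i ω‖) (Set.finite_range _).bddAbove i).trans h
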